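/- **Setting.** Let $p$ be a prime, $q=p^a$ with $a\ge 1$, let $n>1$ and $2\le m\le n-1$. Let $\mathbb{C}_p$ be the completion of $\overline{\mathbb{Q}}_p$, with $\mathrm{ord}_p(p)=1$ and $\mathrm{ord}_p(0)=\infty$; let $\mathbb{Q}_q\subset\mathbb{C}_p$ be the unramified extension of $\mathbb{Q}_p$ of degree $a$, and $\zeta_p\in\mathbb{C}_p$ a primitive $p$-th root of unity. Let $\gamma\in\mathbb{Q}_p(\zeta_p)$ be a zero of $\sum_{k\ge0}x^{p^k}/p^k$ with $\mathrm{ord}_p\gamma=\frac1{p-1}$, let $\tilde\gamma\in\mathbb{C}_p$ satisfy $\tilde\gamma^n=\gamma$, let $K=\mathbb{Q}_q(\zeta_p,\tilde\gamma)$, and let $\mathcal{O}=\mathbb{Z}_q[\tilde\gamma]$ be its ring of integers. Let $\sigma$ be the automorphism of $K$ over $\mathbb{Q}_p$ that extends the Frobenius generator of $\mathrm{Gal}(\mathbb{Q}_q/\mathbb{Q}_p)$ and fixes $\zeta_p$ and $\tilde\gamma$. Let $t\in\mathbb{F}_q^*$, with Teichmüller representative $\bar t\in\mathbb{Q}_q$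 (so $\bar t^{\,q}=\bar t\ne0$). Let $\Theta_\infty(x)=E(\gamma x)$ with $E(x)=\exp\big(\sum_{k\ge0}x^{p^k}/p^k\big)$, let $F_t(x,y)=\Theta_\infty(x^n)\,\Theta_\infty(y)\,\Theta_\infty\big(\tfrac{\bar t}{xy}\big)$, and for $(u,v)\in\mathbb{Z}^2$ let $\omega(u,v)=\frac un+v+\frac{2n+1}n\max\{0,-u,-v\}$. Let $$\mathcal{C}_0=\Big\{\sum_{(u,v)\in\mathbb{Z}^2}\xi(u,v)\,\tilde\gamma^{\,n\omega(u,v)}x^uy^v:\ \xi(u,v)\in\mathcal{O},\ \xi(u,v)\to0\text{ as }\omega(u,v)\to\infty\Big\}.$$ Let $\psi_p\big(\sum c(u,v)x^uy^v\big)=\sum c(pu,pv)x^uy^v$ and $\alpha_1=\sigma^{-1}\circ\psi_p\circ F_t$, where $F_t$ acts by multiplication and $\sigma^{-1}$ acts on coefficients. With $\gamma_i=\sum_{k=0}^i\gamma^{p^k}/p^k$, let $$D_x=x\tfrac{\partial}{\partial x}+\sum_{i\ge0}\gamma_ip^i\Big(nx^{np^i}-\frac{\sigma^i(\bar t)}{x^{p^i}y^{p^i}}\Big),\qquad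 D_y=y\tfrac{\partial}{\partial y}+\sum_{i\ge0}\gamma_ip^i\Big(y^{p^i}-\frac{\sigma^i(\bar t)}{x^{p^i}y^{p^i}}\Big),$$ and $H^2=\mathcal{C}_0/(D_x\mathcal{C}_0+D_y\mathcal{C}_0)$. Let $\tilde\varepsilon_i=\tilde\gamma^{\,i}x^i$ for $0\le i\le n$ and $\tilde\varepsilon_i=\tilde\gamma^{\,i}x^{i-n}y$ for $n+1\le i\le2n$. For integers $i,j$ put $\alpha_{i,j}=i-pj+n\lceil\frac{pj-i}n\rceil$. Let $S_m$ be the group of permutations of $\{0,\dots,m-1\}$ and $S_m^0\subseteq S_m$ the set of those $\delta$ for which $\sum_{i=0}^{m-1}\alpha_{i,\delta(i)}$ is minimal. Let $V(x_0,\dots,x_{m-1})$ be the $m\times m$ matrix with entries $V_{ij}=\prod_{k=0}^{j-1}(x_i-k)^2$, $0\le i,j\le m-1$. **Theorem 3.5.** Assume that $\det V(x_0,\dots,x_{m-1})\ne0$ for all distinct integers $x_0,\dots,x_{m-1}$ with $0\le x_i\le n-1$, and let $M_n(m)$ be the maximum of $|\det V(x_0,\dots,x_{m-1})|$ over all such $x_0,\dots,x_{m-1}$.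 Assume $p>\max\{M_n(m),\,2n^3-n^2-n+1\}$. Then $D_x$ and $D_y$ map $\mathcal{C}_0$ into itself, the classes of $\tilde\varepsilon_0,\dots,\tilde\varepsilon_{2n}$ form an $\mathcal{O}$-basis of $H^2$, and there is a unique matrix $A=(A_{ij})_{0\le i,j\le2n}$ over $\mathcal{O}$ with $\alpha_1(\tilde\varepsilon_i)=\sum_{j=0}^{2n}A_{ij}\tilde\varepsilon_j$ in $H^2$ for all $i$. If $\det(I-AT)=1+b_1T+\dots+b_{2n+1}T^{2n+1}$, then for every $\delta\in S_m^0$ $$\mathrm{ord}_p\,b_m=\frac{m(m-1)}{2n}+\frac{2n+1}{n(p-1)}\sum_{i=0}^{m-1}\alpha_{i,\delta(i)}.$$ -/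

import Mathlib

open Filter Topology

noncomputable section

namespace ToricNP

/-! ### The `p`-adic fields -/

section Fields

variable (p : ℕ) [Fact p.Prime]

/-- `ℚ_q` for `q = p ^ a`: the unramified extension of `ℚ_p` of degree `a` inside `ℂ_p`,
generated by the Teichmüller representatives of `𝔽_q`, i.e. by the solutions of `z ^ q = z`. -/
def Qq (a : ℕ) : IntermediateField ℚ_[p] ℂ_[p] :=
  IntermediateField.adjoin ℚ_[p] {z : ℂ_[p] | z ^ p ^ a = z}

/-- `Ω₁ = ℚ_p(ζ_p)`. -/
def Omega1 : IntermediateField ℚ_[p] ℂ_[p] :=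
  IntermediateField.adjoin ℚ_[p] {z : ℂ_[p] | z ^ p = 1}

/-- `Ω₀(γ̃)`, where `Ω₀ = ℚ_q(ζ_p)`. Its ring of integers `ℤ_q[γ̃]` is the set of elements of
norm at most `1`. -/
def Omega0 (a : ℕ) (γt : ℂ_[p]) : IntermediateField ℚ_[p] ℂ_[p] :=
  Qq p a ⊔ Omega1 p ⊔ IntermediateField.adjoin ℚ_[p] {γt}

/-- `γ̃` as an element of `Ω₀(γ̃)`. -/
def gen (a : ℕ) (γt : ℂ_[p]) : Omega0 p a γt :=
  ⟨γt, (le_sup_right : IntermediateField.adjoin ℚ_[p] {γt} ≤ Omega0 p a γt)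
    (IntermediateField.mem_adjoin_simple_self ℚ_[p] γt)⟩

/-- `σ` is the Frobenius generator of `Gal(ℚ_q/ℚ_p)` (`z ↦ z ^ p` on Teichmüller
representatives), extended to `Ω₀(γ̃)` by `σ(ζ_p) = ζ_p` and `σ(γ̃) = γ̃`. These conditions
determine `σ`. -/
def IsFrobenius (a : ℕ) (γt : ℂ_[p])
    (σ : Omega0 p a γt ≃ₐ[ℚ_[p]] Omega0 p a γt) : Prop :=
  (∀ z : Omega0 p a γt, z ^ p ^ a = z → σ z = z ^ p) ∧
  (∀ z : Omega0 p a γt, z ^ p = 1 → σ z = z) ∧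
  σ (gen p a γt) = gen p a γt

/-- The additive valuation `ord_p`, with values in `ℝ ∪ {∞}`; here `‖p‖ = 1 / p`, so that
`ord_p p = 1`. -/
def ordp {K : Type*} [NormedField K] (x : K) : WithTop ℝ :=
  open Classical in if x = 0 then ⊤ else ((-Real.logb p ‖x‖ : ℝ) : WithTop ℝ)

/-- `γ` is a zero of `∑_k x^{p^k}/p^k` in `Ω₁` with `ord_p γ = 1/(p-1)`. -/
def IsSplittingRoot (γ : ℂ_[p]) : Prop :=
  γ ∈ Omega1 p ∧
  HasSum (fun k : ℕ => γ ^ p ^ k / (p : ℂ_[p]) ^ k) 0 ∧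
  ordp p γ = ((1 / ((p : ℝ) - 1) : ℝ) : WithTop ℝ)

end Fields

/-! ### The splitting function and the Frobenius operator -/

/-- `∑_k x^{p^k}/p^k`. -/
def artinHasseLog (p : ℕ) : PowerSeries ℚ :=
  open Classical in PowerSeries.mk fun j => if ∃ k : ℕ, j = p ^ k then 1 / (j : ℚ) else 0

/-- The Artin–Hasse series `E(x) = exp(∑_k x^{p^k}/p^k)`. -/
def artinHasse (p : ℕ) : PowerSeries ℚ :=
  (PowerSeries.exp ℚ).subst (artinHasseLog p)

section Operators

variable {K : Type*} [NormedField K] [CharZero K]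

/-- The coefficient `a_k` of `x^k` in the splitting function `Θ_∞(x) = E(γ x)`. -/
def splitCoeff (p : ℕ) (γ : K) (k : ℕ) : K :=
  ((PowerSeries.coeff k (artinHasse p) : ℚ) : K) * γ ^ k

/-- The coefficient `B(w)` of `x^{w.1} y^{w.2}` in
`F_t(x,y) = Θ_∞(x^n) Θ_∞(y) Θ_∞(t̄/(xy))`: the sum of `t̄^k a_k a_l a_m` over the triples
`(k,l,m)` of natural numbers with `n l - k = w.1` and `m - k = w.2`. -/
def frobSeries (p n : ℕ) (γ tbar : K) (w : ℤ × ℤ) : K :=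
  ∑' s : {s : ℕ × ℕ × ℕ // (n : ℤ) * s.2.1 - s.1 = w.1 ∧ (s.2.2 : ℤ) - s.1 = w.2},
    tbar ^ s.1.1 *
      (splitCoeff p γ s.1.1 * splitCoeff p γ s.1.2.1 * splitCoeff p γ s.1.2.2)

/-- The product of two series `∑ F(w) x^{w.1} y^{w.2}` and `∑ c(w) x^{w.1} y^{w.2}`. -/
def mulSeries (F c : ℤ × ℤ → K) (w : ℤ × ℤ) : K :=
  ∑' u : ℤ × ℤ, F (w - u) * c u

/-- `ψ_p`: the coefficient at `(a,b)` of `ψ_p(c)` is the coefficient of `c` at `(pa,pb)`. -/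
def psi (p : ℕ) (c : ℤ × ℤ → K) (w : ℤ × ℤ) : K :=
  c ((p : ℤ) * w.1, (p : ℤ) * w.2)

/-- `α₁ = σ⁻¹ ∘ ψ_p ∘ F_t`. -/
def alpha1 (p n : ℕ) (σ : K ≃+* K) (γ tbar : K) (c : ℤ × ℤ → K) (w : ℤ × ℤ) : K :=
  σ.symm (psi p (mulSeries (frobSeries p n γ tbar) c) w)

/-- `γ_i = ∑_{k=0}^{i} γ^{p^k}/p^k`. -/
def gammaSum (p : ℕ) (γ : K) (i : ℕ) : K :=
  ∑ k ∈ Finset.range (i + 1), γ ^ p ^ k / (p : K) ^ k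

/-- `D_x = x ∂/∂x + ∑_i γ_i p^i (n x^{n p^i} - σ^i(t̄) / (x^{p^i} y^{p^i}))`. -/
def Dx (p n : ℕ) (σ : K ≃+* K) (γ tbar : K) (c : ℤ × ℤ → K) (w : ℤ × ℤ) : K :=
  (w.1 : K) * c w + ∑' i : ℕ, gammaSum p γ i * (p : K) ^ i *
    ((n : K) * c (w.1 - (n : ℤ) * (p : ℤ) ^ i, w.2)
      - (σ : K → K)^[i] tbar * c (w.1 + (p : ℤ) ^ i, w.2 + (p : ℤ) ^ i))

/-- `D_y = y ∂/∂y + ∑_i γ_i p^i (y^{p^i} - σ^i(t̄) / (x^{p^i} y^{p^i}))`. -/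
def Dy (p : ℕ) (σ : K ≃+* K) (γ tbar : K) (c : ℤ × ℤ → K) (w : ℤ × ℤ) : K :=
  (w.2 : K) * c w + ∑' i : ℕ, gammaSum p γ i * (p : K) ^ i *
    (c (w.1, w.2 - (p : ℤ) ^ i)
      - (σ : K → K)^[i] tbar * c (w.1 + (p : ℤ) ^ i, w.2 + (p : ℤ) ^ i))

end Operators

/-! ### The Banach module `𝒞₀` and its top cohomology -/

/-- `n ω(a,b) = a + n b + (2n+1) max{0,-a,-b}`, a non-negative integer, where `ω` is the weight
function of the triangle with vertices `(-1,-1)`, `(n,0)`, `(0,1)`. -/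
def nWeight (n : ℕ) (w : ℤ × ℤ) : ℤ :=
  w.1 + (n : ℤ) * w.2 + (2 * (n : ℤ) + 1) * max 0 (max (-w.1) (-w.2))

section Cohomology

variable {K : Type*} [NormedField K] [CharZero K]

/-- `𝒞₀`: the series `∑ ξ(a,b) γ̃^{n ω(a,b)} x^a y^b` with integral `ξ(a,b)` tending to `0`
as `ω(a,b) → ∞`. (Only finitely many lattice points have weight below a given bound, so this is
the limit along the cofinite filter.) A series is represented by its coefficients. -/
def C0 (n : ℕ) (γt : K) : Set (ℤ × ℤ → K) :=
  {c | ∃ ξ : ℤ × ℤ → K, (∀ w, ‖ξ w‖ ≤ 1) ∧ Tendsto ξ cofinite (𝓝 0) ∧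
    ∀ w, c w = ξ w * γt ^ nWeight n w}

/-- The exponent of `ε_i`: `x^i` for `0 ≤ i ≤ n` and `x^{i-n} y` for `n+1 ≤ i ≤ 2n`. -/
def epsExp (n i : ℕ) : ℤ × ℤ :=
  if i ≤ n then ((i : ℤ), 0) else ((i : ℤ) - n, 1)

/-- `ε̃_i = γ̃^{n ω(ε_i)} ε_i`. -/
def epsTilde (n : ℕ) (γt : K) (i : ℕ) : ℤ × ℤ → K :=
  Pi.single (epsExp n i) (γt ^ nWeight n (epsExp n i))

/-- `β = β'` in `H² = 𝒞₀ / (D_x 𝒞₀ + D_y 𝒞₀)`. Here `γ = γ̃ ^ n`. -/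
def Cohomologous (p n : ℕ) (σ : K ≃+* K) (γt tbar : K) (β β' : ℤ × ℤ → K) : Prop :=
  ∃ ζx ∈ C0 n γt, ∃ ζy ∈ C0 n γt,
    β = β' + Dx p n σ (γt ^ n) tbar ζx + Dy p σ (γt ^ n) tbar ζy

/-- The classes of `ε̃_0, …, ε̃_{2n}` form a basis of `H²` over the ring of integers, i.e.
`𝒞₀ = ⨁ ℤ_q[γ̃] ε̃_i ⊕ (D_x 𝒞₀ + D_y 𝒞₀)`. -/
def EpsIsBasis (p n : ℕ) (σ : K ≃+* K) (γt tbar : K) : Prop :=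
  (∀ ζ ∈ C0 n γt, Dx p n σ (γt ^ n) tbar ζ ∈ C0 n γt ∧ Dy p σ (γt ^ n) tbar ζ ∈ C0 n γt) ∧
  ∀ β ∈ C0 n γt, ∃! a : Fin (2 * n + 1) → K, (∀ j, ‖a j‖ ≤ 1) ∧
    Cohomologous p n σ γt tbar β (∑ j : Fin (2 * n + 1), a j • epsTilde n γt (j : ℕ))

/-- `A` is the matrix, with integral entries, of `α₁` on `H²`:
`α₁(ε̃_i) = ∑_j A_{ij} ε̃_j` in `H²`. -/
def IsFrobeniusMatrix (p n : ℕ) (σ : K ≃+* K) (γt tbar : K)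
    (A : Matrix (Fin (2 * n + 1)) (Fin (2 * n + 1)) K) : Prop :=
  (∀ i j, ‖A i j‖ ≤ 1) ∧
  ∀ i : Fin (2 * n + 1),
    Cohomologous p n σ γt tbar (alpha1 p n σ (γt ^ n) tbar (epsTilde n γt (i : ℕ)))
    (∑ j : Fin (2 * n + 1), A i j • epsTilde n γt (j : ℕ))

end Cohomology

/-! ### Combinatorial data -/

/-- `α_{i,j} = i - p j + n ⌈(p j - i)/n⌉`. -/
def alphaInt (p n : ℕ) (i j : ℤ) : ℤ :=
  i - p * j + n * ⌈((p : ℚ) * j - i) / n⌉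

/-- `∑_{i=0}^{m-1} α_{i,δ(i)}`. -/
def alphaSum (p n m : ℕ) (δ : Equiv.Perm (Fin m)) : ℤ :=
  ∑ i : Fin m, alphaInt p n (i : ℕ) (δ i : ℕ)

/-- The set `S_m^0` of the permutations `δ` that minimize `∑ α_{i,δ(i)}`. -/
def minPerms (p n m : ℕ) : Set (Equiv.Perm (Fin m)) :=
  {δ | ∀ δ', alphaSum p n m δ ≤ alphaSum p n m δ'}

/-- The matrix with rows `1, x_i², x_i²(x_i-1)², …, x_i²(x_i-1)²⋯(x_i-m+2)²`. -/
def vandermondeLike (m : ℕ) (x : Fin m → ℤ) : Matrix (Fin m) (Fin m) ℤ :=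
  Matrix.of fun i j => ∏ k ∈ Finset.range (j : ℕ), (x i - k) ^ 2

/-- `det V(x_0,…,x_{m-1}) ≠ 0` for all distinct integers `x_i` with `0 ≤ x_i ≤ n-1`. -/
def VandermondeAssumption (n m : ℕ) : Prop :=
  ∀ x : Fin m → ℤ, Function.Injective x → (∀ i, 0 ≤ x i ∧ x i ≤ (n : ℤ) - 1) →
    (vandermondeLike m x).det ≠ 0

/-- `M_n(m)`: the maximum of `|det V(x_0,…,x_{m-1})|` over distinct `0 ≤ x_i ≤ n-1`. -/
def maxDet (n m : ℕ) : ℕ :=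
  Finset.univ.sup fun x : Fin m ↪ Fin n =>
    (vandermondeLike m fun i => ((x i : ℕ) : ℤ)).det.natAbs

end ToricNP

end

/-! Write `π` for `γ̃`, `z` for `1/(xy)` and `W` for `nω`. Here `x` has weight 1, `y` and `z` have
weight `n`, and `W` is additive on monomials lying in a common cone of the fan of the triangle;
otherwise it drops by a positive multiple of `2n+1`. Hence multiplication on `𝒞₀` modulo `π` is that
of `R = k[x,y,z]/(xyz)`, with `k` the integers modulo `π`, and `D_x`, `D_y` reduce to multiplication
by `n x^n - t z` and `y - t z`, up to terms of degree 0. As `n` and `t` are units of `k`, these two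
elements behave as a regular sequence: modulo `y - t z` the ring has basis `x^a`, `z^c`, `x^a z`,
and modulo both it has the `2n+1` monomials `ε_i` as basis (`symbolRange_eps_normal`,
`symbol_injective`). Successive approximation in powers of `π`, together with `D_x D_y = D_y D_x`,
lifts this to `𝒞₀` and gives the basis of `H²` (`exists_decomposition`, `eq_zero_of_cohomologous`).

Integrality of the Artin–Hasse series makes the coefficient of `F_t` at `w` divisible by `π^{W(w)}`,
and `ψ_p` improves this to `π^{pW(w)}` for `α₁(ε̃_i)`. The surplus `(p-1)W(w)` shows that column `j`
of `A` is divisible by `π^{(p-1)min(j,n)}`, and that for `i < n`, `j < n-1` the leading term of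
`A_{ij}` is read off directly from the coefficient of `x^{pj-i}` in `F_t`. It is
`π^{(p-1)j+(2n+1)α_{ij}}` times a power of a Teichmüller unit over `α_{ij}!² l!`
(`coord_overconvergent`, `frobenius_entry`).

Up to sign, `b_m` is the sum of the principal `m × m` minors of `A`. Every minor except the first
one gains a further factor `π^{p-1}`, and `(2n+1)∑α ≤ (2n+1)n(n-1) < p-1`, so the first one
dominates. In its expansion the permutations in `S_m^0` have the least exponent. Their coefficients
add up to a unit times `det V` at the distinct points `α_{m-1,j}` of `[0,n-1]`: ratios of factorials
are falling factorials, and these vanish on the permutations outside `S_m^0` (`sum_leadCoeff`).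
Since `det V` is nonzero and less than `p` in absolute value, nothing cancels (`norm_leading_minor`,
`norm_coeff_det`), and `ord_p π = 1/(n(p-1))` turns the exponent into the formula. -/

namespace ToricNP

section Weights

/-! ### The graded symbol of the Koszul complex -/

/-- The depth of a lattice point: the exponent of `z` when `x^u y^v` is written as a monomial
in `x`, `y` and `z = 1 / (x y)` with exponents of minimum `0`. -/
def depth (w : ℤ × ℤ) : ℤ := max 0 (max (-w.1) (-w.2))

/-- The exponents of the monomials `ε_0, …, ε_{2n}`. -/
def IsEps (n : ℕ) (w : ℤ × ℤ) : Prop :=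
  (w.2 = 0 ∧ 0 ≤ w.1 ∧ w.1 ≤ n) ∨ (w.2 = 1 ∧ 1 ≤ w.1 ∧ w.1 ≤ n)

/-- The exponents of the monomials `x^a`, `z^c` and `x^a z`: they represent a basis of the
graded ring modulo `y - t z`. -/
def IsNormal (w : ℤ × ℤ) : Prop := w.2 ≤ 0 ∧ w.2 ≤ w.1 ∧ (-1 ≤ w.2 ∨ w.1 = w.2)

theorem nWeight_eq (n : ℕ) (w : ℤ × ℤ) :
    nWeight n w = w.1 + (n : ℤ) * w.2 + (2 * (n : ℤ) + 1) * depth w := rfl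

theorem nWeight_of_depth (n : ℕ) {u v c : ℤ} (h : max 0 (max (-u) (-v)) = c) :
    nWeight n (u, v) = u + (n : ℤ) * v + (2 * (n : ℤ) + 1) * c := by
  rw [nWeight_eq, depth, h]

/-- Passes to the monomials `x^a y^b z^c` of `k[x,y,z]/(xyz)`; in these coordinates the weight is
linear and the case analysis is about which exponent vanishes. -/
theorem exists_monomial (w : ℤ × ℤ) : ∃ a b c : ℤ, 0 ≤ a ∧ 0 ≤ b ∧ 0 ≤ c ∧
    (a = 0 ∨ b = 0 ∨ c = 0) ∧ w = (a - c, b - c) := by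
  obtain ⟨u, v⟩ := w
  refine ⟨u + depth (u, v), v + depth (u, v), depth (u, v), ?_, ?_, ?_, ?_, ?_⟩ <;>
    simp only [depth, Prod.mk.injEq] <;> omega

theorem depth_monomial {a b c : ℤ} (ha : 0 ≤ a) (hb : 0 ≤ b) (hc : 0 ≤ c)
    (h : a = 0 ∨ b = 0 ∨ c = 0) : depth (a - c, b - c) = c := by
  simp only [depth]; omega

theorem nWeight_monomial (n : ℕ) {a b c : ℤ} (ha : 0 ≤ a) (hb : 0 ≤ b) (hc : 0 ≤ c)
    (h : a = 0 ∨ b = 0 ∨ c = 0) : nWeight n (a - c, b - c) = a + n * (b + c) := by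
  rw [nWeight_eq, depth_monomial ha hb hc h]; ring

theorem nWeight_nonneg (n : ℕ) (w : ℤ × ℤ) : 0 ≤ nWeight n w := by
  obtain ⟨a, b, c, ha, hb, hc, h, rfl⟩ := exists_monomial w
  rw [nWeight_monomial n ha hb hc h]
  positivity

/-- Leading symbol of `w ↦ lam w + m x^s - t / (x y)` on the associated graded ring, on
coefficients. -/
def symbolOp {k : Type*} [CommRing k] (lam : ℤ × ℤ → ℤ) (m t : k) (s : ℤ × ℤ)
    (ζ : ℤ × ℤ → k) (w : ℤ × ℤ) : k :=
  lam w * ζ w + (if depth w = depth (w - s) then m * ζ (w - s) else 0)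
    - (if depth w = depth (w + (1, 1)) + 1 then t * ζ (w + (1, 1)) else 0)

/-! ### Independence in a single degree -/

section Injective

variable {k : Type*} [CommRing k] {n : ℕ} {t : k} {e ζ η : ℤ × ℤ → k}

/-- The degree-`d` part of `e + (n x^n - t z) ζ + (y - t z) η = 0` in `k[x,y,z]/(xyz)`. Restricting
`ζ` to normal monomials removes the trivial Koszul relation between the two elements. Each
coefficient equation is read at a monomial where all but one unknown are absent or already known to
vanish. -/
theorem symbol_injective_step (hn : 1 ≤ n) (hnu : IsUnit (n : k)) (ht : IsUnit t)
    (he : ∀ u v, ¬ IsEps n (u, v) → e (u, v) = 0) (hζ : ∀ u v, ¬ IsNormal (u, v) → ζ (u, v) = 0)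
    (d : ℤ)
    (h : ∀ u v : ℤ, nWeight n (u, v) = d →
      e (u, v) + (if (n : ℤ) ≤ u ∨ n - u ≤ -v then n * ζ (u - n, v) else 0)
        - (if u < 0 ∨ v < 0 then t * (ζ (u + 1, v + 1) + η (u + 1, v + 1)) else 0)
        + (if 1 ≤ v ∨ 1 - v ≤ -u then η (u, v - 1) else 0) = 0) :
    (∀ w, nWeight n w = d - n → ζ w = 0 ∧ η w = 0) ∧ ∀ w, nWeight n w = d → e w = 0 := by
  simp only [IsEps, IsNormal] at he hζ
  have hn' : (1 : ℤ) ≤ n := by exact_mod_cast hn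
  have cn : ∀ x : k, n * x = 0 → x = 0 := fun x hx => (hnu.mul_right_eq_zero).1 hx
  have ct : ∀ x : k, t * x = 0 → x = 0 := fun x hx => (ht.mul_right_eq_zero).1 hx
  -- Multiplying by `x^n`, `y` or `z` raises the weight by `n`, so equations in weight `d` constrain
  -- unknowns in weight `d - n`.
  have wt : ∀ a b c a' b' c' : ℤ, 0 ≤ a → 0 ≤ b → 0 ≤ c → (a = 0 ∨ b = 0 ∨ c = 0) →
      nWeight n (a - c, b - c) = d - n →
      0 ≤ a' → 0 ≤ b' → 0 ≤ c' → (a' = 0 ∨ b' = 0 ∨ c' = 0) →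
      (a' = a + n ∧ b' + c' = b + c ∨ a' = a ∧ b' + c' = b + c + 1) →
      nWeight n (a' - c', b' - c') = d := by
    intro a b c a' b' c' h1 h2 h3 h4 h5 h6 h7 h8 h9 h10
    rw [nWeight_monomial n h1 h2 h3 h4] at h5
    rw [nWeight_monomial n h6 h7 h8 h9]
    rcases h10 with ⟨h10, h11⟩ | ⟨h10, h11⟩
    · rw [h10, h11]; linarith
    · rw [h10, h11]; linarith
  -- `η` vanishes at `x^a y^b` with `b ≥ 1`, `a ≥ 1`
  have s1 : ∀ a b : ℤ, 1 ≤ a → 1 ≤ b → nWeight n (a - 0, b - 0) = d - n → η (a, b) = 0 := by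
    intro a b ha hb hw
    have := h (a - 0) (b + 1 - 0) (wt a b 0 a (b + 1) 0 (by omega) (by omega) (by omega) (by omega)
      hw (by omega) (by omega) (by omega) (by omega) (by omega))
    rw [he _ _ (by omega), hζ (a - 0 - n) (b + 1 - 0) (by omega), mul_zero, ite_self, if_neg (by omega : ¬ (_ ∨ _)),
      if_pos (by omega : (_ ∨ _))] at this
    simpa using this
  -- `η` vanishes at `y^b z^c`
  have s3 : ∀ c : ℕ, ∀ b : ℤ, 0 ≤ b → nWeight n (0 - (c : ℤ), b - c) = d - n →
      η (0 - (c : ℤ), b - c) = 0 := by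
    intro c
    induction c with
    | zero =>
      intro b hb hw
      have := h (0 - (0 : ℤ)) (b + 1 - 0) (wt 0 b 0 0 (b + 1) 0 (by omega) (by omega) (by omega)
        (by omega) (by simpa using hw) (by omega) (by omega) (by omega) (by omega) (by omega))
      rw [he _ _ (by omega), hζ (0 - 0 - n) (b + 1 - 0) (by omega), if_neg (by omega : ¬ (_ ∨ _)),
        if_neg (by omega : ¬ (_ ∨ _)), if_pos (by omega : (_ ∨ _))] at this
      simpa using this
    | succ c ih =>
      intro b hb hw
      have := h (0 - (c + 1 : ℤ)) (b + 1 - (c + 1)) (wt 0 b (c + 1) 0 (b + 1) (c + 1) (by omega)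
        (by omega) (by omega) (by omega) (by simpa using hw) (by omega) (by omega) (by omega)
        (by omega) (by omega))
      have h2 := ih (b + 1) (by omega) (by
        rw [nWeight_monomial n (by omega) (by omega) (by omega) (by omega)] at hw ⊢
        rw [← hw]; push_cast; ring)
      rw [he _ _ (by omega), hζ (0 - (c + 1 : ℤ) + 1) _ (by omega),
        if_neg (by omega : ¬ (_ ∨ _)), if_pos (by omega : (_ ∨ _)), if_pos (by omega : (_ ∨ _)),
        show (0 - (c + 1 : ℤ) + 1) = 0 - c by ring,
        show (b + 1 - (c + 1 : ℤ) + 1) = b + 1 - c by ring, h2] at this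
      have h3 : b - ((c + 1 : ℕ) : ℤ) = b + 1 - (c + 1) - 1 := by push_cast; ring
      rw [h3]
      simpa using this
  -- `ζ` vanishes at `z^c`
  have s4 : ∀ c : ℤ, 0 ≤ c → nWeight n (0 - c, 0 - c) = d - n → ζ (0 - c, 0 - c) = 0 := by
    intro c hc hw
    have := h (0 - (c + 1)) (0 - (c + 1)) (wt 0 0 c 0 0 (c + 1) (by omega)
        (by omega) (by omega) (by omega) hw (by omega) (by omega) (by omega) (by omega) (by omega))
    have h2 := s3 c.toNat 0 le_rfl (by rwa [Int.toNat_of_nonneg hc])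
    rw [Int.toNat_of_nonneg hc] at h2
    rw [he _ _ (by omega), if_neg (by omega : ¬ (_ ∨ _)), if_pos (by omega : (_ ∨ _)),
      if_neg (by omega : ¬ (_ ∨ _)), show (0 - (c + 1 : ℤ) + 1) = 0 - c by ring, h2] at this
    exact ct _ (by simpa using this)
  -- `η` vanishes at `x^a z^c`, `c ≥ 2`, `a ≥ 1`
  have s5 : ∀ a c : ℤ, 1 ≤ a → 2 ≤ c → nWeight n (a - c, 0 - c) = d - n →
      η (a - c, 0 - c) = 0 := by
    intro a c ha hc hw
    have := h (a - (c + 1)) (0 - (c + 1)) (wt a 0 c a 0 (c + 1) (by omega)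
        (by omega) (by omega) (by omega) hw (by omega) (by omega) (by omega) (by omega) (by omega))
    have h2 : ζ (a - (c + 1) - n, 0 - (c + 1)) = 0 := by
      by_cases han : a = n
      · subst han
        have := s4 (c + 1) (by omega) (by
          rw [nWeight_monomial n (by omega) (by omega) (by omega) (by omega)] at hw ⊢
          rw [← hw]; ring)
        rwa [show (n : ℤ) - (c + 1) - n = 0 - (c + 1) by ring]
      · exact hζ _ _ (by omega)
    rw [he _ _ (by omega), h2, hζ (a - (c + 1) + 1) _ (by omega), mul_zero, ite_self, if_pos (by omega : (_ ∨ _)),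
      if_neg (by omega : ¬ (_ ∨ _)), show (a - (c + 1 : ℤ) + 1) = a - c by ring,
      show (0 - (c + 1 : ℤ) + 1) = 0 - c by ring] at this
    exact ct _ (by simpa using this)
  -- At `x^{a+n}` only `n x^n ζ` contributes; this is where `n` must be a unit.
  have s6 : ∀ a : ℤ, 1 ≤ a → nWeight n (a - 0, 0 - 0) = d - n → ζ (a, 0) = 0 := by
    intro a ha hw
    have := h (a + n - 0) (0 - 0) (wt a 0 0 (a + n) 0 0 (by omega)
        (by omega) (by omega) (by omega) hw (by omega) (by omega) (by omega) (by omega) (by omega))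
    rw [he _ _ (by omega), if_pos (by omega : (_ ∨ _)), if_neg (by omega : ¬ (_ ∨ _)),
      if_neg (by omega : ¬ (_ ∨ _))] at this
    exact cn _ (by simpa using this)
  have s7 : ∀ a : ℤ, n + 1 ≤ a → nWeight n (a - 0, 0 - 0) = d - n → η (a, 0) = 0 := by
    intro a ha hw
    have := h (a - 0) (1 - 0) (wt a 0 0 a 1 0 (by omega)
        (by omega) (by omega) (by omega) hw (by omega) (by omega) (by omega) (by omega) (by omega))
    rw [he _ _ (by omega), hζ (a - 0 - n) _ (by omega), mul_zero, ite_self, if_neg (by omega : ¬ (_ ∨ _)),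
      if_pos (by omega : (_ ∨ _))] at this
    simpa using this
  -- At `x^{a+n} z` the terms coming from `x^{a+n}` are already zero, so `ζ` at `x^a z` is isolated.
  have s8 : ∀ a : ℤ, 1 ≤ a → nWeight n (a - 1, 0 - 1) = d - n → ζ (a - 1, -1) = 0 := by
    intro a ha hw
    have := h (a + n - 1) (0 - 1) (wt a 0 1 (a + n) 0 1 (by omega)
        (by omega) (by omega) (by omega) hw (by omega) (by omega) (by omega) (by omega) (by omega))
    have hw' : nWeight n (a + n - 0, 0 - 0) = d - n := by
      rw [nWeight_monomial n (by omega) (by omega) (by omega) (by omega)] at hw ⊢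
      rw [← hw]; ring
    rw [he _ _ (by omega), if_pos (by omega : (_ ∨ _)), if_pos (by omega : (_ ∨ _)),
      if_neg (by omega : ¬ (_ ∨ _)), show (a + n - 1 + 1 : ℤ) = a + n by ring,
      show (0 - 1 + 1 : ℤ) = 0 by ring, s6 _ (by omega) hw', s7 _ (by omega) hw',
      show (a + n - 1 - n : ℤ) = a - 1 by ring] at this
    exact cn _ (by simpa using this)
  have s9 : ∀ a : ℤ, 1 ≤ a → a ≤ n → nWeight n (a - 0, 0 - 0) = d - n → η (a, 0) = 0 := by
    intro a ha han hw
    have := h (a - 1) (0 - 1) (wt a 0 0 a 0 1 (by omega)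
        (by omega) (by omega) (by omega) hw (by omega) (by omega) (by omega) (by omega) (by omega))
    have h2 : (if (n : ℤ) ≤ a - 1 ∨ n - (a - 1) ≤ -(0 - 1) then (n : k) * ζ (a - 1 - n, 0 - 1)
        else 0) = 0 := by
      split_ifs with hc
      · have : a = n := by omega
        subst this
        have := s4 1 (by omega) (by
          rw [nWeight_monomial n (by omega) (by omega) (by omega) (by omega)] at hw ⊢
          rw [← hw]; ring)
        rw [show (n - 1 - n : ℤ) = 0 - 1 by ring, this, mul_zero]
      · rfl
    rw [he _ _ (by omega), h2, if_pos (by omega : (_ ∨ _)), if_neg (by omega : ¬ (_ ∨ _)),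
      show (a - 1 + 1 : ℤ) = a by ring, show (0 - 1 + 1 : ℤ) = 0 by ring, s6 _ (by omega) hw]
      at this
    exact ct _ (by simpa using this)
  -- At `x^a z²` the term `n x^n ζ` survives only for `a = n`, where it comes from `z²`.
  have s10 : ∀ a : ℤ, 1 ≤ a → nWeight n (a - 1, 0 - 1) = d - n → η (a - 1, -1) = 0 := by
    intro a ha hw
    have := h (a - 2) (0 - 2) (wt a 0 1 a 0 2 (by omega)
        (by omega) (by omega) (by omega) hw (by omega) (by omega) (by omega) (by omega) (by omega))
    have h2 : ζ (a - 2 - n, 0 - 2) = 0 := by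
      by_cases han : a = n
      · subst han
        have := s4 2 (by omega) (by
          rw [nWeight_monomial n (by omega) (by omega) (by omega) (by omega)] at hw ⊢
          rw [← hw]; ring)
        rwa [show (n - 2 - n : ℤ) = 0 - 2 by ring]
      · exact hζ _ _ (by omega)
    rw [he _ _ (by omega), h2, mul_zero, ite_self, if_pos (by omega : (_ ∨ _)), if_neg (by omega : ¬ (_ ∨ _)),
      show (a - 2 + 1 : ℤ) = a - 1 by ring, show (0 - 2 + 1 : ℤ) = -1 by ring,
      s8 a ha hw] at this
    exact ct _ (by simpa using this)
  constructor
  · intro w hw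
    obtain ⟨a, b, c, ha, hb, hc, habc, rfl⟩ := exists_monomial w
    by_cases ha0 : a = 0
    · subst ha0
      have h2 := s3 c.toNat b hb (by rwa [Int.toNat_of_nonneg hc])
      rw [Int.toNat_of_nonneg hc] at h2
      refine ⟨?_, h2⟩
      by_cases hb0 : b = 0
      · subst hb0; exact s4 c hc hw
      · exact hζ _ _ (by omega)
    by_cases hb0 : b = 0
    · subst hb0
      by_cases hc0 : c = 0
      · subst hc0
        refine ⟨by simpa using s6 a (by omega) hw, ?_⟩
        rcases le_or_gt a n with han | han
        · simpa using s9 a (by omega) han hw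
        · simpa using s7 a (by omega) hw
      by_cases hc1 : c = 1
      · subst hc1
        exact ⟨s8 a (by omega) hw, s10 a (by omega) hw⟩
      · exact ⟨hζ _ _ (by omega), s5 a c (by omega) (by omega) hw⟩
    · have hc0 : c = 0 := by omega
      subst hc0
      exact ⟨hζ _ _ (by omega), by simpa using s1 a b (by omega) (by omega) (by simpa using hw)⟩
  · rintro ⟨u, v⟩ hw
    by_cases hE : IsEps n (u, v)
    · simp only [IsEps] at hE
      have := h u v hw
      rcases hE with ⟨rfl, hu, hu'⟩ | ⟨rfl, hu, hu'⟩
      · rw [if_neg (by omega : ¬ (_ < _ ∨ _)), if_neg (by omega : ¬ ((1 : ℤ) ≤ _ ∨ _))] at this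
        by_cases hun : u = n
        · subst hun
          have h0 := s4 0 le_rfl (by
            have hw' : nWeight n ((n : ℤ) - 0, (0 : ℤ) - 0) = d := by simpa using hw
            rw [nWeight_monomial n (by omega) (by omega) (by omega) (by omega)] at hw' ⊢
            rw [← hw']; ring)
          rw [if_pos (by omega : (_ ∨ _)), show ((n : ℤ) - n, (0:ℤ)) = (0 - 0, 0 - 0) by simp, h0]
            at this
          simpa using this
        · rw [if_neg (by omega : ¬ (_ ∨ _))] at this
          simpa using this
      · have h0 := s9 u hu hu' (by
            have hw' : nWeight n (u - 0, (1 : ℤ) - 0) = d := by simpa using hw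
            rw [nWeight_monomial n (by omega) (by omega) (by omega) (by omega)] at hw' ⊢
            rw [← hw']; ring)
        rw [hζ (u - n) _ (by omega), mul_zero, ite_self, if_neg (by omega : ¬ (_ ∨ _)),
          if_pos (by omega : (_ ∨ _)), show (1 - 1 : ℤ) = 0 by ring, h0] at this
        simpa using this
    · simp only [IsEps] at hE
      exact he _ _ hE

end Injective

end Weights

/-! ### Independence and spanning for the full symbols, with their degree-0 terms -/

section Symbols

section Symbol

variable {k : Type*} [CommRing k] {n : ℕ} {t : k} {e ζ η : ℤ × ℤ → k}

theorem nWeight_le_of_isEps {w : ℤ × ℤ} (h : IsEps n w) : nWeight n w ≤ 2 * n := by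
  obtain ⟨u, v⟩ := w
  simp only [IsEps] at h
  rcases h with ⟨rfl, h1, h2⟩ | ⟨rfl, h1, h2⟩ <;>
  · rw [nWeight_of_depth n (c := 0) (by omega)]; linarith

/-- The symbols are not homogeneous: `lam` has degree 0, the rest degree `n`. Descending from the
highest weight in the supports, the degree-0 terms always involve coefficients already known to
vanish, so the homogeneous statement applies degree by degree. -/
theorem symbol_injective (hn : 1 ≤ n) (hnu : IsUnit (n : k)) (ht : IsUnit t)
    (he : ∀ w, ¬ IsEps n w → e w = 0) (hζ : ∀ w, ¬ IsNormal w → ζ w = 0)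
    (hfin : ∃ D : ℤ, ∀ w, D < nWeight n w → ζ w = 0 ∧ η w = 0)
    (h : ∀ w, e w + symbolOp Prod.fst (n : k) t ((n : ℤ), 0) ζ w
      + symbolOp Prod.snd 1 t (0, 1) η w = 0) (w : ℤ × ℤ) :
    e w = 0 ∧ ζ w = 0 ∧ η w = 0 := by
  obtain ⟨D, hD⟩ := hfin
  have hn' : (1 : ℤ) ≤ n := by exact_mod_cast hn
  -- Above `max D (2n)` nothing is left: `D` bounds the weights of `ζ` and `η`, and `2n` those of
  -- the `ε_i`.
  have key : ∀ j : ℕ, ∀ w, (max D (2 * n) + n - j - n < nWeight n w → ζ w = 0 ∧ η w = 0) ∧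
      (max D (2 * n) + n - j < nWeight n w → e w = 0) := by
    intro j
    induction j with
    | zero =>
      refine fun w => ⟨fun hw => hD w (by push_cast at hw; omega), fun hw => he w fun hE => ?_⟩
      have := nWeight_le_of_isEps hE
      push_cast at hw
      omega
    | succ j ih =>
      have step := symbol_injective_step (e := e) (ζ := ζ) (η := η) hn hnu ht (fun u v => he (u, v))
        (fun u v => hζ (u, v)) (max D (2 * n) + n - j) (by
          intro u v hw
          have h1 := h (u, v)
          -- Removes the degree-0 terms: in the current weight `d > d - n` both `ζ` and `η` already
          -- vanish.
          obtain ⟨h2, h3⟩ := (ih (u, v)).1 (by omega)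
          simp only [symbolOp, h2, h3, mul_zero, zero_add, one_mul, Prod.mk_sub_mk,
            Prod.mk_add_mk, sub_zero] at h1
          have c1 : depth (u, v) = depth (u - n, v) ↔ ((n : ℤ) ≤ u ∨ n - u ≤ -v) := by
            simp only [depth]; omega
          have c2 : depth (u, v) = depth (u + 1, v + 1) + 1 ↔ (u < 0 ∨ v < 0) := by
            simp only [depth]; omega
          have c3 : depth (u, v) = depth (u, v - 1) ↔ (1 ≤ v ∨ 1 - v ≤ -u) := by
            simp only [depth]; omega
          simp only [c1, c2, c3] at h1
          split_ifs at h1 ⊢ <;> linear_combination h1)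
      refine fun w => ⟨fun hw => ?_, fun hw => ?_⟩
      · by_cases hw' : max D (2 * n) + n - j - n < nWeight n w
        · exact (ih w).1 hw'
        · exact step.1 w (by push_cast at hw; omega)
      · by_cases hw' : max D (2 * n) + n - j < nWeight n w
        · exact (ih w).2 hw'
        · exact step.2 w (by push_cast at hw; omega)
  have hw0 := nWeight_nonneg n w
  have := key (max D (2 * n) + n + 1).toNat w
  rw [Int.toNat_of_nonneg (by omega)] at this
  exact ⟨this.2 (by omega), this.1 (by omega)⟩

/-- `symbolOp` as a linear map. -/
def symbolLin (lam : ℤ × ℤ → ℤ) (m t : k) (s : ℤ × ℤ) : (ℤ × ℤ → k) →ₗ[k] (ℤ × ℤ → k) where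
  toFun := symbolOp lam m t s
  map_add' x y := by
    funext w
    simp only [symbolOp, Pi.add_apply]
    split_ifs <;> ring
  map_smul' c x := by
    funext w
    simp only [symbolOp, Pi.smul_apply, smul_eq_mul, RingHom.id_apply]
    split_ifs <;> ring

theorem symbolLin_single (lam : ℤ × ℤ → ℤ) (m t : k) (s u : ℤ × ℤ) :
    symbolLin lam m t s (Pi.single u 1) = (lam u : k) • Pi.single u 1
      + (if depth (u + s) = depth u then m else 0) • Pi.single (u + s) 1
      - (if depth (u - (1, 1)) = depth u + 1 then t else 0) • Pi.single (u - (1, 1)) 1 := by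
  funext w
  have e1 : w - s = u ↔ w = u + s := sub_eq_iff_eq_add
  have e2 : w + (1, 1) = u ↔ w = u - (1, 1) := eq_sub_iff_add_eq.symm
  simp only [symbolLin, LinearMap.coe_mk, AddHom.coe_mk, symbolOp, Pi.add_apply, Pi.sub_apply,
    Pi.smul_apply, smul_eq_mul, Pi.single_apply, e1, e2]
  congr 1
  · congr 1
    · by_cases h : w = u
      · subst h; simp
      · simp [h]
    · by_cases h : w = u + s
      · subst h; simp
      · simp [h]
  · by_cases h : w = u - (1, 1)
    · subst h; simp
    · simp [h]

/-- Functions with finite support contained in `{w | P w}`. -/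
def finSupported (k : Type*) [CommRing k] (P : ℤ × ℤ → Prop) : Submodule k (ℤ × ℤ → k) where
  carrier := {c | c.support.Finite ∧ ∀ w, ¬ P w → c w = 0}
  add_mem' {a b} ha hb := ⟨(ha.1.union hb.1).subset (Function.support_add a b),
    fun w hw => by simp [ha.2 w hw, hb.2 w hw]⟩
  zero_mem' := ⟨by simp, fun _ _ => rfl⟩
  smul_mem' c x hx := ⟨hx.1.subset (Function.support_const_smul_subset c x),
    fun w hw => by simp [hx.2 w hw]⟩

theorem single_mem_finSupported {P : ℤ × ℤ → Prop} {u : ℤ × ℤ} (h : P u) :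
    (Pi.single u 1 : ℤ × ℤ → k) ∈ finSupported k P := by
  refine ⟨(Set.finite_singleton u).subset ?_, fun w hw => Pi.single_eq_of_ne ?_ _⟩
  · exact Pi.support_single_subset
  · rintro rfl; exact hw h

/-- The sum of the spans of the `ε_i` and of the images of the two symbol operators, the first one
restricted to `{w | Q w}`. -/
def symbolRange (n : ℕ) (t : k) (P Q : ℤ × ℤ → Prop) : Submodule k (ℤ × ℤ → k) :=
  finSupported k P ⊔ (finSupported k Q).map (symbolLin Prod.fst (n : k) t ((n : ℤ), 0)) ⊔
    (finSupported k fun _ => True).map (symbolLin Prod.snd 1 t (0, 1))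

variable {P Q : ℤ × ℤ → Prop}

theorem single_mem_symbolRange {u : ℤ × ℤ} (h : P u) :
    Pi.single u 1 ∈ symbolRange n t P Q :=
  Submodule.mem_sup_left (Submodule.mem_sup_left (single_mem_finSupported h))

/-- The degree-0 term is a multiple of the monomial itself, so it can be subtracted once that
monomial is in the range. This reduces spanning to an induction on weight with homogeneous
relations. -/
theorem symbolX_mem {u : ℤ × ℤ} (h : Q u) (hu : Pi.single u 1 ∈ symbolRange n t P Q) :
    (if depth (u + ((n : ℤ), 0)) = depth u then (n : k) else 0) • Pi.single (u + ((n : ℤ), 0)) 1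
      - (if depth (u - (1, 1)) = depth u + 1 then t else 0) • Pi.single (u - (1, 1)) 1
      ∈ symbolRange n t P Q := by
  have h1 : symbolLin Prod.fst (n : k) t ((n : ℤ), 0) (Pi.single u 1) ∈ symbolRange n t P Q :=
    Submodule.mem_sup_left (Submodule.mem_sup_right
      (Submodule.mem_map_of_mem (single_mem_finSupported h)))
  rw [symbolLin_single] at h1
  have := Submodule.sub_mem _ h1 (Submodule.smul_mem _ ((Prod.fst u : ℤ) : k) hu)
  convert this using 1
  module

theorem symbolY_mem {u : ℤ × ℤ} (hu : Pi.single u 1 ∈ symbolRange n t P Q) :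
    (if depth (u + (0, 1)) = depth u then (1 : k) else 0) • Pi.single (u + (0, 1)) 1
      - (if depth (u - (1, 1)) = depth u + 1 then t else 0) • Pi.single (u - (1, 1)) 1
      ∈ symbolRange n t P Q := by
  have h1 : symbolLin Prod.snd 1 t (0, 1) (Pi.single u 1) ∈ symbolRange n t P Q :=
    Submodule.mem_sup_right (Submodule.mem_map_of_mem (single_mem_finSupported trivial))
  rw [symbolLin_single] at h1
  have := Submodule.sub_mem _ h1 (Submodule.smul_mem _ ((Prod.snd u : ℤ) : k) hu)
  convert this using 1
  module

/-- In terms of monomials: `y m ≡ t z m`. -/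
theorem monomialY_mem {a b c : ℤ} (ha : 0 ≤ a) (hb : 0 ≤ b) (hc : 0 ≤ c)
    (h : a = 0 ∨ b = 0 ∨ c = 0)
    (hu : Pi.single (a - c, b - c) 1 ∈ symbolRange n t P Q) :
    (if a = 0 ∨ c = 0 then (1 : k) else 0) • Pi.single (a - c, b + 1 - c) 1
      - (if a = 0 ∨ b = 0 then t else 0) • Pi.single (a - (c + 1), b - (c + 1)) 1
      ∈ symbolRange n t P Q := by
  have := symbolY_mem hu
  have c1 : depth ((a - c, b - c) + (0, 1)) = depth (a - c, b - c) ↔ (a = 0 ∨ c = 0) := by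
    simp only [depth, Prod.mk_add_mk]; omega
  have c2 : depth ((a - c, b - c) - (1, 1)) = depth (a - c, b - c) + 1 ↔ (a = 0 ∨ b = 0) := by
    simp only [depth, Prod.mk_sub_mk]; omega
  simp only [c1, c2] at this
  convert this using 5 <;> simp <;> ring

/-- In terms of monomials: `n x ^ n m ≡ t z m`. -/
theorem monomialX_mem {a b c : ℤ} (hn : 1 ≤ n) (ha : 0 ≤ a) (hb : 0 ≤ b) (hc : 0 ≤ c)
    (h : a = 0 ∨ b = 0 ∨ c = 0) (hQ : Q (a - c, b - c))
    (hu : Pi.single (a - c, b - c) 1 ∈ symbolRange n t P Q) :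
    (if b = 0 ∨ c = 0 then (n : k) else 0) • Pi.single (a + n - c, b - c) 1
      - (if a = 0 ∨ b = 0 then t else 0) • Pi.single (a - (c + 1), b - (c + 1)) 1
      ∈ symbolRange n t P Q := by
  have := symbolX_mem hQ hu
  have c1 : depth ((a - c, b - c) + ((n : ℤ), 0)) = depth (a - c, b - c) ↔ (b = 0 ∨ c = 0) := by
    simp only [depth, Prod.mk_add_mk]; omega
  have c2 : depth ((a - c, b - c) - (1, 1)) = depth (a - c, b - c) + 1 ↔ (a = 0 ∨ b = 0) := by
    simp only [depth, Prod.mk_sub_mk]; omega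
  simp only [c1, c2] at this
  convert this using 5 <;> simp <;> ring

theorem mem_of_unit_smul_sub {S : Submodule k (ℤ × ℤ → k)} {r r' : k} {x y : ℤ × ℤ → k}
    (hr : IsUnit r) (h : r • x - r' • y ∈ S) (hy : y ∈ S) : x ∈ S := by
  have : r • x ∈ S := by
    have := S.add_mem h (S.smul_mem r' hy)
    rwa [sub_add_cancel] at this
  exact (Submodule.smul_mem_iff_of_isUnit S hr).1 this

theorem mem_of_sub_unit_smul {S : Submodule k (ℤ × ℤ → k)} {r r' : k} {x y : ℤ × ℤ → k}
    (hr : IsUnit r) (h : r' • y - r • x ∈ S) (hy : y ∈ S) : x ∈ S := by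
  rw [← neg_mem_iff, neg_sub] at h
  exact mem_of_unit_smul_sub hr h hy

theorem mem_of_forall_single {S : Submodule k (ℤ × ℤ → k)} (h : ∀ w, Pi.single w 1 ∈ S)
    {β : ℤ × ℤ → k} (hβ : β.support.Finite) : β ∈ S := by
  have : β = ∑ w ∈ hβ.toFinset, β w • (Pi.single w 1 : ℤ × ℤ → k) := by
    funext v
    rw [Finset.sum_apply]
    simp only [Pi.smul_apply, Pi.single_apply, smul_eq_mul, mul_ite, mul_one, mul_zero]
    rw [Finset.sum_ite_eq]
    split_ifs with hv
    · rfl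
    · simpa using hv
  rw [this]
  exact S.sum_mem fun w _ => S.smul_mem _ (h w)

/-- The points `x^a z^c` with `c ≥ 2` lie in the range, given the points of smaller weight. -/
theorem monomialXZ_mem (ht : IsUnit t) {a c : ℤ} (ha : 1 ≤ a) (hc : 2 ≤ c)
    (hlow : ∀ v, nWeight n v < nWeight n (a - c, 0 - c) → Pi.single v 1 ∈ symbolRange n t P Q)
    (hn : 1 ≤ n) : Pi.single (a - c, 0 - c) 1 ∈ symbolRange n t P Q := by
  have hn' : (1 : ℤ) ≤ n := by exact_mod_cast hn
  have := monomialY_mem (a := a) (b := 0) (c := c - 1) (by omega) le_rfl (by omega) (by omega)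
    (hlow _ (by
      rw [nWeight_monomial n (by omega) (by omega) (by omega) (by omega),
        nWeight_monomial n (by omega) (by omega) (by omega) (by omega)]
      linarith))
  rw [if_neg (by omega), if_pos (by omega), zero_smul, zero_sub, neg_mem_iff,
    Submodule.smul_mem_iff_of_isUnit _ ht] at this
  simpa using this

/-- If the points `y^b m` with `b = 0` lie in the range, so do all of them. -/
theorem monomialYZ_mem (hn : 1 ≤ n) {a c : ℤ} (b : ℕ) (ha : 0 ≤ a) (hc : 0 ≤ c)
    (h : a = 0 ∨ b = 0 ∨ c = 0)
    (hlow : ∀ v, nWeight n v < nWeight n (a - c, b - c) → Pi.single v 1 ∈ symbolRange n t P Q)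
    (hz : ∀ a' c' : ℤ, 0 ≤ a' → 0 ≤ c' → nWeight n (a' - c', 0 - c') = nWeight n (a - c, b - c) →
      Pi.single (a' - c', 0 - c') 1 ∈ symbolRange n t P Q) :
    Pi.single (a - c, b - c) 1 ∈ symbolRange n t P Q := by
  have hn' : (1 : ℤ) ≤ n := by exact_mod_cast hn
  induction b generalizing c with
  | zero => exact hz a c ha hc (by simp)
  | succ b ih =>
    rw [nWeight_monomial n (by omega) (by omega) (by omega) (by omega)] at hlow hz
    have := monomialY_mem (a := a) (b := b) (c := c) (by omega) (by omega) (by omega) (by omega)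
      (hlow _ (by
        rw [nWeight_monomial n (by omega) (by omega) (by omega) (by omega)]
        push_cast
        linarith))
    rw [if_pos (by omega)] at this
    push_cast
    -- If `a` and `b` are both positive then `z m = 0` in the graded ring, and the relation `y m ≡ t
    -- z m` alone puts `y m` in the range.
    by_cases h0 : a = 0 ∨ (b : ℤ) = 0
    · refine mem_of_unit_smul_sub isUnit_one this (ih (by omega) (by omega) ?_ ?_)
      · rw [nWeight_monomial n (by omega) (by omega) (by omega) (by omega)]
        intro v hv
        exact hlow v (hv.trans_eq (by push_cast; ring))
      · rw [nWeight_monomial n (by omega) (by omega) (by omega) (by omega)]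
        intro a' c' h1 h2 h3
        exact hz a' c' h1 h2 (h3.trans (by push_cast; ring))
    · rw [if_neg h0, zero_smul, sub_zero, one_smul] at this
      exact this

/-- Powers of `y` are traded for powers of `z`. For `a ≥ 1`, `c ≥ 2` one has `x^a z^c ≡ 0`, because
`y · x^a z^{c-1} = 0`. The rest follows from `x^a z ~ x^a y` for `a ≤ n`, `x^a z ~ x^{a-n} z²` and
`x^a ~ x^{a-n} z` for `a > n`, and `z^c ~ x^n z^{c-1}`, where `~` is up to units. The relation for
`x^n` is only ever used at a normal monomial. -/
theorem symbolRange_eps_normal (hn : 1 ≤ n) (hnu : IsUnit (n : k)) (ht : IsUnit t)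
    {β : ℤ × ℤ → k} (hβ : β.support.Finite) : β ∈ symbolRange n t (IsEps n) IsNormal := by
  have hn' : (1 : ℤ) ≤ n := by exact_mod_cast hn
  refine mem_of_forall_single ?_ hβ
  have key : ∀ d : ℕ, ∀ w, nWeight n w = d →
      Pi.single w 1 ∈ symbolRange (k := k) n t (IsEps n) IsNormal := by
    intro d
    induction d using Nat.strong_induction_on with
    | _ d ih =>
    have hlow : ∀ v, nWeight n v < d →
        Pi.single v 1 ∈ symbolRange (k := k) n t (IsEps n) IsNormal := by
      intro v hv
      have h0 := nWeight_nonneg n v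
      exact ih (nWeight n v).toNat (by omega) v (by omega)
    have wm : ∀ a b c : ℤ, 0 ≤ a → 0 ≤ b → 0 ≤ c → (a = 0 ∨ b = 0 ∨ c = 0) →
      nWeight n (a - c, b - c) = a + n * (b + c) := fun a b c => nWeight_monomial n
    have r4 : ∀ a c : ℤ, 1 ≤ a → 2 ≤ c → nWeight n (a - c, 0 - c) = d →
        Pi.single (a - c, 0 - c) 1 ∈ symbolRange (k := k) n t (IsEps n) IsNormal := by
      intro a c ha hc hw
      exact monomialXZ_mem ht ha hc (hw ▸ hlow) hn
    have r3 : ∀ a : ℤ, 1 ≤ a → nWeight n (a - 1, 0 - 1) = d →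
        Pi.single (a - 1, 0 - 1) 1 ∈ symbolRange (k := k) n t (IsEps n) IsNormal := by
      intro a ha hw
      rw [wm _ _ _ (by omega) (by omega) (by omega) (by omega)] at hw
      rcases le_or_gt a n with han | han
      · have := monomialY_mem (k := k) (t := t) (P := IsEps n) (Q := IsNormal)
          (a := a) (b := 0) (c := 0) (by omega) (by omega) (by omega)
          (by omega) (hlow _ (by
            rw [wm _ _ _ (by omega) (by omega) (by omega) (by omega), ← hw]; linarith))
        rw [if_pos (by omega), if_pos (by omega)] at this
        exact mem_of_sub_unit_smul ht this
          (single_mem_symbolRange (Or.inr ⟨by simp, by simp; omega, by simp; omega⟩))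
      · have := monomialX_mem (k := k) (t := t) (P := IsEps n) (Q := IsNormal)
          (a := a - n) (b := 0) (c := 1) hn (by omega) (by omega) (by omega)
          (by omega) ⟨by simp, by simp; omega, by simp⟩ (hlow _ (by
            rw [wm _ _ _ (by omega) (by omega) (by omega) (by omega), ← hw]; linarith))
        rw [if_pos (by omega), if_pos (by omega)] at this
        have h2 := mem_of_unit_smul_sub hnu this (r4 (a - n) 2 (by omega) le_rfl (by
          rw [wm _ _ _ (by omega) (by omega) (by omega) (by omega), ← hw]; ring))
        simpa using h2
    have r5 : ∀ c : ℤ, 1 ≤ c → nWeight n (0 - c, 0 - c) = d →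
        Pi.single (0 - c, 0 - c) 1 ∈ symbolRange (k := k) n t (IsEps n) IsNormal := by
      intro c hc hw
      rw [wm _ _ _ (by omega) (by omega) (by omega) (by omega)] at hw
      have := monomialX_mem (k := k) (t := t) (P := IsEps n) (Q := IsNormal)
          (a := 0) (b := 0) (c := c - 1) hn (by omega) (by omega) (by omega)
          (by omega) ⟨by simp; omega, by simp, by simp⟩ (hlow _ (by
            rw [wm _ _ _ (by omega) (by omega) (by omega) (by omega), ← hw]; linarith))
      rw [if_pos (by omega), if_pos (by omega), show c - 1 + 1 = c by ring] at this
      refine mem_of_sub_unit_smul ht this ?_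
      have hw' : nWeight n (0 + n - (c - 1), 0 - (c - 1)) = d := by
        rw [wm _ _ _ (by omega) (by omega) (by omega) (by omega), ← hw]; ring
      by_cases h1 : c = 1
      · subst h1
        exact single_mem_symbolRange (Or.inl ⟨by simp, by simp, by simp⟩)
      by_cases h2 : c = 2
      · subst h2
        exact r3 _ (by omega) hw'
      · exact r4 _ _ (by omega) (by omega) hw'
    have r0 : ∀ a c : ℤ, 0 ≤ a → 0 ≤ c → nWeight n (a - c, 0 - c) = d →
        Pi.single (a - c, 0 - c) 1 ∈ symbolRange (k := k) n t (IsEps n) IsNormal := by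
      intro a c ha hc hw
      by_cases hc0 : c = 0
      · subst hc0
        rcases le_or_gt a n with han | han
        · exact single_mem_symbolRange (Or.inl ⟨by simp, by simpa, by simpa⟩)
        rw [wm _ _ _ (by omega) (by omega) (by omega) (by omega)] at hw
        have := monomialX_mem (k := k) (t := t) (P := IsEps n) (Q := IsNormal)
          (a := a - n) (b := 0) (c := 0) hn (by omega) (by omega) (by omega)
          (by omega) ⟨by simp, by simp; omega, by simp⟩ (hlow _ (by
            rw [wm _ _ _ (by omega) (by omega) (by omega) (by omega), ← hw]; linarith))
        rw [if_pos (by omega), if_pos (by omega)] at this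
        have h2 := mem_of_unit_smul_sub hnu this (r3 (a - n) (by omega) (by
          rw [wm _ _ _ (by omega) (by omega) (by omega) (by omega), ← hw]; ring))
        simpa using h2
      by_cases ha0 : a = 0
      · subst ha0; exact r5 c (by omega) hw
      by_cases hc1 : c = 1
      · subst hc1; exact r3 a (by omega) hw
      · exact r4 a c (by omega) (by omega) hw
    intro w hw
    obtain ⟨a, b, c, ha, hb, hc, h, rfl⟩ := exists_monomial w
    lift b to ℕ using hb
    exact monomialYZ_mem hn b ha hc (by omega) (hw ▸ hlow)
      (fun a' c' h1 h2 h3 => r0 a' c' h1 h2 (h3.trans hw))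
  intro w
  exact key (nWeight n w).toNat w (Int.toNat_of_nonneg (nWeight_nonneg n w)).symm

/-- The quotient by `y - t z` alone. Lifted to `𝒞₀`, it replaces an arbitrary argument of `D_x` by
one supported on normal monomials, modulo the image of `D_y`. -/
theorem symbolRange_normal (hn : 1 ≤ n) (ht : IsUnit t)
    {β : ℤ × ℤ → k} (hβ : β.support.Finite) :
    β ∈ symbolRange n t IsNormal (fun _ => False) := by
  have hn' : (1 : ℤ) ≤ n := by exact_mod_cast hn
  refine mem_of_forall_single ?_ hβ
  have key : ∀ d : ℕ, ∀ w, nWeight n w = d →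
      Pi.single w 1 ∈ symbolRange (k := k) n t IsNormal (fun _ => False) := by
    intro d
    induction d using Nat.strong_induction_on with
    | _ d ih =>
    have hlow : ∀ v, nWeight n v < d →
        Pi.single v 1 ∈ symbolRange (k := k) n t IsNormal (fun _ => False) := by
      intro v hv
      have h0 := nWeight_nonneg n v
      exact ih (nWeight n v).toNat (by omega) v (by omega)
    intro w hw
    obtain ⟨a, b, c, ha, hb, hc, h, rfl⟩ := exists_monomial w
    lift b to ℕ using hb
    refine monomialYZ_mem hn b ha hc (by omega) (hw ▸ hlow) (fun a' c' h1 h2 h3 => ?_)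
    by_cases h4 : IsNormal (a' - c', 0 - c')
    · exact single_mem_symbolRange h4
    · simp only [IsNormal] at h4
      exact monomialXZ_mem ht (by omega) (by omega) (by rw [h3, hw]; exact hlow) hn
  intro w
  exact key (nWeight n w).toNat w (Int.toNat_of_nonneg (nWeight_nonneg n w)).symm

end Symbol

end Symbols

section BanachModule

/-! ### The weight function -/

theorem depth_add_le (u v : ℤ × ℤ) : depth (u + v) ≤ depth u + depth v := by
  simp only [depth, Prod.fst_add, Prod.snd_add]; omega

/-- The defect of additivity is `2n+1` times a non-negative integer. Hence a product of monomials
from different cones vanishes modulo `π`, which is the relation `xyz = 0`. -/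
theorem nWeight_add (n : ℕ) (u v : ℤ × ℤ) : nWeight n (u + v) =
    nWeight n u + nWeight n v - (2 * (n : ℤ) + 1) * (depth u + depth v - depth (u + v)) := by
  simp only [nWeight_eq, Prod.fst_add, Prod.snd_add]; ring

theorem nWeight_add_le (n : ℕ) (u v : ℤ × ℤ) : nWeight n (u + v) ≤ nWeight n u + nWeight n v := by
  rw [nWeight_add]
  have := depth_add_le u v
  have : 0 ≤ (2 * (n : ℤ) + 1) * (depth u + depth v - depth (u + v)) :=
    mul_nonneg (by positivity) (by omega)
  omega

theorem depth_zsmul {j : ℤ} (hj : 0 ≤ j) (u : ℤ × ℤ) : depth (j • u) = j * depth u := by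
  simp only [depth, Prod.smul_fst, Prod.smul_snd, smul_eq_mul]
  rw [mul_max_of_nonneg _ _ hj, mul_max_of_nonneg _ _ hj, mul_zero, mul_neg, mul_neg]

theorem nWeight_zsmul (n : ℕ) {j : ℤ} (hj : 0 ≤ j) (u : ℤ × ℤ) :
    nWeight n (j • u) = j * nWeight n u := by
  simp only [nWeight_eq, depth_zsmul hj, Prod.smul_fst, Prod.smul_snd, smul_eq_mul]; ring

theorem finite_nWeight_le {n : ℕ} (hn : 1 ≤ n) (D : ℤ) : {w | nWeight n w ≤ D}.Finite := by
  refine ((Set.finite_Icc (-D) D).prod (Set.finite_Icc (-D) D)).subset ?_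
  intro w hw
  obtain ⟨a, b, c, ha, hb, hc, h, rfl⟩ := exists_monomial w
  rw [Set.mem_ofPred_eq, nWeight_monomial n ha hb hc h] at hw
  have : b + c ≤ n * (b + c) := le_mul_of_one_le_left (by omega) (by exact_mod_cast hn)
  simp only [Set.mem_prod, Set.mem_Icc]
  omega

theorem nWeight_neg_one (n : ℕ) : nWeight n (-(1, 1)) = n := by
  simp [nWeight]; ring

variable {K : Type*} [NormedField K]

/-! ### The module `𝒞₀` -/

/-- The coefficients of a series relative to the basis `γ̃ ^ (n ω(w)) x ^ w`. -/
def normalized (n : ℕ) (π : K) (c : ℤ × ℤ → K) (w : ℤ × ℤ) : K := c w / π ^ nWeight n w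

section C0

variable {n : ℕ} {π : K}

theorem mem_C0_iff (h0 : π ≠ 0) {c : ℤ × ℤ → K} : c ∈ C0 n π ↔
    (∀ w, ‖c w‖ ≤ ‖π‖ ^ nWeight n w) ∧ Tendsto (normalized n π c) cofinite (𝓝 0) := by
  have hpos : ∀ w, 0 < ‖π‖ ^ nWeight n w := fun w => zpow_pos (norm_pos_iff.2 h0) _
  constructor
  · rintro ⟨ξ, h1, h2, h3⟩
    refine ⟨fun w => ?_, ?_⟩
    · rw [h3, norm_mul, norm_zpow]
      exact mul_le_of_le_one_left (hpos w).le (h1 w)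
    · convert h2 using 1
      funext w
      rw [normalized, h3, mul_div_assoc, div_self (zpow_ne_zero _ h0), mul_one]
  · rintro ⟨h1, h2⟩
    refine ⟨normalized n π c, fun w => ?_, h2, fun w => ?_⟩
    · rw [normalized, norm_div, norm_zpow]
      exact (div_le_one (hpos w)).2 (h1 w)
    · rw [normalized, div_mul_cancel₀ _ (zpow_ne_zero _ h0)]

theorem norm_le_of_mem_C0 (h0 : π ≠ 0) {c : ℤ × ℤ → K} (hc : c ∈ C0 n π) (w : ℤ × ℤ) :
    ‖c w‖ ≤ ‖π‖ ^ nWeight n w := ((mem_C0_iff h0).1 hc).1 w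

theorem norm_normalized_le (h0 : π ≠ 0) (c : ℤ × ℤ → K) (w : ℤ × ℤ) (ε : ℝ) :
    ‖normalized n π c w‖ ≤ ε ↔ ‖c w‖ ≤ ε * ‖π‖ ^ nWeight n w := by
  rw [normalized, norm_div, norm_zpow, div_le_iff₀ (zpow_pos (norm_pos_iff.2 h0) _)]

theorem eventually_norm_le (h0 : π ≠ 0) {c : ℤ × ℤ → K} (hc : c ∈ C0 n π) {ε : ℝ} (hε : 0 < ε) :
    ∀ᶠ w in cofinite, ‖c w‖ ≤ ε * ‖π‖ ^ nWeight n w := by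
  have := ((mem_C0_iff h0).1 hc).2
  rw [tendsto_zero_iff_norm_tendsto_zero] at this
  filter_upwards [this.eventually_lt_const hε] with w hw
  exact (norm_normalized_le h0 c w ε).1 hw.le

theorem mem_C0_of_eventually (h0 : π ≠ 0) {c : ℤ × ℤ → K} (h1 : ∀ w, ‖c w‖ ≤ ‖π‖ ^ nWeight n w)
    (h2 : ∀ ε : ℝ, 0 < ε → ∀ᶠ w in cofinite, ‖c w‖ ≤ ε * ‖π‖ ^ nWeight n w) : c ∈ C0 n π := by
  refine (mem_C0_iff h0).2 ⟨h1, ?_⟩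
  rw [Metric.tendsto_nhds]
  intro ε hε
  filter_upwards [h2 (ε / 2) (by positivity)] with w hw
  rw [dist_zero_right]
  exact ((norm_normalized_le h0 c w _).2 hw).trans_lt (by linarith)

theorem mem_C0_of_finite (h0 : π ≠ 0) {c : ℤ × ℤ → K} (h1 : ∀ w, ‖c w‖ ≤ ‖π‖ ^ nWeight n w)
    (h2 : c.support.Finite) : c ∈ C0 n π := by
  refine mem_C0_of_eventually h0 h1 fun ε hε => ?_
  filter_upwards [h2.compl_mem_cofinite] with w hw
  rw [Set.mem_compl_iff, Function.mem_support, not_not] at hw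
  rw [hw, norm_zero]
  positivity

theorem zero_mem_C0 : (0 : ℤ × ℤ → K) ∈ C0 n π :=
  ⟨0, by simp, tendsto_const_nhds, by simp⟩

theorem smul_mem_C0 {c : ℤ × ℤ → K} {a : K} (ha : ‖a‖ ≤ 1) (hc : c ∈ C0 n π) :
    a • c ∈ C0 n π := by
  obtain ⟨ξ, h1, h2, h3⟩ := hc
  refine ⟨a • ξ, fun w => ?_, by simpa [Pi.smul_def] using h2.const_smul a, fun w => ?_⟩
  · rw [Pi.smul_apply, smul_eq_mul, norm_mul]
    exact mul_le_one₀ ha (norm_nonneg _) (h1 w)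
  · simp [h3, mul_assoc]

theorem neg_mem_C0 {c : ℤ × ℤ → K} (hc : c ∈ C0 n π) : -c ∈ C0 n π := by
  simpa using smul_mem_C0 (a := (-1 : K)) (by simp) hc

theorem mem_C0_of_smul (h0 : π ≠ 0) {c : ℤ × ℤ → K} (hc : c ∈ C0 n π)
    (h : ∀ w, ‖c w‖ ≤ ‖π‖ * ‖π‖ ^ nWeight n w) : ∃ c' ∈ C0 n π, c = π • c' := by
  refine ⟨π⁻¹ • c, ?_, by rw [smul_smul, mul_inv_cancel₀ h0, one_smul]⟩
  have hp : 0 < ‖π‖ := norm_pos_iff.2 h0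
  refine mem_C0_of_eventually h0 (fun w => ?_) fun ε hε => ?_
  · rw [Pi.smul_apply, smul_eq_mul, norm_mul, norm_inv, inv_mul_le_iff₀ hp]
    exact h w
  · filter_upwards [eventually_norm_le h0 hc (mul_pos hp hε)] with w hw
    rw [Pi.smul_apply, smul_eq_mul, norm_mul, norm_inv, inv_mul_le_iff₀ hp, ← mul_assoc]
    exact hw

variable [IsUltrametricDist K]

theorem add_mem_C0 {c c' : ℤ × ℤ → K} (hc : c ∈ C0 n π) (hc' : c' ∈ C0 n π) :
    c + c' ∈ C0 n π := by
  obtain ⟨ξ, h1, h2, h3⟩ := hc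
  obtain ⟨ξ', h1', h2', h3'⟩ := hc'
  refine ⟨ξ + ξ', fun w => ?_, by simpa [Pi.add_def] using h2.add h2', fun w => ?_⟩
  · exact (IsUltrametricDist.norm_add_le_max _ _).trans (max_le (h1 w) (h1' w))
  · simp [h3, h3', add_mul]

theorem sub_mem_C0 {c c' : ℤ × ℤ → K} (hc : c ∈ C0 n π) (hc' : c' ∈ C0 n π) :
    c - c' ∈ C0 n π := by
  rw [sub_eq_add_neg]
  exact add_mem_C0 hc (neg_mem_C0 hc')

theorem norm_sub_le_of_le {x y : K} {C : ℝ} (hx : ‖x‖ ≤ C) (hy : ‖y‖ ≤ C) : ‖x - y‖ ≤ C := by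
  rw [sub_eq_add_neg]
  exact (IsUltrametricDist.norm_add_le_max _ _).trans (max_le hx (by rwa [norm_neg]))

theorem norm_add_le_of_le {x y : K} {C : ℝ} (hx : ‖x‖ ≤ C) (hy : ‖y‖ ≤ C) : ‖x + y‖ ≤ C :=
  (IsUltrametricDist.norm_add_le_max _ _).trans (max_le hx hy)

/-- `𝒞₀` is complete for the `π`-adic topology. -/
theorem exists_adic_sum [CompleteSpace K] (h0 : π ≠ 0) (h1 : ‖π‖ < 1) (c : ℕ → ℤ × ℤ → K)
    (hc : ∀ k, c k ∈ C0 n π) : ∃ L : ℕ → ℤ × ℤ → K, (∀ k, L k ∈ C0 n π) ∧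
      (∀ k, L k = c k + π • L (k + 1)) ∧ ∀ w, (∀ k, c k w = 0) → ∀ k, L k w = 0 := by
  have hsum : ∀ (k : ℕ) (w : ℤ × ℤ), Summable fun j => π ^ j * c (k + j) w := by
    intro k w
    refine Summable.of_norm_bounded (g := fun j => ‖π‖ ^ j * ‖π‖ ^ nWeight n w)
      ((summable_geometric_of_lt_one (norm_nonneg _) h1).mul_right _) fun j => ?_
    rw [norm_mul, norm_pow]
    gcongr
    exact norm_le_of_mem_C0 h0 (hc _) w
  refine ⟨fun k w => ∑' j, π ^ j * c (k + j) w, fun k => ?_, fun k => ?_, fun w hw k => ?_⟩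
  · refine mem_C0_of_eventually h0 (fun w => ?_) fun ε hε => ?_
    · refine IsUltrametricDist.norm_tsum_le_of_forall_le_of_nonneg (by positivity) fun j => ?_
      rw [norm_mul, norm_pow]
      exact (mul_le_of_le_one_left (norm_nonneg _) (pow_le_one₀ (norm_nonneg _) h1.le)).trans
        (norm_le_of_mem_C0 h0 (hc _) w)
    -- The terms with `j ≥ J` are uniformly small because of `π^j`; the finitely many others each
    -- tend to zero.
    · obtain ⟨J, hJ⟩ := exists_pow_lt_of_lt_one hε h1
      have : ∀ᶠ w in cofinite, ∀ j ∈ Finset.range J, ‖c (k + j) w‖ ≤ ε * ‖π‖ ^ nWeight n w :=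
        (eventually_all_finset _).2 fun j _ => eventually_norm_le h0 (hc _) hε
      filter_upwards [this] with w hw
      refine IsUltrametricDist.norm_tsum_le_of_forall_le_of_nonneg (by positivity) fun j => ?_
      rw [norm_mul, norm_pow]
      by_cases hj : j < J
      · exact (mul_le_of_le_one_left (norm_nonneg _) (pow_le_one₀ (norm_nonneg _) h1.le)).trans
          (hw j (Finset.mem_range.2 hj))
      · gcongr
        · exact (pow_le_pow_of_le_one (norm_nonneg _) h1.le (not_lt.1 hj)).trans hJ.le
        · exact norm_le_of_mem_C0 h0 (hc _) w
  · funext w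
    simp only [Pi.add_apply, Pi.smul_apply, smul_eq_mul]
    rw [(hsum k w).tsum_eq_zero_add, ← tsum_mul_left]
    simp only [pow_zero, one_mul, add_zero]
    congr 1
    refine tsum_congr fun j => ?_
    rw [show k + (j + 1) = k + 1 + j by ring]; ring
  · simp [hw]

end C0

/-! ### The operators `D_x` and `D_y` -/

/-- The `i`-th term of `∑_i g_i (m x^{p^i s} - τ_i / (x y)^{p^i})`, as an operator. -/
def twistTerm (p : ℕ) (g τ : ℕ → K) (m : K) (s : ℤ × ℤ) (i : ℕ) (c : ℤ × ℤ → K) (w : ℤ × ℤ) : K :=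
  g i * (m * c (w - (p : ℤ) ^ i • s) - τ i * c (w + (p : ℤ) ^ i • (1, 1)))

/-- The operator `lam + ∑_i g_i (m x^{p^i s} - τ_i / (x y)^{p^i})`. -/
noncomputable def twistOp (p : ℕ) (g τ : ℕ → K) (lam : ℤ × ℤ → ℤ) (m : K) (s : ℤ × ℤ) (c : ℤ × ℤ → K)
    (w : ℤ × ℤ) : K :=
  lam w * c w + ∑' i, twistTerm p g τ m s i c w

theorem Dx_eq_twistOp (p n : ℕ) (σ : K ≃+* K) (γ t : K) : Dx p n σ γ t =
    twistOp p (fun i => gammaSum p γ i * (p : K) ^ i) (fun i => (σ : K → K)^[i] t) Prod.fst n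
      ((n : ℤ), 0) := by
  funext c w
  simp [Dx, twistOp, twistTerm, mul_comm (n : ℤ), Prod.sub_def,
    Prod.add_def]

theorem Dy_eq_twistOp (p : ℕ) (σ : K ≃+* K) (γ t : K) : Dy p σ γ t =
    twistOp p (fun i => gammaSum p γ i * (p : K) ^ i) (fun i => (σ : K → K)^[i] t) Prod.snd 1
      (0, 1) := by
  funext c w
  simp [Dy, twistOp, twistTerm, Prod.sub_def, Prod.add_def]

/-- The estimates on the coefficients of the operators. -/
structure IsTwist (p n : ℕ) (π : K) (g τ : ℕ → K) : Prop where
  one_le_n : 1 ≤ n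
  ne_zero : π ≠ 0
  norm_lt_one : ‖π‖ < 1
  g_zero : g 0 = π ^ n
  norm_g : ∀ i, ‖g i‖ ≤ ‖π‖ ^ (n * p ^ i + i)
  norm_tau : ∀ i, ‖τ i‖ = 1

section Twist

variable {p n : ℕ} {π : K} {g τ : ℕ → K} {m : K} {s : ℤ × ℤ} {lam : ℤ × ℤ → ℤ}

theorem twistOp_smul (a : K) (c : ℤ × ℤ → K) :
    twistOp p g τ lam m s (a • c) = a • twistOp p g τ lam m s c := by
  funext w
  simp only [twistOp, Pi.smul_apply, smul_eq_mul]
  rw [mul_add, ← tsum_mul_left]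
  congr 1
  · ring
  · refine tsum_congr fun i => ?_
    simp only [twistTerm, Pi.smul_apply, smul_eq_mul]; ring

theorem nWeight_le_shift_s (hsw : nWeight n s = n) (i : ℕ) (w : ℤ × ℤ) :
    nWeight n w ≤ nWeight n (w - (p : ℤ) ^ i • s) + n * p ^ i := by
  have := nWeight_add_le n (w - (p : ℤ) ^ i • s) ((p : ℤ) ^ i • s)
  rw [sub_add_cancel, nWeight_zsmul n (by positivity), hsw] at this
  linarith

theorem nWeight_le_shift_z (i : ℕ) (w : ℤ × ℤ) :
    nWeight n w ≤ nWeight n (w + (p : ℤ) ^ i • (1, 1)) + n * p ^ i := by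
  have := nWeight_add_le n (w + (p : ℤ) ^ i • (1, 1)) ((p : ℤ) ^ i • (-(1, 1)))
  rw [nWeight_zsmul n (by positivity), nWeight_neg_one, smul_neg, add_neg_cancel_right] at this
  linarith

variable [IsUltrametricDist K]

/-- A shift by `p^i` steps costs at most `n p^i` in weight, which the bound on `g i` repays with a
surplus `‖π‖^i`. The surplus gives convergence of the sum and makes the terms `i ≥ 1` vanish modulo
`π`. -/
theorem norm_twistTerm_le (h : IsTwist p n π g τ) (hsw : nWeight n s = n) (hm : ‖m‖ ≤ 1)
    {c : ℤ × ℤ → K} {w : ℤ × ℤ} {i : ℕ} {ε : ℝ} (hε : 0 ≤ ε)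
    (h1 : ‖c (w - (p : ℤ) ^ i • s)‖ ≤ ε * ‖π‖ ^ nWeight n (w - (p : ℤ) ^ i • s))
    (h2 : ‖c (w + (p : ℤ) ^ i • (1, 1))‖ ≤ ε * ‖π‖ ^ nWeight n (w + (p : ℤ) ^ i • (1, 1))) :
    ‖twistTerm p g τ m s i c w‖ ≤ ε * ‖π‖ ^ i * ‖π‖ ^ nWeight n w := by
  have hp : 0 < ‖π‖ := norm_pos_iff.2 h.ne_zero
  have key : ∀ W : ℤ, nWeight n w ≤ W + n * p ^ i →
      ‖g i‖ * (ε * ‖π‖ ^ W) ≤ ε * ‖π‖ ^ i * ‖π‖ ^ nWeight n w := by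
    intro W hW
    calc ‖g i‖ * (ε * ‖π‖ ^ W) ≤ ‖π‖ ^ (n * p ^ i + i) * (ε * ‖π‖ ^ W) := by
          gcongr; exact h.norm_g i
      _ = ε * ‖π‖ ^ i * ‖π‖ ^ (W + n * p ^ i) := by
          rw [pow_add, zpow_add₀ hp.ne']
          have : ‖π‖ ^ ((n : ℤ) * (p : ℤ) ^ i) = ‖π‖ ^ (n * p ^ i) := by
            rw [← zpow_natCast]; push_cast; rfl
          rw [this]; ring
      _ ≤ _ := by
          gcongr ?_ * ?_
          exact zpow_le_zpow_right_of_le_one₀ hp h.norm_lt_one.le hW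
  rw [twistTerm, mul_sub]
  refine norm_sub_le_of_le ?_ ?_
  · rw [norm_mul, norm_mul]
    refine le_trans ?_ (key _ (nWeight_le_shift_s hsw i w))
    exact mul_le_mul_of_nonneg_left ((mul_le_of_le_one_left (norm_nonneg _) hm).trans h1)
      (norm_nonneg _)
  · rw [norm_mul, norm_mul, h.norm_tau, one_mul]
    refine le_trans ?_ (key _ (nWeight_le_shift_z i w))
    gcongr

theorem norm_twistTerm_le_of_forall (h : IsTwist p n π g τ) (hsw : nWeight n s = n) (hm : ‖m‖ ≤ 1)
    {c : ℤ × ℤ → K} {ε : ℝ} (hε : 0 ≤ ε) (hc : ∀ w, ‖c w‖ ≤ ε * ‖π‖ ^ nWeight n w)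
    (w : ℤ × ℤ) (i : ℕ) :
    ‖twistTerm p g τ m s i c w‖ ≤ ε * ‖π‖ ^ i * ‖π‖ ^ nWeight n w :=
  norm_twistTerm_le h hsw hm hε (hc _) (hc _)

theorem norm_twistTerm_le_of_mem (h : IsTwist p n π g τ) (hsw : nWeight n s = n) (hm : ‖m‖ ≤ 1)
    {c : ℤ × ℤ → K} (hc : c ∈ C0 n π) (w : ℤ × ℤ) (i : ℕ) :
    ‖twistTerm p g τ m s i c w‖ ≤ ‖π‖ ^ i * ‖π‖ ^ nWeight n w := by
  have := norm_twistTerm_le_of_forall h hsw hm zero_le_one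
    (fun w => (norm_le_of_mem_C0 h.ne_zero hc w).trans_eq (one_mul _).symm) w i
  rwa [one_mul] at this

theorem norm_twistTerm_le_pow (h : IsTwist p n π g τ) (hsw : nWeight n s = n) (hm : ‖m‖ ≤ 1)
    {c : ℤ × ℤ → K} (hc : c ∈ C0 n π) (w : ℤ × ℤ) (i : ℕ) :
    ‖twistTerm p g τ m s i c w‖ ≤ ‖π‖ ^ nWeight n w :=
  (norm_twistTerm_le_of_mem h hsw hm hc w i).trans
    (mul_le_of_le_one_left (by positivity) (pow_le_one₀ (norm_nonneg _) h.norm_lt_one.le))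

theorem twistOp_mem_C0 (h : IsTwist p n π g τ) (hsw : nWeight n s = n) (hm : ‖m‖ ≤ 1)
    {c : ℤ × ℤ → K} (hc : c ∈ C0 n π) : twistOp p g τ lam m s c ∈ C0 n π := by
  have h0 := h.ne_zero
  refine mem_C0_of_eventually h0 (fun w => ?_) fun ε hε => ?_
  · refine norm_add_le_of_le ?_ (IsUltrametricDist.norm_tsum_le_of_forall_le_of_nonneg
      (by positivity) fun i => norm_twistTerm_le_pow h hsw hm hc w i)
    rw [norm_mul]
    exact (mul_le_of_le_one_left (norm_nonneg _) (IsUltrametricDist.norm_intCast_le_one K _)).trans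
      (norm_le_of_mem_C0 h0 hc w)
  · obtain ⟨J, hJ⟩ := exists_pow_lt_of_lt_one hε h.norm_lt_one
    have e0 := eventually_norm_le h0 hc hε
    have e1 : ∀ᶠ w in cofinite, ∀ j ∈ Finset.range J, ‖c (w - (p : ℤ) ^ j • s)‖ ≤
        ε * ‖π‖ ^ nWeight n (w - (p : ℤ) ^ j • s) :=
      (eventually_all_finset _).2 fun j _ => (sub_left_injective.tendsto_cofinite).eventually e0
    have e2 : ∀ᶠ w in cofinite, ∀ j ∈ Finset.range J, ‖c (w + (p : ℤ) ^ j • (1, 1))‖ ≤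
        ε * ‖π‖ ^ nWeight n (w + (p : ℤ) ^ j • (1, 1)) :=
      (eventually_all_finset _).2 fun j _ =>
        ((add_left_injective _).tendsto_cofinite).eventually e0
    filter_upwards [e0, e1, e2] with w h0' h1 h2
    refine norm_add_le_of_le ?_ (IsUltrametricDist.norm_tsum_le_of_forall_le_of_nonneg
      (by positivity) fun i => ?_)
    · rw [norm_mul]
      exact (mul_le_of_le_one_left (norm_nonneg _)
        (IsUltrametricDist.norm_intCast_le_one K _)).trans h0'
    · by_cases hi : i < J
      · refine (norm_twistTerm_le h hsw hm hε.le (h1 i (Finset.mem_range.2 hi))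
          (h2 i (Finset.mem_range.2 hi))).trans ?_
        gcongr
        exact mul_le_of_le_one_right hε.le (pow_le_one₀ (norm_nonneg _) h.norm_lt_one.le)
      · refine (norm_twistTerm_le_of_mem h hsw hm hc w i).trans ?_
        gcongr
        exact (pow_le_pow_of_le_one (norm_nonneg _) h.norm_lt_one.le (not_lt.1 hi)).trans hJ.le

variable [CompleteSpace K]

theorem summable_twistTerm (h : IsTwist p n π g τ) (hsw : nWeight n s = n) (hm : ‖m‖ ≤ 1)
    {c : ℤ × ℤ → K} (hc : c ∈ C0 n π) (w : ℤ × ℤ) :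
    Summable fun i => twistTerm p g τ m s i c w :=
  Summable.of_norm_bounded
    ((summable_geometric_of_lt_one (norm_nonneg _) h.norm_lt_one).mul_right _)
    fun i => norm_twistTerm_le_of_mem h hsw hm hc w i

theorem twistOp_add (h : IsTwist p n π g τ) (hsw : nWeight n s = n) (hm : ‖m‖ ≤ 1)
    {c c' : ℤ × ℤ → K} (hc : c ∈ C0 n π) (hc' : c' ∈ C0 n π) :
    twistOp p g τ lam m s (c + c') = twistOp p g τ lam m s c + twistOp p g τ lam m s c' := by
  funext w
  simp only [twistOp, Pi.add_apply]
  have : ∀ i, twistTerm p g τ m s i (c + c') w =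
      twistTerm p g τ m s i c w + twistTerm p g τ m s i c' w := by
    intro i; simp only [twistTerm, Pi.add_apply]; ring
  simp_rw [this]
  rw [(summable_twistTerm h hsw hm hc w).tsum_add (summable_twistTerm h hsw hm hc' w)]
  ring

theorem twistOp_sub (h : IsTwist p n π g τ) (hsw : nWeight n s = n) (hm : ‖m‖ ≤ 1)
    {c c' : ℤ × ℤ → K} (hc : c ∈ C0 n π) (hc' : c' ∈ C0 n π) :
    twistOp p g τ lam m s (c - c') = twistOp p g τ lam m s c - twistOp p g τ lam m s c' := by
  rw [sub_eq_add_neg, ← neg_one_smul K c', twistOp_add h hsw hm hc (smul_mem_C0 (by simp) hc'),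
    twistOp_smul, neg_one_smul, sub_eq_add_neg]

end Twist

end BanachModule

section Reduction

variable {K : Type*} [NormedField K] {p n : ℕ} {π : K} {g τ : ℕ → K}

/-! ### Commutation of the two operators -/

section Commute

variable {m₁ m₂ : K} {s₁ s₂ : ℤ × ℤ} {l₁ l₂ : ℤ × ℤ → ℤ}

theorem twistTerm_comm (i j : ℕ) (c : ℤ × ℤ → K) (w : ℤ × ℤ) :
    twistTerm p g τ m₁ s₁ i (twistTerm p g τ m₂ s₂ j c) w =
      twistTerm p g τ m₂ s₂ j (twistTerm p g τ m₁ s₁ i c) w := by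
  simp only [twistTerm]
  rw [show w - (p : ℤ) ^ j • s₂ - (p : ℤ) ^ i • s₁ = w - (p : ℤ) ^ i • s₁ - (p : ℤ) ^ j • s₂ by abel,
    show w - (p : ℤ) ^ j • s₂ + (p : ℤ) ^ i • (1, 1) = w + (p : ℤ) ^ i • (1, 1) - (p : ℤ) ^ j • s₂ by
      abel,
    show w + (p : ℤ) ^ j • (1, 1) - (p : ℤ) ^ i • s₁ = w - (p : ℤ) ^ i • s₁ + (p : ℤ) ^ j • (1, 1) by
      abel,
    show w + (p : ℤ) ^ j • ((1, 1) : ℤ × ℤ) + (p : ℤ) ^ i • (1, 1) =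
      w + (p : ℤ) ^ i • (1, 1) + (p : ℤ) ^ j • (1, 1) by abel]
  ring

variable [IsUltrametricDist K] [CompleteSpace K]

/-- The composition of two twisted operators, in a form symmetric up to the order of summation. -/
theorem twistOp_twistOp (h : IsTwist p n π g τ) (hs₁ : nWeight n s₁ = n) (hs₂ : nWeight n s₂ = n)
    (hm₁ : ‖m₁‖ ≤ 1) (hm₂ : ‖m₂‖ ≤ 1) (hl : ∀ w (j : ℤ), l₂ (w - j • s₁) = l₂ w)
    (hl' : ∀ w (j : ℤ), l₂ (w + j • (1, 1)) = l₂ w + j)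
    {c : ℤ × ℤ → K} (hc : c ∈ C0 n π) (w : ℤ × ℤ) :
    twistOp p g τ l₁ m₁ s₁ (twistOp p g τ l₂ m₂ s₂ c) w =
      l₁ w * (l₂ w * c w) + l₁ w * (∑' j, twistTerm p g τ m₂ s₂ j c w)
        + l₂ w * (∑' i, twistTerm p g τ m₁ s₁ i c w)
        - (∑' i, g i * τ i * (p : K) ^ i * c (w + (p : ℤ) ^ i • (1, 1)))
        + ∑' i, ∑' j, twistTerm p g τ m₁ s₁ i (twistTerm p g τ m₂ s₂ j c) w := by
  have hc2 := summable_twistTerm h hs₂ hm₂ hc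
  have hc1 := summable_twistTerm h hs₁ hm₁ hc
  -- Of the two shifts only the one by `(xy)^{-p^i}` fails to commute with `l₂`. The resulting
  -- correction involves neither `m₁`, `s₁` nor `m₂`, `s₂`, so it is the same for both orders of
  -- composition.
  have h1 : ∀ i, twistTerm p g τ m₁ s₁ i (twistOp p g τ l₂ m₂ s₂ c) w =
      l₂ w * twistTerm p g τ m₁ s₁ i c w - g i * τ i * (p : K) ^ i * c (w + (p : ℤ) ^ i • (1, 1))
        + ∑' j, twistTerm p g τ m₁ s₁ i (twistTerm p g τ m₂ s₂ j c) w := by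
    intro i
    have : ∑' j, twistTerm p g τ m₁ s₁ i (twistTerm p g τ m₂ s₂ j c) w =
        g i * (m₁ * (∑' j, twistTerm p g τ m₂ s₂ j c (w - (p : ℤ) ^ i • s₁))
          - τ i * ∑' j, twistTerm p g τ m₂ s₂ j c (w + (p : ℤ) ^ i • (1, 1))) := by
      rw [← tsum_mul_left, ← tsum_mul_left, ← ((hc2 _).mul_left _).tsum_sub ((hc2 _).mul_left _),
        ← tsum_mul_left]
      rfl
    rw [this]
    simp only [twistTerm, twistOp, hl, hl']
    push_cast
    ring
  have hA : Summable fun i => l₂ w * twistTerm p g τ m₁ s₁ i c w := (hc1 w).mul_left _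
  have hB : Summable fun i => g i * τ i * (p : K) ^ i * c (w + (p : ℤ) ^ i • (1, 1)) := by
    refine Summable.of_norm_bounded
      (summable_geometric_of_lt_one (norm_nonneg π) h.norm_lt_one) fun i => ?_
    rw [norm_mul, norm_mul, norm_mul, h.norm_tau, mul_one, norm_pow]
    have e1 : ‖g i‖ ≤ ‖π‖ ^ i := (h.norm_g i).trans
      (pow_le_pow_of_le_one (norm_nonneg _) h.norm_lt_one.le (by omega))
    have e2 : ‖c (w + (p : ℤ) ^ i • (1, 1))‖ ≤ 1 := (norm_le_of_mem_C0 h.ne_zero hc _).trans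
      ((zpow_le_zpow_right_of_le_one₀ (norm_pos_iff.2 h.ne_zero) h.norm_lt_one.le
        (nWeight_nonneg n _)).trans_eq (zpow_zero _))
    have e3 : ‖(p : K)‖ ^ i ≤ 1 := pow_le_one₀ (norm_nonneg _)
      (IsUltrametricDist.norm_natCast_le_one K p)
    calc _ ≤ ‖π‖ ^ i * 1 * 1 := by gcongr
      _ = _ := by ring
  have hT : Summable fun i => twistTerm p g τ m₁ s₁ i (twistOp p g τ l₂ m₂ s₂ c) w :=
    summable_twistTerm h hs₁ hm₁ (twistOp_mem_C0 h hs₂ hm₂ hc) w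
  have hC : Summable fun i => ∑' j, twistTerm p g τ m₁ s₁ i (twistTerm p g τ m₂ s₂ j c) w := by
    have := (hT.sub hA).add hB
    refine this.congr fun i => ?_
    rw [h1]; ring
  rw [twistOp]
  simp_rw [h1]
  rw [(hA.sub hB).tsum_add hC, hA.tsum_sub hB, tsum_mul_left]
  simp only [twistOp]
  ring

/-- Both orders expand to the same expression up to interchanging a double sum, which is absolutely
convergent thanks to the surplus `‖π‖^{i+j}`. -/
theorem twistOp_comm (h : IsTwist p n π g τ) (hs₁ : nWeight n s₁ = n) (hs₂ : nWeight n s₂ = n)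
    (hm₁ : ‖m₁‖ ≤ 1) (hm₂ : ‖m₂‖ ≤ 1)
    (hl₁ : ∀ w (j : ℤ), l₁ (w - j • s₂) = l₁ w) (hl₁' : ∀ w (j : ℤ), l₁ (w + j • (1, 1)) = l₁ w + j)
    (hl₂ : ∀ w (j : ℤ), l₂ (w - j • s₁) = l₂ w) (hl₂' : ∀ w (j : ℤ), l₂ (w + j • (1, 1)) = l₂ w + j)
    {c : ℤ × ℤ → K} (hc : c ∈ C0 n π) :
    twistOp p g τ l₁ m₁ s₁ (twistOp p g τ l₂ m₂ s₂ c) =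
      twistOp p g τ l₂ m₂ s₂ (twistOp p g τ l₁ m₁ s₁ c) := by
  funext w
  rw [twistOp_twistOp h hs₁ hs₂ hm₁ hm₂ hl₂ hl₂' hc, twistOp_twistOp h hs₂ hs₁ hm₂ hm₁ hl₁ hl₁' hc]
  have hsum : Summable (Function.uncurry fun i j =>
      twistTerm p g τ m₁ s₁ i (twistTerm p g τ m₂ s₂ j c) w) := by
    have hgeo := summable_geometric_of_lt_one (norm_nonneg π) h.norm_lt_one
    refine Summable.of_norm_bounded ((hgeo.mul_of_nonneg hgeo (fun i => by positivity)
      (fun i => by positivity)).mul_right (‖π‖ ^ nWeight n w)) ?_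
    rintro ⟨i, j⟩
    refine (norm_twistTerm_le_of_forall h hs₁ hm₁ (ε := ‖π‖ ^ j) (by positivity)
      (fun v => norm_twistTerm_le_of_mem h hs₂ hm₂ hc v j) w i).trans_eq ?_
    ring
  have e : ∑' i, ∑' j, twistTerm p g τ m₁ s₁ i (twistTerm p g τ m₂ s₂ j c) w =
      ∑' i, ∑' j, twistTerm p g τ m₂ s₂ i (twistTerm p g τ m₁ s₁ j c) w := by
    rw [← hsum.tsum_comm]
    simp_rw [twistTerm_comm (m₁ := m₁) (s₁ := s₁) (m₂ := m₂) (s₂ := s₂)]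
  rw [e]
  ring

end Commute

/-! ### Reduction modulo `π` -/

section Reduction

theorem norm_normalized_le_one (h0 : π ≠ 0) {c : ℤ × ℤ → K} (hc : c ∈ C0 n π) (w : ℤ × ℤ) :
    ‖normalized n π c w‖ ≤ 1 :=
  (norm_normalized_le h0 c w 1).2 (by rw [one_mul]; exact norm_le_of_mem_C0 h0 hc w)

variable [IsUltrametricDist K]

/-- The ring of integers of an ultrametric field. -/
def unitBall (K : Type*) [NormedField K] [IsUltrametricDist K] : Subring K where
  carrier := {x | ‖x‖ ≤ 1}
  mul_mem' ha hb := by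
    rw [Set.mem_ofPred_eq, norm_mul]; exact mul_le_one₀ ha (norm_nonneg _) hb
  one_mem' := by simp
  add_mem' ha hb := norm_add_le_of_le ha hb
  zero_mem' := by simp
  neg_mem' ha := by simpa using ha

/-- The ring of integers modulo the elements of norm at most `‖π‖`. -/
def smallIdeal (π : K) : Ideal (unitBall K) where
  carrier := {x | ‖(x : K)‖ ≤ ‖π‖}
  add_mem' ha hb := norm_add_le_of_le ha hb
  zero_mem' := by simp
  smul_mem' c x hx := by
    rw [Set.mem_ofPred_eq, smul_eq_mul, Subring.coe_mul, norm_mul]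
    exact (mul_le_of_le_one_left (norm_nonneg _) c.2).trans hx

/-- Reduction modulo `π`. -/
noncomputable def red (π x : K) : unitBall K ⧸ smallIdeal π :=
  open Classical in if h : ‖x‖ ≤ 1 then Ideal.Quotient.mk _ ⟨x, h⟩ else 0

theorem red_of_le {x : K} (h : ‖x‖ ≤ 1) : red π x = Ideal.Quotient.mk _ (⟨x, h⟩ : unitBall K) :=
  dif_pos h

theorem red_add {x y : K} (hx : ‖x‖ ≤ 1) (hy : ‖y‖ ≤ 1) : red π (x + y) = red π x + red π y := by
  rw [red_of_le hx, red_of_le hy, red_of_le (norm_add_le_of_le hx hy), ← map_add]; rfl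

theorem red_sub {x y : K} (hx : ‖x‖ ≤ 1) (hy : ‖y‖ ≤ 1) : red π (x - y) = red π x - red π y := by
  rw [red_of_le hx, red_of_le hy, red_of_le (norm_sub_le_of_le hx hy), ← map_sub]; rfl

theorem red_mul {x y : K} (hx : ‖x‖ ≤ 1) (hy : ‖y‖ ≤ 1) : red π (x * y) = red π x * red π y := by
  rw [red_of_le hx, red_of_le hy, red_of_le (show ‖x * y‖ ≤ 1 by
    rw [norm_mul]; exact mul_le_one₀ hx (norm_nonneg _) hy), ← map_mul]; rfl

theorem red_eq_zero {x : K} (hx : ‖x‖ ≤ 1) : red π x = 0 ↔ ‖x‖ ≤ ‖π‖ := by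
  rw [red_of_le hx, Ideal.Quotient.eq_zero_iff_mem]; rfl

theorem red_zero : red π (0 : K) = 0 := (red_eq_zero (by simp)).2 (by simp)

theorem red_one : red π (1 : K) = 1 := by
  rw [red_of_le (by simp), ← map_one (Ideal.Quotient.mk (smallIdeal π))]; rfl

theorem red_intCast (z : ℤ) : red π (z : K) = z := by
  rw [red_of_le (IsUltrametricDist.norm_intCast_le_one K z),
    ← map_intCast (Ideal.Quotient.mk (smallIdeal π))]
  congr 1

theorem red_natCast (z : ℕ) : red π (z : K) = z := by
  exact_mod_cast red_intCast (π := π) (z : ℤ)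

theorem isUnit_red {x : K} (hx : ‖x‖ = 1) : IsUnit (red π x) := by
  have h0 : x ≠ 0 := by rintro rfl; simp at hx
  refine IsUnit.of_mul_eq_one (red π x⁻¹) ?_
  rw [← red_mul hx.le (by rw [norm_inv, hx, inv_one]), mul_inv_cancel₀ h0, red_one]

/-- Choosing 0 as the lift of 0 makes coefficientwise lifting preserve supports, hence finiteness
and the conditions `P`, `Q`. -/
theorem exists_red_eq (y : unitBall K ⧸ smallIdeal π) :
    ∃ x : K, ‖x‖ ≤ 1 ∧ red π x = y ∧ (y = 0 → x = 0) := by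
  by_cases hy : y = 0
  · exact ⟨0, by simp, by rw [hy, red_zero], fun _ => rfl⟩
  · obtain ⟨⟨x, hx⟩, rfl⟩ := Ideal.Quotient.mk_surjective y
    exact ⟨x, hx, red_of_le hx, fun h => absurd h hy⟩

/-- The reduction of an element of `𝒞₀` modulo `π`. -/
noncomputable def redSeries (n : ℕ) (π : K) (c : ℤ × ℤ → K) (w : ℤ × ℤ) :
    unitBall K ⧸ smallIdeal π := red π (normalized n π c w)

theorem redSeries_eq_zero (h0 : π ≠ 0) {c : ℤ × ℤ → K} (hc : c ∈ C0 n π) {w : ℤ × ℤ} :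
    redSeries n π c w = 0 ↔ ‖c w‖ ≤ ‖π‖ * ‖π‖ ^ nWeight n w := by
  rw [redSeries, red_eq_zero (norm_normalized_le_one h0 hc w), norm_normalized_le h0]

theorem redSeries_add (h0 : π ≠ 0) {c c' : ℤ × ℤ → K} (hc : c ∈ C0 n π) (hc' : c' ∈ C0 n π) :
    redSeries n π (c + c') = redSeries n π c + redSeries n π c' := by
  funext w
  rw [Pi.add_apply, redSeries, redSeries, redSeries, ← red_add (norm_normalized_le_one h0 hc w)
    (norm_normalized_le_one h0 hc' w)]
  simp [normalized, add_div]

theorem redSeries_sub (h0 : π ≠ 0) {c c' : ℤ × ℤ → K} (hc : c ∈ C0 n π) (hc' : c' ∈ C0 n π) :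
    redSeries n π (c - c') = redSeries n π c - redSeries n π c' := by
  funext w
  rw [Pi.sub_apply, redSeries, redSeries, redSeries, ← red_sub (norm_normalized_le_one h0 hc w)
    (norm_normalized_le_one h0 hc' w)]
  simp [normalized, sub_div]

theorem redSeries_eq_zero_iff (h0 : π ≠ 0) {c : ℤ × ℤ → K} (hc : c ∈ C0 n π) :
    redSeries n π c = 0 ↔ ∃ c' ∈ C0 n π, c = π • c' := by
  constructor
  · intro h
    exact mem_C0_of_smul h0 hc fun w => (redSeries_eq_zero h0 hc).1 (congrFun h w)
  · rintro ⟨c', hc', rfl⟩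
    funext w
    refine (redSeries_eq_zero h0 hc).2 ?_
    rw [Pi.smul_apply, smul_eq_mul, norm_mul]
    gcongr
    exact norm_le_of_mem_C0 h0 hc' w

theorem redSeries_support_finite (h0 : π ≠ 0) {c : ℤ × ℤ → K} (hc : c ∈ C0 n π) :
    (redSeries n π c).support.Finite := by
  have := eventually_norm_le h0 hc (norm_pos_iff.2 h0)
  rw [eventually_cofinite] at this
  refine this.subset fun w hw hw' => hw ?_
  exact (redSeries_eq_zero h0 hc).2 hw'

theorem exists_redSeries_eq (h0 : π ≠ 0) {c : ℤ × ℤ → unitBall K ⧸ smallIdeal π}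
    (hc : c.support.Finite) : ∃ c' ∈ C0 n π, redSeries n π c' = c ∧ ∀ w, c w = 0 → c' w = 0 := by
  choose f hf1 hf2 hf3 using exists_red_eq (π := π)
  refine ⟨fun w => f (c w) * π ^ nWeight n w, ?_, ?_, ?_⟩
  · refine mem_C0_of_finite h0 (fun w => ?_) (hc.subset fun w hw h => hw ?_)
    · rw [norm_mul, norm_zpow]
      exact mul_le_of_le_one_left (by positivity) (hf1 _)
    · simp [hf3 _ h]
  · funext w
    rw [redSeries, normalized, mul_div_cancel_right₀ _ (zpow_ne_zero _ h0), hf2]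
  · intro w hw
    simp [hf3 _ hw]

/-- Only the degree-0 term and the `i = 0` term survive modulo `π`. Since `g 0 = π^n` exactly
matches the weight of one step, each shifted coefficient carries `π` to the defect of additivity,
which is 0 or at least `2n+1`. -/
theorem redSeries_twistOp [CompleteSpace K] {lam : ℤ × ℤ → ℤ} {m : K} {s : ℤ × ℤ}
    (h : IsTwist p n π g τ) (hs : depth s = 0) (hsw : nWeight n s = n) (hm : ‖m‖ ≤ 1)
    {c : ℤ × ℤ → K} (hc : c ∈ C0 n π) : redSeries n π (twistOp p g τ lam m s c) =
      symbolOp lam (red π m) (red π (τ 0)) s (redSeries n π c) := by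
  have h0 := h.ne_zero
  have hp : 0 < ‖π‖ := norm_pos_iff.2 h0
  funext w
  -- a shifted coefficient, multiplied by `π ^ n`
  have key : ∀ (v : ℤ × ℤ) (d : ℤ), 0 ≤ d → nWeight n w = nWeight n v + n - (2 * n + 1) * d →
      ‖π ^ n * c v / π ^ nWeight n w‖ ≤ 1 ∧ red π (π ^ n * c v / π ^ nWeight n w) =
        if d = 0 then redSeries n π c v else 0 := by
    intro v d hd hw
    have e : π ^ n * c v / π ^ nWeight n w = π ^ ((2 * (n : ℤ) + 1) * d) * normalized n π c v := by
      rw [normalized, hw, zpow_sub₀ h0, zpow_add₀ h0, zpow_natCast]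
      field_simp
    have hn1 := norm_normalized_le_one h0 hc v
    by_cases hd0 : d = 0
    · rw [e, hd0]; simp [hn1, redSeries]
    have hd1 : 0 < d := by omega
    · have : ‖π ^ ((2 * (n : ℤ) + 1) * d) * normalized n π c v‖ ≤ ‖π‖ := by
        rw [norm_mul, norm_zpow]
        have h2 : 1 ≤ (2 * (n : ℤ) + 1) * d := Order.one_le_iff_pos.2 (by positivity)
        have h3 := zpow_le_zpow_right_of_le_one₀ hp h.norm_lt_one.le h2
        calc _ ≤ ‖π‖ ^ (1 : ℤ) * 1 := mul_le_mul h3 hn1 (norm_nonneg _) (by positivity)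
          _ = ‖π‖ := by simp
      rw [e, if_neg hd0]
      exact ⟨this.trans h.norm_lt_one.le, (red_eq_zero (this.trans h.norm_lt_one.le)).2 this⟩
  have hX := key (w - s) (depth (w - s) - depth w)
    (by have := depth_add_le (w - s) s; rw [sub_add_cancel] at this; omega)
    (by have := nWeight_add n (w - s) s
        rw [sub_add_cancel] at this
        rw [this, hs, hsw]; ring)
  have hZ := key (w + (1, 1)) (depth (w + (1, 1)) + 1 - depth w)
    (by have := depth_add_le (w + (1, 1)) (-(1, 1))
        rw [add_neg_cancel_right] at this
        have e : depth (-(1, 1)) = 1 := by simp [depth]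
        omega)
    (by have := nWeight_add n (w + (1, 1)) (-(1, 1))
        rw [add_neg_cancel_right] at this
        have e : depth (-(1, 1)) = 1 := by simp [depth]
        rw [this, e, nWeight_neg_one])
  -- The terms with index at least 1 each carry at least one extra factor `π`.
  have hrest : ‖(∑' i, twistTerm p g τ m s (i + 1) c w) / π ^ nWeight n w‖ ≤ ‖π‖ := by
    rw [norm_div, norm_zpow, div_le_iff₀ (zpow_pos hp _)]
    refine IsUltrametricDist.norm_tsum_le_of_forall_le_of_nonneg (by positivity) fun i => ?_
    refine (norm_twistTerm_le_of_mem h hsw hm hc w (i + 1)).trans ?_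
    gcongr
    exact pow_le_of_le_one hp.le h.norm_lt_one.le (by omega)
  have hrest1 := hrest.trans h.norm_lt_one.le
  have e : normalized n π (twistOp p g τ lam m s c) w =
      lam w * normalized n π c w + m * (π ^ n * c (w - s) / π ^ nWeight n w)
        - τ 0 * (π ^ n * c (w + (1, 1)) / π ^ nWeight n w)
        + (∑' i, twistTerm p g τ m s (i + 1) c w) / π ^ nWeight n w := by
    rw [normalized, normalized, twistOp, (summable_twistTerm h hsw hm hc w).tsum_eq_zero_add]
    simp only [twistTerm, h.g_zero, pow_zero, one_smul]
    ring
  have hl := IsUltrametricDist.norm_intCast_le_one K (lam w)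
  have hc1 := norm_normalized_le_one h0 hc w
  have mulle : ∀ x y : K, ‖x‖ ≤ 1 → ‖y‖ ≤ 1 → ‖x * y‖ ≤ 1 := fun x y hx hy => by
    rw [norm_mul]; exact mul_le_one₀ hx (norm_nonneg _) hy
  have ht := (h.norm_tau 0).le
  have b1 := norm_add_le_of_le (mulle _ _ hl hc1) (mulle _ _ hm hX.1)
  rw [redSeries, e, red_add (norm_sub_le_of_le b1 (mulle _ _ ht hZ.1)) hrest1,
    red_sub b1 (mulle _ _ ht hZ.1), red_add (mulle _ _ hl hc1) (mulle _ _ hm hX.1),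
    red_mul hl hc1, red_mul hm hX.1, red_mul ht hZ.1, hX.2, hZ.2, (red_eq_zero hrest1).2 hrest,
    red_intCast, add_zero, symbolOp]
  simp only [sub_eq_zero, mul_ite, mul_zero, eq_comm (b := depth w)]
  rfl

end Reduction

end Reduction

section Basis

variable {K : Type*} [NormedField K] {p n : ℕ} {π : K} {g τ : ℕ → K}

/-! ### The cohomology of `𝒞₀` -/

/-- `D_x`, for general coefficients. -/
noncomputable def opX (p n : ℕ) (g τ : ℕ → K) : (ℤ × ℤ → K) → ℤ × ℤ → K :=
  twistOp p g τ Prod.fst (n : K) ((n : ℤ), 0)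

/-- `D_y`, for general coefficients. -/
noncomputable def opY (p : ℕ) (g τ : ℕ → K) : (ℤ × ℤ → K) → ℤ × ℤ → K :=
  twistOp p g τ Prod.snd 1 (0, 1)

theorem nWeight_x (n : ℕ) : nWeight n ((n : ℤ), 0) = n := by simp [nWeight]

theorem nWeight_y (n : ℕ) : nWeight n (0, 1) = n := by simp [nWeight]

theorem depth_x (n : ℕ) : depth ((n : ℤ), 0) = 0 := by simp [depth]

theorem depth_y : depth (0, 1) = 0 := by simp [depth]

theorem opX_smul (a : K) (c : ℤ × ℤ → K) : opX p n g τ (a • c) = a • opX p n g τ c :=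
  twistOp_smul a c

theorem opY_smul (a : K) (c : ℤ × ℤ → K) : opY p g τ (a • c) = a • opY p g τ c :=
  twistOp_smul a c

theorem opX_zero : opX p n g τ 0 = 0 := by simpa using opX_smul (p := p) (n := n) (g := g) (τ := τ) 0 0

theorem eq_zero_of_forall_smul (h0 : π ≠ 0) (h1 : ‖π‖ < 1) {c : ℤ × ℤ → K}
    (h : ∀ k : ℕ, ∃ c' ∈ C0 n π, c = π ^ k • c') : c = 0 := by
  funext w
  rw [Pi.zero_apply, ← norm_eq_zero]
  have : ∀ k : ℕ, ‖c w‖ ≤ ‖π‖ ^ k * ‖π‖ ^ nWeight n w := by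
    intro k
    obtain ⟨c', hc', e⟩ := h k
    rw [e, Pi.smul_apply, smul_eq_mul, norm_mul, norm_pow]
    gcongr
    exact norm_le_of_mem_C0 h0 hc' w
  have ht := (tendsto_pow_atTop_nhds_zero_of_lt_one (norm_nonneg π) h1).mul_const
    (‖π‖ ^ nWeight n w)
  rw [zero_mul] at ht
  exact le_antisymm (ge_of_tendsto' ht this) (norm_nonneg _)

theorem epsExp_isEps (j : Fin (2 * n + 1)) : IsEps n (epsExp n j) := by
  have := j.2
  rw [epsExp]
  split_ifs with hj
  · exact Or.inl ⟨rfl, by simp, by simpa using hj⟩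
  · refine Or.inr ⟨rfl, ?_, ?_⟩ <;> simp only <;> omega

theorem nWeight_epsExp (i : ℕ) : nWeight n (epsExp n i) = i := by
  rw [epsExp]
  split_ifs with hi
  · simp [nWeight]
  · rw [nWeight_of_depth n (c := 0) (by omega)]; ring

theorem epsExp_injective {i j : ℕ} (h : epsExp n i = epsExp n j) : i = j := by
  have := congrArg (nWeight n) h
  simpa [nWeight_epsExp] using this

theorem exists_epsExp_eq {w : ℤ × ℤ} (h : IsEps n w) : ∃ j : Fin (2 * n + 1), epsExp n j = w := by
  obtain ⟨u, v⟩ := w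
  simp only [IsEps] at h
  rcases h with ⟨rfl, h1, h2⟩ | ⟨rfl, h1, h2⟩
  · refine ⟨⟨u.toNat, by omega⟩, ?_⟩
    simp only [epsExp]
    rw [if_pos (by omega), Int.toNat_of_nonneg h1]
  · refine ⟨⟨u.toNat + n, by omega⟩, ?_⟩
    simp only [epsExp]
    rw [if_neg (by omega)]
    ext <;> simp; omega

theorem sum_epsTilde_apply (a : Fin (2 * n + 1) → K) (i : Fin (2 * n + 1)) :
    (∑ j : Fin (2 * n + 1), a j • epsTilde n π (j : ℕ)) (epsExp n i) = a i * π ^ (i : ℕ) := by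
  rw [Finset.sum_apply, Finset.sum_eq_single i]
  · simp [epsTilde, nWeight_epsExp]
  · intro j _ hj
    rw [Pi.smul_apply, epsTilde, Pi.single_eq_of_ne, smul_zero]
    intro h
    exact hj (Fin.ext (epsExp_injective h).symm)
  · simp

theorem sum_epsTilde_apply_of_not (a : Fin (2 * n + 1) → K) {w : ℤ × ℤ} (hw : ¬ IsEps n w) :
    (∑ j : Fin (2 * n + 1), a j • epsTilde n π (j : ℕ)) w = 0 := by
  rw [Finset.sum_apply]
  refine Finset.sum_eq_zero fun j _ => ?_
  rw [Pi.smul_apply, epsTilde, Pi.single_eq_of_ne, smul_zero]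
  rintro rfl
  exact hw (epsExp_isEps j)

theorem epsTilde_mem_C0 (h0 : π ≠ 0) (i : ℕ) : epsTilde n π i ∈ C0 n π := by
  refine mem_C0_of_finite h0 (fun w => ?_) ((Set.finite_singleton _).subset
    Pi.support_single_subset)
  by_cases hw : w = epsExp n i
  · subst hw; simp [epsTilde]
  · rw [epsTilde, Pi.single_eq_of_ne hw, norm_zero]; positivity

variable [IsUltrametricDist K]

theorem opX_mem (h : IsTwist p n π g τ) {c : ℤ × ℤ → K} (hc : c ∈ C0 n π) :
    opX p n g τ c ∈ C0 n π :=
  twistOp_mem_C0 h (nWeight_x n) (IsUltrametricDist.norm_natCast_le_one K n) hc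

theorem opY_mem (h : IsTwist p n π g τ) {c : ℤ × ℤ → K} (hc : c ∈ C0 n π) :
    opY p g τ c ∈ C0 n π :=
  twistOp_mem_C0 h (nWeight_y n) (by simp) hc

theorem sum_epsTilde_mem_C0 (h0 : π ≠ 0) {a : Fin (2 * n + 1) → K} (ha : ∀ j, ‖a j‖ ≤ 1) :
    ∑ j : Fin (2 * n + 1), a j • epsTilde n π (j : ℕ) ∈ C0 n π :=
  Finset.sum_induction _ (· ∈ C0 n π) (fun _ _ => add_mem_C0) zero_mem_C0
    fun j _ => smul_mem_C0 (ha j) (epsTilde_mem_C0 h0 j)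

variable [CompleteSpace K]

theorem opX_add (h : IsTwist p n π g τ) {c c' : ℤ × ℤ → K} (hc : c ∈ C0 n π) (hc' : c' ∈ C0 n π) :
    opX p n g τ (c + c') = opX p n g τ c + opX p n g τ c' :=
  twistOp_add h (nWeight_x n) (IsUltrametricDist.norm_natCast_le_one K n) hc hc'

theorem opY_add (h : IsTwist p n π g τ) {c c' : ℤ × ℤ → K} (hc : c ∈ C0 n π) (hc' : c' ∈ C0 n π) :
    opY p g τ (c + c') = opY p g τ c + opY p g τ c' :=
  twistOp_add h (nWeight_y n) (by simp) hc hc'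

theorem opX_sub (h : IsTwist p n π g τ) {c c' : ℤ × ℤ → K} (hc : c ∈ C0 n π) (hc' : c' ∈ C0 n π) :
    opX p n g τ (c - c') = opX p n g τ c - opX p n g τ c' :=
  twistOp_sub h (nWeight_x n) (IsUltrametricDist.norm_natCast_le_one K n) hc hc'

theorem opY_sub (h : IsTwist p n π g τ) {c c' : ℤ × ℤ → K} (hc : c ∈ C0 n π) (hc' : c' ∈ C0 n π) :
    opY p g τ (c - c') = opY p g τ c - opY p g τ c' :=
  twistOp_sub h (nWeight_y n) (by simp) hc hc'

theorem opX_opY_comm (h : IsTwist p n π g τ) {c : ℤ × ℤ → K} (hc : c ∈ C0 n π) :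
    opX p n g τ (opY p g τ c) = opY p g τ (opX p n g τ c) := by
  refine twistOp_comm h (nWeight_x n) (nWeight_y n) (IsUltrametricDist.norm_natCast_le_one K n)
    (by simp) ?_ ?_ ?_ ?_ hc <;> intro w j <;> simp

theorem redSeries_opX (h : IsTwist p n π g τ) {c : ℤ × ℤ → K} (hc : c ∈ C0 n π) :
    redSeries n π (opX p n g τ c) =
      symbolOp Prod.fst (n : unitBall K ⧸ smallIdeal π) (red π (τ 0)) ((n : ℤ), 0)
        (redSeries n π c) := by
  rw [opX, redSeries_twistOp h (depth_x n) (nWeight_x n)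
    (IsUltrametricDist.norm_natCast_le_one K n) hc, red_natCast]

theorem redSeries_opY (h : IsTwist p n π g τ) {c : ℤ × ℤ → K} (hc : c ∈ C0 n π) :
    redSeries n π (opY p g τ c) =
      symbolOp Prod.snd (1 : unitBall K ⧸ smallIdeal π) (red π (τ 0)) (0, 1)
        (redSeries n π c) := by
  rw [opY, redSeries_twistOp h depth_y (nWeight_y n) (by simp) hc, red_one]

variable {P Q : ℤ × ℤ → Prop}

/-- One step of successive approximation: decompose the reduction, which has finite support, lift
the three parts, and divide the remaining error by `π`. -/
theorem exists_approx (h : IsTwist p n π g τ)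
    (hPQ : ∀ β : ℤ × ℤ → unitBall K ⧸ smallIdeal π, β.support.Finite →
      β ∈ symbolRange n (red π (τ 0)) P Q) {β : ℤ × ℤ → K} (hβ : β ∈ C0 n π) :
    ∃ e ∈ C0 n π, ∃ ζ ∈ C0 n π, ∃ η ∈ C0 n π, ∃ β' ∈ C0 n π, (∀ w, ¬ P w → e w = 0) ∧
      (∀ w, ¬ Q w → ζ w = 0) ∧ β = e + opX p n g τ ζ + opY p g τ η + π • β' := by
  have h0 := h.ne_zero
  obtain ⟨x, hx, _, ⟨η', hη', rfl⟩, hxy⟩ :=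
    Submodule.mem_sup.1 (hPQ _ (redSeries_support_finite h0 hβ))
  obtain ⟨e', he', _, ⟨ζ', hζ', rfl⟩, rfl⟩ := Submodule.mem_sup.1 hx
  obtain ⟨e, he, rfl, he0⟩ := exists_redSeries_eq (n := n) h0 he'.1
  obtain ⟨ζ, hζ, rfl, hζ0⟩ := exists_redSeries_eq (n := n) h0 hζ'.1
  obtain ⟨η, hη, rfl, -⟩ := exists_redSeries_eq (n := n) h0 hη'.1
  have hX := opX_mem h hζ
  have hY := opY_mem h hη
  have hred : redSeries n π (β - (e + opX p n g τ ζ + opY p g τ η)) = 0 := by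
    rw [redSeries_sub h0 hβ (add_mem_C0 (add_mem_C0 he hX) hY),
      redSeries_add h0 (add_mem_C0 he hX) hY, redSeries_add h0 he hX, redSeries_opX h hζ,
      redSeries_opY h hη, sub_eq_zero]
    exact hxy.symm
  obtain ⟨β', hβ', hb⟩ := (redSeries_eq_zero_iff h0
    (sub_mem_C0 hβ (add_mem_C0 (add_mem_C0 he hX) hY))).1 hred
  exact ⟨e, he, ζ, hζ, η, hη, β', hβ', fun w hw => he0 w (he'.2 w hw),
    fun w hw => hζ0 w (hζ'.2 w hw), by rw [← hb]; abel⟩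

/-- Iterating the approximation gives three `π`-adic series, which converge in `𝒞₀`. The difference
from `β` is divisible by every power of `π`, hence zero. Tails `E k`, `Z k`, `H k` are carried along
so that only finite additivity of the operators is needed. -/
theorem exists_decomposition (h : IsTwist p n π g τ)
    (hPQ : ∀ β : ℤ × ℤ → unitBall K ⧸ smallIdeal π, β.support.Finite →
      β ∈ symbolRange n (red π (τ 0)) P Q) {β : ℤ × ℤ → K} (hβ : β ∈ C0 n π) :
    ∃ e ∈ C0 n π, ∃ ζ ∈ C0 n π, ∃ η ∈ C0 n π, (∀ w, ¬ P w → e w = 0) ∧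
      (∀ w, ¬ Q w → ζ w = 0) ∧ β = e + opX p n g τ ζ + opY p g τ η := by
  have h0 := h.ne_zero
  choose! fe he fζ hζ fη hη fβ hfβ hP hQ hdec using
    fun β (hβ : β ∈ C0 n π) => exists_approx h hPQ hβ
  let b : ℕ → ℤ × ℤ → K := fun k => fβ^[k] β
  have hb : ∀ k, b k ∈ C0 n π := by
    intro k
    induction k with
    | zero => exact hβ
    | succ k ih => simp only [b, Function.iterate_succ_apply'] at ih ⊢; exact hfβ _ ih
  have hbs : ∀ k, b (k + 1) = fβ (b k) := fun k => Function.iterate_succ_apply' _ _ _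
  obtain ⟨E, hE, hE', hE0⟩ := exists_adic_sum h0 h.norm_lt_one (fun k => fe (b k))
    fun k => he _ (hb k)
  obtain ⟨Z, hZ, hZ', hZ0⟩ := exists_adic_sum h0 h.norm_lt_one (fun k => fζ (b k))
    fun k => hζ _ (hb k)
  obtain ⟨H, hH, hH', -⟩ := exists_adic_sum h0 h.norm_lt_one (fun k => fη (b k))
    fun k => hη _ (hb k)
  refine ⟨E 0, hE 0, Z 0, hZ 0, H 0, hH 0, fun w hw => hE0 w (fun k => hP _ (hb k) w hw) 0,
    fun w hw => hZ0 w (fun k => hQ _ (hb k) w hw) 0, ?_⟩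
  have hp1 := h.norm_lt_one.le
  have hmem : ∀ k, b k - (E k + opX p n g τ (Z k) + opY p g τ (H k)) ∈ C0 n π := fun k =>
    sub_mem_C0 (hb k) (add_mem_C0 (add_mem_C0 (hE k) (opX_mem h (hZ k))) (opY_mem h (hH k)))
  have step : ∀ k, b k - (E k + opX p n g τ (Z k) + opY p g τ (H k)) =
      π • (b (k + 1) - (E (k + 1) + opX p n g τ (Z (k + 1)) + opY p g τ (H (k + 1)))) := by
    intro k
    conv_lhs => rw [hdec _ (hb k), hE', hZ', hH', opX_add h (hζ _ (hb k)) (smul_mem_C0 hp1 (hZ _)),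
      opY_add h (hη _ (hb k)) (smul_mem_C0 hp1 (hH _)), opX_smul, opY_smul, ← hbs]
    module
  have : b 0 - (E 0 + opX p n g τ (Z 0) + opY p g τ (H 0)) = 0 := by
    refine eq_zero_of_forall_smul h0 h.norm_lt_one fun k => ⟨_, hmem k, ?_⟩
    induction k with
    | zero => simp
    | succ k ih => rw [ih, step k, smul_smul, pow_succ]
  exact sub_eq_zero.1 this

/-- Independence of the symbols makes all three reductions vanish, so `e`, `ζ`, `η` are divisible by
`π`. The quotients satisfy the same relation, and the argument repeats indefinitely. -/
theorem eq_zero_of_decomposition (h : IsTwist p n π g τ) (hn : ‖(n : K)‖ = 1)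
    {e ζ η : ℤ × ℤ → K} (he : e ∈ C0 n π) (hζ : ζ ∈ C0 n π) (hη : η ∈ C0 n π)
    (hE : ∀ w, ¬ IsEps n w → e w = 0) (hN : ∀ w, ¬ IsNormal w → ζ w = 0)
    (hsum : e + opX p n g τ ζ + opY p g τ η = 0) : e = 0 := by
  have h0 := h.ne_zero
  refine eq_zero_of_forall_smul (n := n) h0 h.norm_lt_one fun k => ?_
  have key : ∀ k : ℕ, ∃ e' ∈ C0 n π, ∃ ζ' ∈ C0 n π, ∃ η' ∈ C0 n π, (∀ w, ¬ IsEps n w → e' w = 0) ∧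
      (∀ w, ¬ IsNormal w → ζ' w = 0) ∧ e' + opX p n g τ ζ' + opY p g τ η' = 0 ∧
      e = π ^ k • e' := by
    intro k
    induction k with
    | zero => exact ⟨e, he, ζ, hζ, η, hη, hE, hN, hsum, by simp⟩
    | succ k ih =>
      obtain ⟨e, he, ζ, hζ, η, hη, hE, hN, hsum, hk⟩ := ih
      have hred : ∀ w, redSeries n π e w + symbolOp Prod.fst (n : unitBall K ⧸ smallIdeal π)
          (red π (τ 0)) ((n : ℤ), 0) (redSeries n π ζ) w + symbolOp Prod.snd 1 (red π (τ 0)) (0, 1)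
            (redSeries n π η) w = 0 := by
        intro w
        rw [← redSeries_opX h hζ, ← redSeries_opY h hη, ← Pi.add_apply, ← Pi.add_apply,
          ← redSeries_add h0 he (opX_mem h hζ),
          ← redSeries_add h0 (add_mem_C0 he (opX_mem h hζ)) (opY_mem h hη), hsum,
          (redSeries_eq_zero_iff h0 zero_mem_C0).2 ⟨0, zero_mem_C0, by simp⟩]
        rfl
      have hz : ∀ {c : ℤ × ℤ → K} {w}, c w = 0 → redSeries n π c w = 0 := by
        intro c w hw
        simp [redSeries, normalized, hw, red_zero]
      have hfin : ∃ D : ℤ, ∀ w, D < nWeight n w → redSeries n π ζ w = 0 ∧ redSeries n π η w = 0 := by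
        have hf := ((redSeries_support_finite h0 hζ).union (redSeries_support_finite h0 hη)).image
          (nWeight n)
        obtain ⟨D, hD⟩ := hf.bddAbove
        refine ⟨D, fun w hw => ?_⟩
        by_contra hcon
        refine hw.not_ge (hD ⟨w, ?_, rfl⟩)
        rw [not_and_or] at hcon
        exact hcon
      have hall := symbol_injective h.one_le_n
        (by simpa [red_natCast] using isUnit_red (π := π) hn) (isUnit_red (h.norm_tau 0))
        (fun w hw => hz (hE w hw)) (fun w hw => hz (hN w hw)) hfin hred
      obtain ⟨e', he', rfl⟩ := (redSeries_eq_zero_iff h0 he).1 (funext fun w => (hall w).1)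
      obtain ⟨ζ', hζ', rfl⟩ := (redSeries_eq_zero_iff h0 hζ).1 (funext fun w => (hall w).2.1)
      obtain ⟨η', hη', rfl⟩ := (redSeries_eq_zero_iff h0 hη).1 (funext fun w => (hall w).2.2)
      refine ⟨e', he', ζ', hζ', η', hη', fun w hw => ?_, fun w hw => ?_, ?_, ?_⟩
      · simpa [h0] using hE w hw
      · simpa [h0] using hN w hw
      · rw [opX_smul, opY_smul, ← smul_add, ← smul_add] at hsum
        exact (smul_eq_zero_iff_right h0).1 hsum
      · rw [hk, smul_smul, pow_succ]
  obtain ⟨e', he', _, _, _, _, _, _, _, hk⟩ := key k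
  exact ⟨e', he', hk⟩

/-- An arbitrary `ζ` is `ν + D_y θ` with `ν` supported on normal monomials. Then `D_x D_y θ = D_y
D_x θ` is absorbed into the image of `D_y`, reducing to the normal case. -/
theorem eq_zero_of_cohomologous (h : IsTwist p n π g τ) (hn : ‖(n : K)‖ = 1)
    {e ζ η : ℤ × ℤ → K} (he : e ∈ C0 n π) (hζ : ζ ∈ C0 n π) (hη : η ∈ C0 n π)
    (hE : ∀ w, ¬ IsEps n w → e w = 0)
    (hsum : e + opX p n g τ ζ + opY p g τ η = 0) : e = 0 := by
  obtain ⟨ν, hν, z, hz, θ, hθ, hνN, hz0, rfl⟩ := exists_decomposition h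
    (fun β => symbolRange_normal h.one_le_n (isUnit_red (h.norm_tau 0))) hζ
  -- Here `Q` is identically false, so the `D_x` part of the decomposition is absent.
  have hz0 : z = 0 := funext fun w => hz0 w id
  subst hz0
  rw [opX_zero, add_zero, opX_add h hν (opY_mem h hθ), opX_opY_comm h hθ, add_assoc, add_assoc,
    ← opY_add h (opX_mem h hθ) hη, ← add_assoc] at hsum
  exact eq_zero_of_decomposition h hn he hν (add_mem_C0 (opX_mem h hθ) hη) hE hνN hsum

/-! ### Coordinates in `H²` -/

section Basis

variable {σ : K ≃+* K} {t : K}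

/-- The estimates on the coefficients of `D_x` and `D_y`. -/
def IsTwistFor (p n : ℕ) (σ : K ≃+* K) (π t : K) : Prop :=
  IsTwist p n π (fun i => gammaSum p (π ^ n) i * (p : K) ^ i) fun i => (σ : K → K)^[i] t

theorem eps_coeff_unique (h : IsTwistFor p n σ π t) (hn : ‖(n : K)‖ = 1)
    {a : Fin (2 * n + 1) → K} {ζ η : ℤ × ℤ → K} (ha : ∀ j, ‖a j‖ ≤ 1) (hζ : ζ ∈ C0 n π) (hη : η ∈ C0 n π)
    (hsum : (∑ j : Fin (2 * n + 1), a j • epsTilde n π (j : ℕ)) + Dx p n σ (π ^ n) t ζ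
      + Dy p σ (π ^ n) t η = 0) : a = 0 := by
  rw [Dx_eq_twistOp, Dy_eq_twistOp] at hsum
  have := eq_zero_of_cohomologous h hn (sum_epsTilde_mem_C0 h.ne_zero ha) hζ hη
    (fun w hw => sum_epsTilde_apply_of_not a hw) hsum
  funext i
  have hi := congrFun this (epsExp n i)
  rw [sum_epsTilde_apply] at hi
  exact (mul_eq_zero.1 hi).resolve_right (pow_ne_zero _ h.ne_zero)

theorem Dx_sub (h : IsTwistFor p n σ π t) {c c' : ℤ × ℤ → K} (hc : c ∈ C0 n π) (hc' : c' ∈ C0 n π) :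
    Dx p n σ (π ^ n) t (c - c') = Dx p n σ (π ^ n) t c - Dx p n σ (π ^ n) t c' := by
  rw [Dx_eq_twistOp]; exact opX_sub h hc hc'

theorem Dy_sub (h : IsTwistFor p n σ π t) {c c' : ℤ × ℤ → K} (hc : c ∈ C0 n π) (hc' : c' ∈ C0 n π) :
    Dy p σ (π ^ n) t (c - c') = Dy p σ (π ^ n) t c - Dy p σ (π ^ n) t c' := by
  rw [Dy_eq_twistOp]; exact opY_sub h hc hc'

/-- A relation between classes determines the coordinates. -/
theorem coord_eq_of_cohomologous (h : IsTwistFor p n σ π t) (hn : ‖(n : K)‖ = 1)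
    {β : ℤ × ℤ → K} {a a' : Fin (2 * n + 1) → K} (ha : ∀ j, ‖a j‖ ≤ 1) (ha' : ∀ j, ‖a' j‖ ≤ 1)
    (h1 : Cohomologous p n σ π t β (∑ j : Fin (2 * n + 1), a j • epsTilde n π (j : ℕ)))
    (h2 : Cohomologous p n σ π t β (∑ j : Fin (2 * n + 1), a' j • epsTilde n π (j : ℕ))) :
    a = a' := by
  obtain ⟨ζ, hζ, η, hη, e⟩ := h1
  obtain ⟨ζ', hζ', η', hη', e'⟩ := h2
  rw [← sub_eq_zero]
  refine eps_coeff_unique h hn (fun j => norm_sub_le_of_le (ha j) (ha' j)) (sub_mem_C0 hζ hζ')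
    (sub_mem_C0 hη hη') ?_
  simp only [Pi.sub_apply, sub_smul, Finset.sum_sub_distrib]
  rw [Dx_sub h hζ hζ', Dy_sub h hη hη']
  have := e.symm.trans e'
  rw [← sub_eq_zero] at this
  rw [← this]
  abel

theorem exists_coord (h : IsTwistFor p n σ π t) (hn : ‖(n : K)‖ = 1) {β : ℤ × ℤ → K}
    (hβ : β ∈ C0 n π) : ∃ a : Fin (2 * n + 1) → K, (∀ j, ‖a j‖ ≤ 1) ∧
      Cohomologous p n σ π t β (∑ j : Fin (2 * n + 1), a j • epsTilde n π (j : ℕ)) := by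
  have h0 : π ≠ 0 := h.ne_zero
  obtain ⟨e, he, ζ, hζ, η, hη, hE, -, hsum⟩ := exists_decomposition h
    (fun β hβ => symbolRange_eps_normal h.one_le_n
      (by simpa [red_natCast] using isUnit_red (π := π) hn) (isUnit_red (h.norm_tau 0)) hβ) hβ
  refine ⟨fun j => normalized n π e (epsExp n j), fun j => norm_normalized_le_one h0 he _,
    ζ, hζ, η, hη, ?_⟩
  have : ∑ j : Fin (2 * n + 1), normalized n π e (epsExp n j) • epsTilde n π (j : ℕ) = e := by
    funext w
    by_cases hw : IsEps n w
    · obtain ⟨j, rfl⟩ := exists_epsExp_eq hw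
      rw [sum_epsTilde_apply, normalized, nWeight_epsExp, zpow_natCast,
        div_mul_cancel₀ _ (pow_ne_zero _ h0)]
    · rw [sum_epsTilde_apply_of_not _ hw, hE w hw]
  rw [this, Dx_eq_twistOp, Dy_eq_twistOp]
  exact hsum

theorem epsIsBasis (h : IsTwistFor p n σ π t) (hn : ‖(n : K)‖ = 1) [CharZero K] :
    EpsIsBasis p n σ π t := by
  refine ⟨fun ζ hζ => ?_, fun β hβ => ?_⟩
  · rw [Dx_eq_twistOp, Dy_eq_twistOp]
    exact ⟨opX_mem h hζ, opY_mem h hζ⟩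
  · obtain ⟨a, ha, hc⟩ := exists_coord h hn hβ
    exact ⟨a, ⟨ha, hc⟩, fun a' ha' => coord_eq_of_cohomologous h hn ha'.1 ha ha'.2 hc⟩

end Basis

end Basis

section ArtinHasse

/-! ### Integrality of the Artin–Hasse series -/

section ArtinHasse

open PowerSeries

variable (p : ℕ)

theorem ode_unique {H F G : PowerSeries ℚ} (hF : d⁄dX ℚ F = H * F) (hG : d⁄dX ℚ G = H * G)
    (h0 : coeff 0 F = coeff 0 G) : F = G := by
  ext k
  induction k using Nat.strong_induction_on with
  | _ k ih =>
    cases k with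
    | zero => exact h0
    | succ k =>
      have e1 := congrArg (coeff k) hF
      have e2 := congrArg (coeff k) hG
      rw [coeff_derivative, coeff_mul] at e1 e2
      have : ∑ x ∈ Finset.HasAntidiagonal.antidiagonal k, coeff x.1 H * coeff x.2 F =
          ∑ x ∈ Finset.HasAntidiagonal.antidiagonal k, coeff x.1 H * coeff x.2 G := by
        refine Finset.sum_congr rfl fun x hx => ?_
        rw [ih x.2 (by have := Finset.HasAntidiagonal.mem_antidiagonal.1 hx; omega)]
      rw [this, ← e2] at e1
      exact mul_right_cancel₀ (by positivity) e1

variable {p}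

theorem hasSubst_artinHasseLog : HasSubst (artinHasseLog p) := by
  refine HasSubst.of_constantCoeff_zero' ?_
  rw [← coeff_zero_eq_constantCoeff_apply, artinHasseLog, coeff_mk]
  split_ifs with h <;> simp

theorem coeff_derivative_artinHasseLog (j : ℕ) [Decidable (∃ k, j + 1 = p ^ k)] :
    coeff j (d⁄dX ℚ (artinHasseLog p)) = if ∃ k, j + 1 = p ^ k then 1 else 0 := by
  rw [coeff_derivative, artinHasseLog, coeff_mk]
  split_ifs with h
  · push_cast
    field_simp
  · simp

theorem derivative_artinHasse :
    d⁄dX ℚ (artinHasse p) = d⁄dX ℚ (artinHasseLog p) * artinHasse p := by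
  rw [artinHasse, derivative_subst (hasSubst_artinHasseLog), derivative_exp, mul_comm]

theorem coeff_zero_artinHasse : coeff 0 (artinHasse p) = 1 := by
  have h0 : constantCoeff (artinHasseLog p) = 0 := by
    rw [← coeff_zero_eq_constantCoeff_apply, artinHasseLog, coeff_mk]
    split_ifs <;> simp
  rw [artinHasse, coeff_subst' (hasSubst_artinHasseLog), finsum_eq_single _ 0]
  · simp
  · intro k hk
    simp [h0, hk]

/-- The derivative is `∑ x^{p^k-1}`; its term `k = 0` is 1, and `p^{k+1} - 1 = (p-1) + p(p^k-1)`
gives the others. -/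
theorem derivative_artinHasseLog_eq (hp : p.Prime) : d⁄dX ℚ (artinHasseLog p) =
    1 + X ^ (p - 1) * (d⁄dX ℚ (artinHasseLog p)).subst (X ^ p : PowerSeries ℚ) := by
  classical
  have hp1 := hp.one_lt
  ext j
  rw [map_add, coeff_X_pow_mul', ← expand_apply p hp.ne_zero, coeff_expand, coeff_one,
    coeff_derivative_artinHasseLog, coeff_derivative_artinHasseLog]
  by_cases hj : j = 0
  · subst hj
    rw [if_pos ⟨0, by simp⟩, if_pos rfl, if_neg (by omega), add_zero]
  rw [if_neg hj, zero_add]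
  by_cases hpj : p - 1 ≤ j ∧ p ∣ j - (p - 1)
  · obtain ⟨h1, q, hq⟩ := hpj
    have e : j + 1 = p * (q + 1) := by rw [mul_add, ← hq]; omega
    rw [if_pos h1, if_pos (Dvd.intro q hq.symm), hq, Nat.mul_div_cancel_left _ hp.pos]
    congr 1
    rw [e, eq_iff_iff]
    constructor
    · rintro ⟨k, hk⟩
      cases k with
      | zero =>
        rw [pow_zero] at hk
        exact absurd (Nat.eq_one_of_mul_eq_one_right hk) (by omega)
      | succ k => exact ⟨k, Nat.eq_of_mul_eq_mul_left hp.pos (by rw [hk, pow_succ'])⟩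
    · rintro ⟨k, hk⟩
      exact ⟨k + 1, by rw [hk, pow_succ']⟩
  · rw [if_neg]
    · split_ifs with h1 h2
      · exact absurd ⟨h1, h2⟩ hpj
      all_goals rfl
    · rintro ⟨k, hk⟩
      cases k with
      | zero => simp at hk; omega
      | succ k =>
        refine hpj ⟨?_, ?_⟩
        · have : p ≤ j + 1 := by rw [hk]; exact Nat.le_self_pow (by omega) p
          omega
        · have h2 : p ≤ p ^ (k + 1) := Nat.le_self_pow (by omega) p
          have : j - (p - 1) = p ^ (k + 1) - p := by omega
          rw [this]
          exact Nat.dvd_sub (dvd_pow_self p (by omega)) dvd_rfl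

/-- The functional equation behind the integrality of the Artin–Hasse series. -/
theorem artinHasse_pow (hp : p.Prime) : artinHasse p ^ p =
    expand p hp.ne_zero (artinHasse p) * rescale (p : ℚ) (exp ℚ) := by
  -- With `L` the Artin–Hasse logarithm, `p L(x) = L(x^p) + p x`. Comparing logarithmic derivatives
  -- proves the identity without forming logarithms.
  refine ode_unique (H := p * d⁄dX ℚ (artinHasseLog p)) ?_ ?_ ?_
  · rw [derivative_pow, derivative_artinHasse]
    have : artinHasse p ^ p = artinHasse p ^ (p - 1) * artinHasse p := by
      rw [← pow_succ, Nat.sub_add_cancel hp.one_le]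
    rw [this]
    ring
  · have hs : HasSubst (X ^ p : PowerSeries ℚ) := HasSubst.X_pow hp.ne_zero
    have h1 : d⁄dX ℚ (rescale (p : ℚ) (exp ℚ)) = p * rescale (p : ℚ) (exp ℚ) := by
      rw [← exp_pow_eq_rescale_exp, derivative_pow, derivative_exp, mul_assoc, ← pow_succ,
        Nat.sub_add_cancel hp.one_le]
    have h2 : d⁄dX ℚ (expand p hp.ne_zero (artinHasse p)) =
        (p : PowerSeries ℚ) * (X ^ (p - 1) * (d⁄dX ℚ (artinHasseLog p)).subst (X ^ p : PowerSeries ℚ)) *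
          expand p hp.ne_zero (artinHasse p) := by
      rw [expand_apply, derivative_subst hs, derivative_artinHasse, subst_mul hs,
        derivative_pow, derivative_X]
      ring
    rw [Derivation.leibniz, h1, h2, smul_eq_mul, smul_eq_mul]
    conv_rhs => rw [derivative_artinHasseLog_eq hp]
    ring
  · simp only [coeff_zero_eq_constantCoeff, map_pow, map_mul, constantCoeff_expand]
    rw [← coeff_zero_eq_constantCoeff_apply, ← coeff_zero_eq_constantCoeff_apply,
      coeff_zero_artinHasse]
    simp

/-- Below degree `p` only the linear term of the logarithm acts, so the series agrees with `exp`.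
This is the source of the factorials in the leading terms of the Frobenius matrix. -/
theorem coeff_artinHasse_of_lt {k : ℕ} (hk : k < p) :
    coeff k (artinHasse p) = 1 / (k.factorial : ℚ) := by
  classical
  induction k with
  | zero => simpa using coeff_zero_artinHasse
  | succ k ih =>
    have h := congrArg (coeff k) (derivative_artinHasse (p := p))
    rw [coeff_derivative, coeff_mul, Finset.sum_eq_single (0, k)] at h
    · rw [coeff_derivative_artinHasseLog, if_pos ⟨0, by simp⟩, one_mul, ih (by omega)] at h
      rw [Nat.factorial_succ, Nat.cast_mul, Nat.cast_succ]
      field_simp at h ⊢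
      exact h
    · rintro ⟨i, j⟩ hij hne
      rw [Finset.HasAntidiagonal.mem_antidiagonal] at hij
      simp only at hij
      rw [coeff_derivative_artinHasseLog, if_neg, zero_mul]
      rintro ⟨l, hl⟩
      cases l with
      | zero =>
        simp at hl
        subst hl
        exact hne (by simp; omega)
      | succ l =>
        have : p ≤ i + 1 := by simp only at hl; rw [hl]; exact Nat.le_self_pow (by omega) p
        omega
    · intro h
      exact absurd (Finset.HasAntidiagonal.mem_antidiagonal.2 (by simp)) h

variable (p) [Fact p.Prime]

/-- By Legendre's formula `(p-1) v_p(b!)` is `b` minus a digit sum that is at least 1, so `v_p(b!) ≤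
b - 1`. Hence `exp(px) ≡ 1` modulo `p`. -/
theorem norm_pow_div_factorial_le {b : ℕ} (hb : 1 ≤ b) :
    ‖((p : ℚ_[p]) ^ b / (b.factorial : ℚ_[p]))‖ ≤ ‖(p : ℚ_[p])‖ := by
  have hp : p.Prime := Fact.out
  have h1 := sub_one_mul_padicValNat_factorial (p := p) b
  have h2 : 1 ≤ (p.digits b).sum := by
    rw [Nat.one_le_iff_ne_zero]
    intro h
    have h3 : p.digits b ≠ [] := Nat.digits_ne_nil_iff_ne_zero.2 (by omega)
    have h4 := Nat.getLast_digit_ne_zero p (m := b) (by omega)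
    have h5 : (p.digits b).getLast h3 ∈ p.digits b := List.getLast_mem h3
    exact h4 (List.sum_eq_zero_iff.1 h _ h5)
  have hv : padicValNat p b.factorial + 1 ≤ b := by
    have : padicValNat p b.factorial ≤ (p - 1) * padicValNat p b.factorial :=
      Nat.le_mul_of_pos_left _ (by have := hp.two_le; omega)
    omega
  rw [norm_div, norm_pow, Padic.norm_p]
  have hf : ‖(b.factorial : ℚ_[p])‖ = (p : ℝ) ^ (-(padicValNat p b.factorial : ℤ)) := by
    rw [Padic.norm_eq_zpow_neg_valuation (by exact_mod_cast b.factorial_ne_zero),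
      Padic.valuation_natCast]
  have hp0 : (0 : ℝ) < p := by exact_mod_cast hp.pos
  rw [hf, div_le_iff₀ (by positivity), ← zpow_natCast, inv_zpow', ← zpow_neg_one,
    ← zpow_add₀ hp0.ne']
  exact zpow_le_zpow_right₀ (by exact_mod_cast hp.one_le) (by omega)

theorem norm_coeff_pow_sub_expand (f : Polynomial ℤ_[p]) (k : ℕ) :
    ‖(f ^ p - Polynomial.expand ℤ_[p] p f).coeff k‖ ≤ ‖(p : ℤ_[p])‖ := by
  have h : (f ^ p - Polynomial.expand ℤ_[p] p f).map PadicInt.toZMod = 0 := by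
    rw [Polynomial.map_sub, Polynomial.map_pow, Polynomial.map_expand, ZMod.expand_card, sub_self]
  have h2 : PadicInt.toZMod ((f ^ p - Polynomial.expand ℤ_[p] p f).coeff k) = 0 := by
    rw [← Polynomial.coeff_map, h, Polynomial.coeff_zero]
  rw [← RingHom.mem_ker, PadicInt.ker_toZMod, PadicInt.maximalIdeal_eq_span_p,
    Ideal.mem_span_singleton] at h2
  obtain ⟨c, hc⟩ := h2
  rw [hc, norm_mul]
  exact mul_le_of_le_one_right (norm_nonneg _) (PadicInt.norm_le_one c)

/-- Induction through `E(x)^p = E(x^p) exp(px)`. If `F` is the truncation below degree `k`, the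
coefficient of `x^k` in `E^p` is that of `F^p` plus `p e_k`. Both `F(x)^p ≡ F(x^p)` and `exp(px) ≡
1` hold modulo `p`, so `p e_k` is divisible by `p`. -/
theorem norm_coeff_artinHasse_le (k : ℕ) :
    ‖((coeff k (artinHasse p) : ℚ) : ℚ_[p])‖ ≤ 1 := by
  have hp : p.Prime := Fact.out
  induction k using Nat.strong_induction_on with
  | _ k ih =>
  rcases Nat.eq_zero_or_pos k with rfl | hk
  · rw [coeff_zero_artinHasse]; simp
  set E : PowerSeries ℚ_[p] := PowerSeries.map (algebraMap ℚ ℚ_[p]) (artinHasse p) with hE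
  have hcE : ∀ j, coeff j E = ((coeff j (artinHasse p) : ℚ) : ℚ_[p]) := fun j => by
    rw [hE, coeff_map]; simp
  have hfun : E ^ p = expand p hp.ne_zero E * rescale (p : ℚ_[p]) (exp ℚ_[p]) := by
    rw [hE, ← map_pow, artinHasse_pow hp, map_mul, map_expand]
    congr 1
  -- the truncation, as a polynomial over `ℤ_p`
  have hex : ∀ j, ∃ x : ℤ_[p], j < k → (x : ℚ_[p]) = coeff j E := fun j => by
    by_cases h : j < k
    · exact ⟨⟨_, ih j h⟩, fun _ => (hcE j).symm⟩
    · exact ⟨0, fun h' => absurd h' h⟩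
  choose a ha using hex
  let f : Polynomial ℤ_[p] := ∑ j ∈ Finset.range k, Polynomial.monomial j (a j)
  have hf : ∀ j, f.coeff j = if j < k then a j else 0 := fun j => by
    simp only [f, Polynomial.finsetSum_coeff, Polynomial.coeff_monomial, Finset.sum_ite_eq',
      Finset.mem_range]
  let F : PowerSeries ℚ_[p] := PowerSeries.map PadicInt.Coe.ringHom (f : PowerSeries ℤ_[p])
  have hF : ∀ j, coeff j F = ((f.coeff j : ℤ_[p]) : ℚ_[p]) := fun j => by
    simp only [F, coeff_map, Polynomial.coeff_coe]; rfl
  have hdvd : X ^ k ∣ E - F := by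
    rw [X_pow_dvd_iff]
    intro j hj
    rw [map_sub, hF, hf, if_pos hj, ha j hj, sub_self]
  obtain ⟨G, hG⟩ := hdvd
  have hEF : E = F + X ^ k * G := by rw [← hG]; ring
  have hG0 : coeff 0 G = coeff k E := by
    rw [hEF, map_add, hF, hf, if_neg (lt_irrefl _), coeff_X_pow_mul']
    simp
  -- Beyond first order the expansion is divisible by `x^{2k}` and does not reach degree `k`.
  obtain ⟨R, hR⟩ := Polynomial.powAddExpansion F (X ^ k * G) p
  have hF0 : coeff 0 F = 1 := by
    rw [hF, hf, if_pos hk, ha 0 hk, hcE, coeff_zero_artinHasse]; simp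
  -- compare the coefficients of `x ^ k`
  have hl : coeff k (E ^ p) = coeff k (F ^ p) + p * coeff k E := by
    rw [hEF, hR, ← hEF, map_add, map_add]
    have e1 : coeff k (R * (X ^ k * G) ^ 2) = 0 := by
      rw [show R * (X ^ k * G) ^ 2 = X ^ (k + k) * (R * G ^ 2) by ring, coeff_X_pow_mul',
        if_neg (by omega)]
    have e2 : coeff k ((p : PowerSeries ℚ_[p]) * F ^ (p - 1) * (X ^ k * G)) = p * coeff k E := by
      rw [show (p : PowerSeries ℚ_[p]) * F ^ (p - 1) * (X ^ k * G) =
        X ^ k * ((p : PowerSeries ℚ_[p]) * F ^ (p - 1) * G) by ring, coeff_X_pow_mul', if_pos le_rfl,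
        Nat.sub_self, ← hG0]
      simp only [coeff_zero_eq_constantCoeff, map_mul, map_pow, map_natCast]
      rw [coeff_zero_eq_constantCoeff_apply] at hF0
      rw [hF0, one_pow, mul_one]
    rw [e1, e2, add_zero]
  have hr : ‖coeff k (expand p hp.ne_zero E * rescale (p : ℚ_[p]) (exp ℚ_[p])) -
      coeff k (expand p hp.ne_zero E)‖ ≤ ‖(p : ℚ_[p])‖ := by
    rw [coeff_mul, ← Finset.sum_erase_add _ _ (a := (k, 0))
      (Finset.HasAntidiagonal.mem_antidiagonal.2 (add_zero k))]
    simp only [coeff_rescale, coeff_exp, pow_zero]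
    simp only [Nat.factorial_zero, Nat.cast_one, div_one, map_one, mul_one, add_sub_cancel_right]
    refine IsUltrametricDist.norm_sum_le_of_forall_le_of_nonneg (norm_nonneg _) ?_
    rintro ⟨i, b⟩ hib
    rw [Finset.mem_erase, Finset.HasAntidiagonal.mem_antidiagonal] at hib
    simp only [ne_eq, Prod.mk.injEq, not_and] at hib
    have hb : 1 ≤ b := by
      by_contra hb
      exact hib.1 (by omega) (by omega)
    rw [norm_mul]
    have h1 : ‖coeff i (expand p hp.ne_zero E)‖ ≤ 1 := by
      rw [coeff_expand]
      split_ifs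
      · rw [hcE]
        exact ih _ ((Nat.div_le_self i p).trans_lt (by omega))
      · simp
    have h2 := norm_pow_div_factorial_le p hb
    calc _ ≤ 1 * ‖(p : ℚ_[p]) ^ b / (b.factorial : ℚ_[p])‖ := by
          gcongr
          rw [map_div₀, map_one, map_natCast, mul_one_div]
      _ ≤ _ := by rwa [one_mul]
  have hm : ‖coeff k (F ^ p) - coeff k (expand p hp.ne_zero E)‖ ≤ ‖(p : ℚ_[p])‖ := by
    have e1 : coeff k (F ^ p) = (((f ^ p).coeff k : ℤ_[p]) : ℚ_[p]) := by
      simp only [F]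
      rw [← map_pow, ← Polynomial.coe_pow, coeff_map, Polynomial.coeff_coe]; rfl
    have e2 : coeff k (expand p hp.ne_zero E) =
        (((Polynomial.expand ℤ_[p] p f).coeff k : ℤ_[p]) : ℚ_[p]) := by
      rw [coeff_expand, Polynomial.coeff_expand hp.pos]
      split_ifs
      · have : k / p < k := Nat.div_lt_self hk hp.one_lt
        rw [hf, if_pos this, ha _ this]
      · simp
    rw [e1, e2, ← PadicInt.coe_sub, ← Polynomial.coeff_sub]
    have := norm_coeff_pow_sub_expand p f k
    rwa [PadicInt.norm_def, PadicInt.norm_def, PadicInt.coe_natCast] at this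
  have hfin : (p : ℚ_[p]) * coeff k E = (coeff k (expand p hp.ne_zero E *
      rescale (p : ℚ_[p]) (exp ℚ_[p])) - coeff k (expand p hp.ne_zero E)) -
      (coeff k (F ^ p) - coeff k (expand p hp.ne_zero E)) := by
    rw [← hfun, hl]; ring
  have hnorm : ‖(p : ℚ_[p]) * coeff k E‖ ≤ ‖(p : ℚ_[p])‖ := by
    rw [hfin]; exact norm_sub_le_of_le hr hm
  rw [norm_mul, hcE] at hnorm
  have hp0 : 0 < ‖(p : ℚ_[p])‖ := norm_pos_iff.2 (by exact_mod_cast hp.ne_zero)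
  exact le_of_mul_le_mul_left (by linarith) hp0

end ArtinHasse

end ArtinHasse

section FrobeniusMatrix

/-! ### The Frobenius operator -/

/-- The ceiling is the negative of a floor, so `α_{i,j}` is the residue of `i - pj` modulo `n`: the
least `k ≥ 0` for which `nl - k = pj - i` has an integer solution `l`. -/
theorem alphaInt_eq_emod (p : ℕ) {n : ℕ} (i j : ℤ) : alphaInt p n i j = (i - p * j) % n := by
  have h : ⌈((p : ℚ) * j - i) / n⌉ = -((i - p * j) / n) := by
    have : ((p : ℚ) * j - i) / n = -(((i - p * j : ℤ) : ℚ) / n) := by push_cast; ring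
    rw [this, Int.ceil_neg, Rat.floor_intCast_div_natCast]
  rw [alphaInt, h, Int.emod_def]
  ring

theorem alphaInt_nonneg (p : ℕ) {n : ℕ} (hn : 1 ≤ n) (i j : ℤ) : 0 ≤ alphaInt p n i j := by
  rw [alphaInt_eq_emod]
  exact Int.emod_nonneg _ (by omega)

theorem alphaInt_lt (p : ℕ) {n : ℕ} (hn : 1 ≤ n) (i j : ℤ) : alphaInt p n i j < n := by
  rw [alphaInt_eq_emod]
  exact Int.emod_lt_of_pos _ (by omega)

variable {K : Type*} [NormedField K] {p n : ℕ} {π t : K} {σ : K ≃+* K}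

section Estimates

theorem norm_splitCoeff_le (hAH : ∀ k, ‖((PowerSeries.coeff k (artinHasse p) : ℚ) : K)‖ ≤ 1)
    (k : ℕ) : ‖splitCoeff p (π ^ n) k‖ ≤ ‖π‖ ^ (n * k) := by
  rw [splitCoeff, norm_mul, norm_pow, norm_pow, ← pow_mul]
  exact mul_le_of_le_one_left (by positivity) (hAH k)

theorem alpha1_epsTilde (i : ℕ) (w : ℤ × ℤ) :
    alpha1 p n σ (π ^ n) t (epsTilde n π i) w =
      σ.symm (frobSeries p n (π ^ n) t ((p : ℤ) • w - epsExp n i) * π ^ (i : ℤ)) := by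
  rw [alpha1, psi, mulSeries, tsum_eq_single (epsExp n i)]
  · rw [epsTilde, Pi.single_eq_same, nWeight_epsExp]; rfl
  · intro u hu
    rw [epsTilde, Pi.single_eq_of_ne hu, mul_zero]

theorem norm_frobTerm_le (hAH : ∀ k, ‖((PowerSeries.coeff k (artinHasse p) : ℚ) : K)‖ ≤ 1)
    (ht : ‖t‖ = 1) (k l m : ℕ) :
    ‖t ^ k * (splitCoeff p (π ^ n) k * splitCoeff p (π ^ n) l * splitCoeff p (π ^ n) m)‖ ≤
      ‖π‖ ^ (n * (k + l + m)) := by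
  rw [norm_mul, norm_mul, norm_mul, norm_pow, ht, one_pow, one_mul, mul_add, mul_add, pow_add,
    pow_add]
  gcongr <;> exact norm_splitCoeff_le hAH _

variable [CharZero K]

variable [IsUltrametricDist K]

/-- A triple `(k,l,m)` contributes with `π^{n(k+l+m)}`, and the weight of `z^k x^{nl} y^m` is at
most `n(k+l+m)` by subadditivity. -/
theorem norm_frobSeries_le (hAH : ∀ k, ‖((PowerSeries.coeff k (artinHasse p) : ℚ) : K)‖ ≤ 1)
    (ht : ‖t‖ = 1) (h0 : π ≠ 0) (h1 : ‖π‖ ≤ 1) (w : ℤ × ℤ) :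
    ‖frobSeries p n (π ^ n) t w‖ ≤ ‖π‖ ^ nWeight n w := by
  refine IsUltrametricDist.norm_tsum_le_of_forall_le_of_nonneg (by positivity) ?_
  rintro ⟨⟨k, l, m⟩, e1, e2⟩
  refine (norm_frobTerm_le hAH ht k l m).trans ?_
  rw [← zpow_natCast]
  refine zpow_le_zpow_right_of_le_one₀ (norm_pos_iff.2 h0) h1 ?_
  simp only at e1 e2
  have hw : w = (k : ℤ) • (-(1, 1)) + ((l : ℤ) • ((n : ℤ), 0) + (m : ℤ) • (0, 1)) := by
    ext <;> simp <;> linarith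
  have a1 := nWeight_add_le n ((k : ℤ) • (-(1, 1))) ((l : ℤ) • ((n : ℤ), 0) + (m : ℤ) • (0, 1))
  have a2 := nWeight_add_le n ((l : ℤ) • ((n : ℤ), 0)) ((m : ℤ) • (0, 1))
  rw [← hw] at a1
  rw [nWeight_zsmul n (by positivity), nWeight_zsmul n (by positivity), nWeight_x,
    nWeight_y] at a2
  rw [nWeight_zsmul n (by positivity), nWeight_neg_one] at a1
  push_cast
  linarith

/-- The coefficient at `w` comes from the point `pw`, whose weight is `p` times as large; the factor
`π^i` in `ε̃_i` pays for the shift by `ε_i`. -/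
theorem norm_alpha1_le (hAH : ∀ k, ‖((PowerSeries.coeff k (artinHasse p) : ℚ) : K)‖ ≤ 1)
    (ht : ‖t‖ = 1) (h0 : π ≠ 0) (h1 : ‖π‖ ≤ 1) (hσ : ∀ x, ‖σ x‖ = ‖x‖) (i : ℕ) (w : ℤ × ℤ) :
    ‖alpha1 p n σ (π ^ n) t (epsTilde n π i) w‖ ≤ ‖π‖ ^ (p * nWeight n w) := by
  have hσ' : ∀ x, ‖σ.symm x‖ = ‖x‖ := fun x => by rw [← hσ, σ.apply_symm_apply]
  have hp : 0 < ‖π‖ := norm_pos_iff.2 h0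
  rw [alpha1_epsTilde, hσ', norm_mul, norm_zpow]
  calc _ ≤ ‖π‖ ^ nWeight n ((p : ℤ) • w - epsExp n i) * ‖π‖ ^ (i : ℤ) := by
        gcongr; exact norm_frobSeries_le hAH ht h0 h1 _
    _ = ‖π‖ ^ (nWeight n ((p : ℤ) • w - epsExp n i) + i) := (zpow_add₀ hp.ne' _ _).symm
    _ ≤ _ := by
        refine zpow_le_zpow_right_of_le_one₀ hp h1 ?_
        have := nWeight_add_le n ((p : ℤ) • w - epsExp n i) (epsExp n i)
        rwa [sub_add_cancel, nWeight_zsmul n (by positivity), nWeight_epsExp] at this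

end Estimates

/-- The points of weight less than `n` are the `(i, 0)`. -/
theorem eq_epsExp_of_nWeight_lt (hn : 1 ≤ n) {w : ℤ × ℤ} {i : ℕ} (hw : nWeight n w = i)
    (hi : i < n) : w = epsExp n i := by
  obtain ⟨a, b, c, ha, hb, hc, h, rfl⟩ := exists_monomial w
  rw [nWeight_monomial n ha hb hc h] at hw
  have : b + c = 0 := by
    by_contra hbc
    have : (n : ℤ) * 1 ≤ n * (b + c) := by gcongr; omega
    omega
  rw [this] at hw
  rw [epsExp, if_pos hi.le]
  ext <;> simp <;> omega

theorem mem_C0_of_overconvergent (hp : 2 ≤ p) (hn : 1 ≤ n) (h0 : π ≠ 0) (h1 : ‖π‖ < 1)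
    {c : ℤ × ℤ → K} (hc : ∀ w, ‖c w‖ ≤ ‖π‖ ^ (p * nWeight n w)) (D : ℕ)
    (hD : ∀ w, nWeight n w < D → c w = 0) :
    ∃ c' ∈ C0 n π, c = π ^ ((p - 1) * D) • c' := by
  have hr : 0 < ‖π‖ := norm_pos_iff.2 h0
  have hb : ∀ J : ℕ, ∀ w, D + J ≤ nWeight n w →
      ‖(π ^ ((p - 1) * D))⁻¹ * c w‖ ≤ ‖π‖ ^ J * ‖π‖ ^ nWeight n w := by
    intro J w hw
    rw [norm_mul, norm_inv, norm_pow, inv_mul_le_iff₀ (by positivity)]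
    refine (hc w).trans ?_
    rw [← zpow_natCast, ← zpow_natCast, ← zpow_add₀ hr.ne', ← zpow_add₀ hr.ne']
    refine zpow_le_zpow_right_of_le_one₀ hr h1.le ?_
    -- After dividing by `π^{(p-1)D}` an exponent of at least `W(w) - D` remains in surplus, and
    -- this forces the quotient to tend to zero.
    have h2 : ((p - 1 : ℕ) : ℤ) * (nWeight n w - D) ≥ 1 * (nWeight n w - D) := by
      gcongr
      · omega
      · omega
    push_cast [Nat.cast_sub (by omega : 1 ≤ p)] at h2 ⊢
    linarith
  refine ⟨(π ^ ((p - 1) * D))⁻¹ • c, mem_C0_of_eventually h0 (fun w => ?_) fun ε hε => ?_, ?_⟩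
  · rcases lt_or_ge (nWeight n w) D with hw | hw
    · simp only [Pi.smul_apply, hD w hw, smul_zero, norm_zero]; positivity
    · simpa using hb 0 w (by simpa using hw)
  · obtain ⟨J, hJ⟩ := exists_pow_lt_of_lt_one hε h1
    filter_upwards [(finite_nWeight_le hn (D + J)).compl_mem_cofinite] with w hw
    rw [Set.mem_compl_iff, Set.mem_ofPred_eq, not_le] at hw
    refine (hb J w hw.le).trans ?_
    gcongr
  · rw [smul_smul, mul_inv_cancel₀ (pow_ne_zero _ h0), one_smul]

/-! ### Entries of the Frobenius matrix -/

section Matrix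

theorem sum_first_epsTilde_apply (hn : 1 ≤ n) (h0 : π ≠ 0) (c : ℤ × ℤ → K) {D : ℕ} (hD : D ≤ n)
    (w : ℤ × ℤ) :
    (∑ j : Fin (2 * n + 1), (if (j : ℕ) < D then c (epsExp n j) / π ^ (j : ℕ) else 0) •
      epsTilde n π (j : ℕ)) w = if nWeight n w < D then c w else 0 := by
  by_cases hE : IsEps n w
  · obtain ⟨j, rfl⟩ := exists_epsExp_eq hE
    rw [sum_epsTilde_apply (fun j : Fin (2 * n + 1) =>
      if (j : ℕ) < D then c (epsExp n j) / π ^ (j : ℕ) else 0), nWeight_epsExp]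
    simp only [Nat.cast_lt, ite_mul, zero_mul]
    rw [div_mul_cancel₀ _ (pow_ne_zero _ h0)]
  · rw [sum_epsTilde_apply_of_not _ hE, if_neg]
    intro hw
    have h2 := nWeight_nonneg n w
    refine hE ?_
    obtain ⟨i, hi⟩ := Int.eq_ofNat_of_zero_le h2
    rw [eq_epsExp_of_nWeight_lt hn hi (by omega)]
    exact epsExp_isEps ⟨i, by omega⟩

variable [IsUltrametricDist K]

variable [CompleteSpace K]

/-- For `D ≤ n` the points of weight below `D` are themselves among the `ε_i`, so their coefficients
are coordinates as they stand. What remains is `π^{(p-1)D}` times an element of `𝒞₀`, and its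
coordinates inherit the factor. -/
theorem coord_overconvergent (h : IsTwistFor p n σ π t) (hp : 2 ≤ p) (hn : ‖(n : K)‖ = 1)
    {c : ℤ × ℤ → K} (hc : ∀ w, ‖c w‖ ≤ ‖π‖ ^ (p * nWeight n w))
    {a : Fin (2 * n + 1) → K} (ha : ∀ j, ‖a j‖ ≤ 1)
    (hca : Cohomologous p n σ π t c (∑ j : Fin (2 * n + 1), a j • epsTilde n π (j : ℕ)))
    {D : ℕ} (hD : D ≤ n) (j : Fin (2 * n + 1)) :
    ‖a j - (if (j : ℕ) < D then c (epsExp n j) / π ^ (j : ℕ) else 0)‖ ≤ ‖π‖ ^ ((p - 1) * D) := by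
  have h0 : π ≠ 0 := h.ne_zero
  have h1 : ‖π‖ < 1 := h.norm_lt_one
  have hr : 0 < ‖π‖ := norm_pos_iff.2 h0
  let b : Fin (2 * n + 1) → K := fun j => if (j : ℕ) < D then c (epsExp n j) / π ^ (j : ℕ) else 0
  have hb : ∀ j, ‖b j‖ ≤ 1 := fun j => by
    simp only [b]
    split_ifs
    · rw [norm_div, norm_pow, div_le_one (by positivity)]
      refine (hc _).trans ?_
      rw [nWeight_epsExp, ← zpow_natCast]
      refine zpow_le_zpow_right_of_le_one₀ hr h1.le ?_
      exact le_mul_of_one_le_left (by positivity) (by exact_mod_cast (by omega : 1 ≤ p))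
    · simp
  let c₁ : ℤ × ℤ → K := c - ∑ j : Fin (2 * n + 1), b j • epsTilde n π (j : ℕ)
  have hc₁ : ∀ w, c₁ w = if nWeight n w < D then 0 else c w := fun w => by
    simp only [c₁, Pi.sub_apply]
    rw [sum_first_epsTilde_apply h.one_le_n h0 c hD]
    split_ifs <;> simp
  obtain ⟨c', hc', e⟩ := mem_C0_of_overconvergent (c := c₁) hp h.one_le_n h0 h1
    (fun w => by
      rw [hc₁]
      split_ifs
      · rw [norm_zero]; positivity
      · exact hc w) D (fun w hw => by rw [hc₁, if_pos hw])
  obtain ⟨a', ha', ζ, hζ, η, hη, hc'e⟩ := exists_coord h hn hc'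
  have hM : ‖π ^ ((p - 1) * D)‖ ≤ 1 := by
    rw [norm_pow]; exact pow_le_one₀ (norm_nonneg _) h1.le
  have hfin := coord_eq_of_cohomologous h hn (a := b + π ^ ((p - 1) * D) • a')
    (fun j => norm_add_le_of_le (hb j) (by
      rw [Pi.smul_apply, smul_eq_mul, norm_mul]
      exact mul_le_one₀ hM (norm_nonneg _) (ha' j))) ha
    ⟨_, smul_mem_C0 hM hζ, _, smul_mem_C0 hM hη, by
      rw [Dx_eq_twistOp, Dy_eq_twistOp, twistOp_smul, twistOp_smul, ← Dx_eq_twistOp,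
        ← Dy_eq_twistOp]
      have e2 : c = c₁ + ∑ j : Fin (2 * n + 1), b j • epsTilde n π (j : ℕ) := by
        simp only [c₁, sub_add_cancel]
      rw [e2, e, hc'e]
      simp only [Pi.add_apply, add_smul, Finset.sum_add_distrib, Pi.smul_apply, smul_add,
        Finset.smul_sum, smul_assoc]
      abel⟩ hca
  rw [← hfin]
  simp only [b, Pi.add_apply, add_sub_cancel_left, Pi.smul_apply, smul_eq_mul, norm_mul, norm_pow]
  exact mul_le_of_le_one_right (by positivity) (ha' j)

variable [CharZero K]

/-- The leading term of `F_t` on the axis `y ^ 0`. -/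
theorem frobSeries_leading
    (hAH : ∀ k, ‖((PowerSeries.coeff k (artinHasse p) : ℚ) : K)‖ ≤ 1)
    (ht : ‖t‖ = 1) (hn : 1 ≤ n) (h1 : ‖π‖ < 1) {k l : ℕ} (hk : k < n) :
    ‖frobSeries p n (π ^ n) t ((n : ℤ) * l - k, 0) - t ^ k *
      (splitCoeff p (π ^ n) k * splitCoeff p (π ^ n) l * splitCoeff p (π ^ n) k)‖ ≤
      ‖π‖ ^ (n * (k + l + k) + 1) := by
  let S := {s : ℕ × ℕ × ℕ // (n : ℤ) * s.2.1 - s.1 = (n : ℤ) * l - k ∧ (s.2.2 : ℤ) - s.1 = 0}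
  have hinj : Function.Injective fun s : S => s.1.1 := by
    rintro ⟨⟨a, b, c⟩, h, h'⟩ ⟨⟨a', b', c'⟩, g, g'⟩ haa
    simp only at h h' g g' haa
    subst haa
    have : (n : ℤ) * b = n * b' := by linarith
    have hb : (b : ℤ) = b' := mul_left_cancel₀ (by omega) this
    have hb' : b = b' := by exact_mod_cast hb
    have hc : c = c' := by omega
    subst hb' hc
    rfl
  have hsum : Summable fun s : S => t ^ s.1.1 * (splitCoeff p (π ^ n) s.1.1 *
      splitCoeff p (π ^ n) s.1.2.1 * splitCoeff p (π ^ n) s.1.2.2) := by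
    refine Summable.of_norm_bounded
      ((summable_geometric_of_lt_one (norm_nonneg π) h1).comp_injective hinj) fun s => ?_
    refine (norm_frobTerm_le hAH ht _ _ _).trans (pow_le_pow_of_le_one (norm_nonneg _) h1.le ?_)
    have : 1 * s.1.1 ≤ n * (s.1.1 + s.1.2.1 + s.1.2.2) := by gcongr; omega
    exact (one_mul _).symm.le.trans this
  let s₀ : S := ⟨(k, l, k), by simp⟩
  have e := hsum.tsum_eq_add_tsum_ite s₀
  rw [frobSeries, e]
  simp only [s₀, add_sub_cancel_left]
  refine IsUltrametricDist.norm_tsum_le_of_forall_le_of_nonneg (by positivity) ?_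
  rintro ⟨⟨a, b, c⟩, h, h'⟩
  split_ifs with heq
  · rw [norm_zero]; positivity
  · refine (norm_frobTerm_le hAH ht _ _ _).trans (pow_le_pow_of_le_one (norm_nonneg _) h1.le ?_)
    simp only at h h' ⊢
    have hc : (c : ℤ) = a := by omega
    have hab : (n : ℤ) * (b - l) = a - k := by linarith
    -- The contributing triples are `(k + ns, l + s, k + ns)`. As `k < n`, a negative `s` would make
    -- the first entry negative, and `s = 0` is the leading term.
    have hbl : (l : ℤ) < b := by
      by_contra hcon
      rcases lt_or_eq_of_le (not_lt.1 hcon) with hlt | hlt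
      · have : (n : ℤ) * (b - l) ≤ n * (-1) := by gcongr; omega
        omega
      · apply heq
        rw [hlt, sub_self, mul_zero] at hab
        obtain rfl : b = l := by exact_mod_cast hlt
        obtain rfl : a = k := by omega
        obtain rfl : c = a := by omega
        rfl
    have h3 : (n : ℤ) * 1 ≤ n * (b - l) := by gcongr; omega
    have h4 : k + l + k + 1 ≤ a + b + c := by omega
    calc n * (k + l + k) + 1 ≤ n * (k + l + k) + n * 1 := by omega
      _ = n * (k + l + k + 1) := by ring
      _ ≤ _ := by gcongr

/-- The entries of the Frobenius matrix in the first columns, up to higher order. -/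
theorem frobenius_entry (h : IsTwistFor p n σ π t) (hn : ‖(n : K)‖ = 1) (hn2 : 2 ≤ n)
    (hAH : ∀ k, ‖((PowerSeries.coeff k (artinHasse p) : ℚ) : K)‖ ≤ 1)
    (hσ : ∀ x, ‖σ x‖ = ‖x‖) (hσπ : σ π = π) (ht : ‖t‖ = 1)
    (hp : (2 * n + 1) * (n - 1) + 1 ≤ p - 1)
    {A : Matrix (Fin (2 * n + 1)) (Fin (2 * n + 1)) K} (hA : IsFrobeniusMatrix p n σ π t A)
    {i j : Fin (2 * n + 1)} (hi : (i : ℕ) < n) (hj : (j : ℕ) + 1 < n) {k l : ℕ}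
    (hk : (k : ℤ) = alphaInt p n (i : ℕ) (j : ℕ)) (hl : (n : ℤ) * l = p * j - i + k) :
    ∃ e : K, ‖e‖ ≤ ‖π‖ ∧ A i j = π ^ ((p - 1) * (j : ℕ) + (2 * n + 1) * k) *
      (σ.symm t ^ k / ((k.factorial : K) ^ 2 * (l.factorial : K)) + e) := by
  have h0 : π ≠ 0 := h.ne_zero
  have h1 : ‖π‖ < 1 := h.norm_lt_one
  have hr : 0 < ‖π‖ := norm_pos_iff.2 h0
  have hkn : k < n := by
    have := alphaInt_lt p (n := n) (by omega) (i : ℕ) (j : ℕ)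
    omega
  have hkn' : (2 * n + 1) * k ≤ (2 * n + 1) * (n - 1) := by gcongr; omega
  have hnp : n < p := by
    have : 1 * (n - 1) ≤ (2 * n + 1) * (n - 1) := by gcongr; omega
    omega
  -- Needed so that the Artin–Hasse coefficient is `1/l!`; this uses that `j` stays below `n - 1`.
  have hlp : l < p := by
    by_contra hcon
    have h2 : (n : ℤ) * p ≤ n * l := by gcongr; omega
    have h3 : (p : ℤ) * (j + 1) ≤ p * (n - 1) := by gcongr; omega
    have h4 : (p : ℤ) * (n - 1) = n * p - p := by ring
    have h5 : (p : ℤ) * (j + 1) = p * j + p := by ring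
    omega
  have hσ' : ∀ x, ‖σ.symm x‖ = ‖x‖ := fun x => by rw [← hσ, σ.apply_symm_apply]
  have hσπ' : σ.symm π = π := by rw [← hσπ, σ.symm_apply_apply, hσπ]
  have hc := norm_alpha1_le hAH ht h0 h1.le hσ (i : ℕ) (p := p) (n := n)
  -- With `D = j + 1` the coefficient at `ε_j` is kept, and the error is divisible by
  -- `π^{(p-1)(j+1)}`. This beats the leading exponent because `(2n+1)k ≤ (2n+1)(n-1) < p - 1`.
  have key := coord_overconvergent h (by omega) hn hc (hA.1 i) (hA.2 i) (D := j + 1)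
    (by omega) j
  rw [if_pos (Nat.lt_succ_self _), alpha1_epsTilde] at key
  have hej : (p : ℤ) • epsExp n j - epsExp n i = ((n : ℤ) * l - k, 0) := by
    rw [epsExp, epsExp, if_pos (by omega), if_pos (by omega)]
    ext
    · simp; linarith
    · simp
  rw [hej] at key
  have hlead := frobSeries_leading hAH ht (by omega) h1 (p := p) (n := n) (π := π) (t := t)
    (l := l) hkn
  -- The factors `π^i` and `π^j` from `ε̃_i` and `ε̃_j`, combined with `nl = pj - i + k`, leave the
  -- exponent `(p-1)j + (2n+1)k`.
  have hexp : n * (k + l + k) + i = (p - 1) * (j : ℕ) + (2 * n + 1) * k + j := by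
    zify [show 1 ≤ p by omega]
    linear_combination hl
  set N := (p - 1) * (j : ℕ) + (2 * n + 1) * k with hN
  set F := frobSeries p n (π ^ n) t ((n : ℤ) * l - k, 0) with hF
  set T := t ^ k * (splitCoeff p (π ^ n) k * splitCoeff p (π ^ n) l * splitCoeff p (π ^ n) k)
    with hT
  have hsT : σ.symm (T * π ^ ((i : ℕ) : ℤ)) / π ^ (j : ℕ) =
      π ^ N * (σ.symm t ^ k / ((k.factorial : K) ^ 2 * (l.factorial : K))) := by
    rw [hT]
    simp only [splitCoeff]
    rw [coeff_artinHasse_of_lt (by omega : k < p), coeff_artinHasse_of_lt hlp, zpow_natCast]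
    rw [show t ^ k * (((1 / (k.factorial : ℚ) : ℚ) : K) * (π ^ n) ^ k *
      (((1 / (l.factorial : ℚ) : ℚ) : K) * (π ^ n) ^ l) *
        (((1 / (k.factorial : ℚ) : ℚ) : K) * (π ^ n) ^ k)) * π ^ (i : ℕ) =
      t ^ k * ((((1 / (k.factorial : ℚ)) ^ 2 * (1 / (l.factorial : ℚ)) : ℚ)) : K) *
        π ^ (n * (k + l + k) + i) by push_cast; ring, hexp]
    simp only [map_mul, map_pow, map_ratCast, hσπ', pow_add, one_div]
    have := pow_ne_zero (j : ℕ) h0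
    push_cast
    field_simp
  refine ⟨(A i j - π ^ N * (σ.symm t ^ k / ((k.factorial : K) ^ 2 * (l.factorial : K)))) / π ^ N,
    ?_, ?_⟩
  · rw [norm_div, div_le_iff₀ (by rw [norm_pow]; positivity), norm_pow, ← pow_succ', ← hsT]
    have e1 : A i j - σ.symm (T * π ^ ((i : ℕ) : ℤ)) / π ^ (j : ℕ) =
      (A i j - σ.symm (F * π ^ ((i : ℕ) : ℤ)) / π ^ (j : ℕ)) +
        σ.symm ((F - T) * π ^ ((i : ℕ) : ℤ)) / π ^ (j : ℕ) := by
      rw [sub_mul, map_sub]; ring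
    rw [e1]
    refine norm_add_le_of_le (key.trans ?_) ?_
    · refine pow_le_pow_of_le_one hr.le h1.le ?_
      rw [mul_add, hN]
      omega
    · rw [norm_div, hσ', norm_mul, zpow_natCast, norm_pow, norm_pow, div_le_iff₀ (by positivity)]
      calc _ ≤ ‖π‖ ^ (n * (k + l + k) + 1) * ‖π‖ ^ (i : ℕ) := by gcongr
        _ = ‖π‖ ^ (N + 1) * ‖π‖ ^ (j : ℕ) := by
            rw [← pow_add, ← pow_add]
            congr 1
            omega
        _ ≤ _ := le_rfl
  · have := pow_ne_zero N h0
    field_simp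
    ring

/-- The divisibility of the columns of the Frobenius matrix. -/
theorem norm_frobenius_entry_le (h : IsTwistFor p n σ π t) (hn : ‖(n : K)‖ = 1) (hp : 2 ≤ p)
    (hAH : ∀ k, ‖((PowerSeries.coeff k (artinHasse p) : ℚ) : K)‖ ≤ 1)
    (hσ : ∀ x, ‖σ x‖ = ‖x‖) (ht : ‖t‖ = 1)
    {A : Matrix (Fin (2 * n + 1)) (Fin (2 * n + 1)) K} (hA : IsFrobeniusMatrix p n σ π t A)
    (i j : Fin (2 * n + 1)) : ‖A i j‖ ≤ ‖π‖ ^ ((p - 1) * min (j : ℕ) n) := by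
  have := coord_overconvergent h hp hn (norm_alpha1_le hAH ht h.ne_zero h.norm_lt_one.le hσ (i : ℕ))
    (hA.1 i) (hA.2 i) (min_le_right (j : ℕ) n) j
  rwa [if_neg (by omega), sub_zero] at this

theorem existsUnique_frobeniusMatrix (h : IsTwistFor p n σ π t) (hn : ‖(n : K)‖ = 1) (hp : 2 ≤ p)
    (hAH : ∀ k, ‖((PowerSeries.coeff k (artinHasse p) : ℚ) : K)‖ ≤ 1)
    (hσ : ∀ x, ‖σ x‖ = ‖x‖) (ht : ‖t‖ = 1) :
    ∃! A : Matrix (Fin (2 * n + 1)) (Fin (2 * n + 1)) K, IsFrobeniusMatrix p n σ π t A := by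
  have hmem : ∀ i : Fin (2 * n + 1), alpha1 p n σ (π ^ n) t (epsTilde n π (i : ℕ)) ∈ C0 n π := by
    intro i
    obtain ⟨c, hc, e⟩ := mem_C0_of_overconvergent hp h.one_le_n h.ne_zero h.norm_lt_one
      (norm_alpha1_le hAH ht h.ne_zero h.norm_lt_one.le hσ (i : ℕ) (p := p) (n := n)) 0
      (fun w hw => absurd (nWeight_nonneg n w) (by simpa using hw))
    rw [e]
    simpa using hc
  choose a ha hca using fun i => exists_coord h hn (hmem i)
  refine ⟨Matrix.of a, ⟨fun i j => ha i j, fun i => hca i⟩, fun B hB => ?_⟩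
  funext i
  exact coord_eq_of_cohomologous h hn (hB.1 i) (ha i) (hB.2 i) (hca i)

end Matrix

end FrobeniusMatrix

section LeadingDeterminant

/-! ### Minimal permutations and the leading determinant -/

section Combinatorics

open Finset

variable {m : ℕ}

theorem vandermondeLike_natCast (x : Fin m → ℕ) (i j : Fin m) :
    vandermondeLike m (fun i => (x i : ℤ)) i j = (((x i).descFactorial j : ℕ) : ℤ) ^ 2 := by
  rw [vandermondeLike, Matrix.of_apply, Finset.prod_pow]
  congr 1
  induction (j : ℕ) with
  | zero => simp
  | succ k ih =>
    rw [Finset.prod_range_succ, ih, Nat.descFactorial_succ, mul_comm]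
    rcases le_or_gt k (x i) with h | h
    · push_cast [Nat.cast_sub h]; ring
    · rw [Nat.descFactorial_of_lt h]; simp

/-- Reduction of `r + i` modulo `n`, for `r + i < 2 n`. -/
def wrap (n r i : ℕ) : ℕ := if r + i < n then r + i else r + i - n

/-- The coefficient `1 / (k!² l!)` of the leading term of a Frobenius matrix entry. -/
def leadCoeff (n r L i : ℕ) : ℚ :=
  1 / (((wrap n r i).factorial : ℚ) ^ 2 * ((if r + i < n then L else L - 1).factorial : ℚ))

/-- When rows `i` and `M` both wrap or both do not, `l` is the same for both, and the residues
differ by `M - i`. The ratio of the squared factorials is then a squared falling factorial. -/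
theorem leadCoeff_eq {n r L i M : ℕ} (hi : i ≤ M)
    (h : n ≤ r + M → n ≤ r + i) :
    leadCoeff n r L i = (((wrap n r M).descFactorial (M - i) : ℕ) : ℚ) ^ 2 * leadCoeff n r L M := by
  have hw : wrap n r M - (M - i) = wrap n r i ∧ M - i ≤ wrap n r M ∧
      (if r + i < n then L else L - 1) = (if r + M < n then L else L - 1) := by
    unfold wrap
    split_ifs <;> omega
  have h1 := Nat.factorial_mul_descFactorial hw.2.1
  rw [hw.1] at h1
  rw [leadCoeff, leadCoeff, hw.2.2, ← h1]
  have := Nat.factorial_ne_zero (wrap n r i)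
  have : ((wrap n r M).descFactorial (M - i) : ℚ) ≠ 0 := by
    exact_mod_cast (Nat.descFactorial_pos.2 hw.2.1).ne'
  push_cast
  field_simp

/-- If row `M` wraps and row `i` does not, the wrapped residue `r + M - n` is smaller than `M - i`.
Thus the determinant drops exactly the permutations that are not minimal. -/
theorem descFactorial_wrap_eq_zero {n r i M : ℕ} (h : n ≤ r + M) (h' : r + i < n) :
    (wrap n r M).descFactorial (M - i) = 0 := by
  refine Nat.descFactorial_of_lt ?_
  unfold wrap
  split_ifs <;> omega

variable {n : ℕ} {r : Fin m → ℕ}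

theorem wrap_injective {M : ℕ} (hr : ∀ j, r j < n) (hinj : Function.Injective r) :
    Function.Injective fun j => wrap n (r j) M := by
  intro a b hab
  apply hinj
  have h1 := hr a
  have h2 := hr b
  dsimp only at hab
  unfold wrap at hab
  split_ifs at hab <;> omega

theorem wrap_lt {r M : ℕ} (hM : M < n) (hr : r < n) : wrap n r M < n := by
  unfold wrap
  split_ifs <;> omega

open Classical in
/-- The sum over the permutations that wrap as often as possible is a multiple of the
determinant of the Vandermonde-like matrix. -/
theorem sum_leadCoeff (L : Fin m → ℕ) :
    ∑ δ : Equiv.Perm (Fin m), (if ∀ i, n ≤ r (δ i) + (m - 1) → n ≤ r (δ i) + i then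
      ((Equiv.Perm.sign δ : ℤ) : ℚ) * ∏ i : Fin m, leadCoeff n (r (δ i)) (L (δ i)) i else 0) =
    ((Equiv.Perm.sign (Fin.revPerm : Equiv.Perm (Fin m)) : ℤ) : ℚ) *
      ((vandermondeLike m fun j => (wrap n (r j) (m - 1) : ℤ)).det : ℚ) *
      ∏ j : Fin m, leadCoeff n (r j) (L j) (m - 1) := by
  set V := vandermondeLike m fun j => (wrap n (r j) (m - 1) : ℤ) with hV
  have h1 : ((Equiv.Perm.sign (Fin.revPerm : Equiv.Perm (Fin m)) : ℤ) : ℚ) * (V.det : ℚ) =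
      (((V.submatrix id (Fin.revPerm : Equiv.Perm (Fin m))).det : ℤ) : ℚ) := by
    rw [Matrix.det_permute']
    push_cast
    rfl
  rw [h1, Matrix.det_apply', Int.cast_sum, Finset.sum_mul]
  refine Finset.sum_congr rfl fun δ _ => ?_
  have h2 : ∏ j : Fin m, leadCoeff n (r j) (L j) (m - 1) =
      ∏ i : Fin m, leadCoeff n (r (δ i)) (L (δ i)) (m - 1) :=
    (Equiv.prod_comp δ fun j => leadCoeff n (r j) (L j) (m - 1)).symm
  -- Column reversal turns the index `i` into `m - 1 - i`, the length of the falling factorial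
  -- relative to the last row.
  have h3 : ∀ i : Fin m, V.submatrix id (Fin.revPerm : Equiv.Perm (Fin m)) (δ i) i =
      (((wrap n (r (δ i)) (m - 1)).descFactorial (m - 1 - i) : ℕ) : ℤ) ^ 2 := fun i => by
    rw [Matrix.submatrix_apply, hV, vandermondeLike_natCast]
    simp only [id, Fin.revPerm_apply, Fin.val_rev]
    rw [show m - ((i : ℕ) + 1) = m - 1 - i by omega]
  rw [h2, Int.cast_mul, Int.cast_prod, mul_assoc, ← Finset.prod_mul_distrib]
  simp only [h3]
  split_ifs with hW
  · congr 1
    refine Finset.prod_congr rfl fun i _ => ?_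
    rw [leadCoeff_eq (M := m - 1) (by omega) (hW i)]
    push_cast
    rfl
  · push Not at hW
    obtain ⟨i, hi, hi'⟩ := hW
    rw [Finset.prod_eq_zero (Finset.mem_univ i), mul_zero]
    rw [descFactorial_wrap_eq_zero hi hi']
    simp

/-- Every wrap lowers the sum by `n`, so minimizing the sum means maximizing the number of wraps. -/
theorem sum_wrap (δ : Equiv.Perm (Fin m)) :
    ∑ i : Fin m, (wrap n (r (δ i)) i : ℤ) = ∑ j : Fin m, (r j : ℤ) + ∑ i : Fin m, (i : ℤ) -
      n * #{i : Fin m | n ≤ r (δ i) + i} := by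
  rw [← Equiv.sum_comp δ fun j => (r j : ℤ), ← Finset.sum_add_distrib, Finset.card_filter]
  push_cast
  rw [Finset.mul_sum, ← Finset.sum_sub_distrib]
  refine Finset.sum_congr rfl fun i _ => ?_
  unfold wrap
  split_ifs <;> omega

/-- A column can wrap in some row only if it wraps in the last row `m - 1`. The number of such
columns bounds the number of wraps, and a permutation attains the bound exactly when each of them
receives a row where it wraps. The hypothesis says that the bound is attained. -/
theorem minimal_iff (hn : 0 < n)
    (h : ∃ δ : Equiv.Perm (Fin m), ∀ i, n ≤ r (δ i) + (m - 1) → n ≤ r (δ i) + i)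
    (δ : Equiv.Perm (Fin m)) :
    (∀ δ' : Equiv.Perm (Fin m),
      ∑ i : Fin m, (wrap n (r (δ i)) i : ℤ) ≤ ∑ i : Fin m, (wrap n (r (δ' i)) i : ℤ)) ↔
    ∀ i, n ≤ r (δ i) + (m - 1) → n ≤ r (δ i) + i := by
  have hcard : ∀ δ : Equiv.Perm (Fin m), #{i : Fin m | n ≤ r (δ i) + (m - 1)} =
      #{j : Fin m | n ≤ r j + (m - 1)} := fun δ => by
    rw [Finset.card_filter, Finset.card_filter]
    exact Equiv.sum_comp δ fun j => if n ≤ r j + (m - 1) then 1 else 0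
  have hsub : ∀ δ : Equiv.Perm (Fin m), ({i : Fin m | n ≤ r (δ i) + i} : Finset (Fin m)) ⊆
      ({i : Fin m | n ≤ r (δ i) + (m - 1)} : Finset (Fin m)) := fun δ i hi => by
    simp only [Finset.mem_filter, Finset.mem_univ, true_and] at hi ⊢
    omega
  have hle : ∀ δ : Equiv.Perm (Fin m), #{i : Fin m | n ≤ r (δ i) + i} ≤
      #{j : Fin m | n ≤ r j + (m - 1)} := fun δ => (Finset.card_le_card (hsub δ)).trans (hcard δ).le
  have hW : ∀ δ : Equiv.Perm (Fin m), (∀ i, n ≤ r (δ i) + (m - 1) → n ≤ r (δ i) + i) ↔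
      #{i : Fin m | n ≤ r (δ i) + i} = #{j : Fin m | n ≤ r j + (m - 1)} := fun δ => by
    rw [← hcard δ]
    constructor
    · intro h
      refine congrArg Finset.card (Finset.filter_congr fun i _ => ⟨fun h' => by omega, h i⟩)
    · intro h i hi
      have := Finset.eq_of_subset_of_card_le (hsub δ) h.ge
      have hi' : i ∈ ({i : Fin m | n ≤ r (δ i) + (m - 1)} : Finset (Fin m)) := by simpa using hi
      rw [← this] at hi'
      simpa using hi'
  obtain ⟨δ₀, h₀⟩ := h
  rw [hW] at h₀ ⊢
  simp only [sum_wrap]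
  constructor
  · intro h
    have h1 := h δ₀
    have h2 := hle δ
    rw [h₀] at h1
    have : (n : ℤ) * #{j : Fin m | n ≤ r j + (m - 1)} ≤ n * #{i : Fin m | n ≤ r (δ i) + i} := by
      linarith
    have := le_of_mul_le_mul_left this (by exact_mod_cast hn)
    omega
  · intro h δ'
    rw [h]
    have : (n : ℤ) * #{i : Fin m | n ≤ r (δ' i) + i} ≤ n * #{j : Fin m | n ≤ r j + (m - 1)} := by
      exact mul_le_mul_of_nonneg_left (by exact_mod_cast hle δ') (by positivity)
    linarith

/-- Passing from the first `m` columns to another set replaces indices below `m` by indices at least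
`m`, whose capped value is still at least `m` because `m ≤ n`. The cap is that of the known
divisibility of the columns. -/
theorem sum_min_lt {N n m : ℕ} (hmn : m ≤ n) (S S₀ : Finset (Fin N)) (hS : #S = #S₀)
    (h₀ : ∀ j, j ∈ S₀ ↔ (j : ℕ) < m) (hne : S ≠ S₀) :
    ∑ j ∈ S₀, (j : ℕ) + 1 ≤ ∑ j ∈ S, min (j : ℕ) n := by
  have hc : #(S \ S₀) = #(S₀ \ S) := Finset.card_sdiff_comm hS
  have hpos : 0 < #(S \ S₀) := by
    rw [Finset.card_pos, Finset.sdiff_nonempty]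
    exact fun h => hne (Finset.eq_of_subset_of_card_le h hS.ge)
  have e1 := Finset.sum_inter_add_sum_sdiff S S₀ fun j : Fin N => min (j : ℕ) n
  have e2 := Finset.sum_inter_add_sum_sdiff S₀ S fun j : Fin N => (j : ℕ)
  have e3 : ∑ j ∈ S ∩ S₀, min (j : ℕ) n = ∑ j ∈ S₀ ∩ S, (j : ℕ) := by
    rw [Finset.inter_comm]
    refine Finset.sum_congr rfl fun j hj => ?_
    have := (h₀ j).1 (Finset.mem_inter.1 hj).1
    omega
  have e4 : #(S \ S₀) * m ≤ ∑ j ∈ S \ S₀, min (j : ℕ) n := by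
    rw [← smul_eq_mul]
    refine Finset.card_nsmul_le_sum _ _ _ fun j hj => ?_
    have := mt (h₀ j).2 (Finset.mem_sdiff.1 hj).2
    omega
  have e5 : ∑ j ∈ S₀ \ S, (j : ℕ) + #(S₀ \ S) ≤ #(S₀ \ S) * m := by
    rw [Finset.card_eq_sum_ones, ← Finset.sum_add_distrib, Finset.sum_mul]
    refine Finset.sum_le_sum fun j hj => ?_
    have := (h₀ j).1 (Finset.mem_sdiff.1 hj).1
    omega
  rw [hc] at e4 hpos
  omega

end Combinatorics

/-! ### Ultrametric determinants -/

section Ultrametric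

variable {K : Type*} [NormedField K]

theorem norm_units_intCast (u : ℤˣ) : ‖((u : ℤ) : K)‖ = 1 := by
  rcases Int.units_eq_one_or u with rfl | rfl <;> simp

variable [IsUltrametricDist K]

theorem norm_eq_of_norm_sub_lt {x y : K} (h : ‖x - y‖ < ‖y‖) : ‖x‖ = ‖y‖ := by
  have := IsUltrametricDist.norm_eq_of_add_norm_lt_max (x := x) (y := -y)
    (by rw [← sub_eq_add_neg, norm_neg]; exact lt_max_of_lt_right h)
  rwa [norm_neg] at this

theorem norm_prod_sub_prod_le {ι : Type*} (s : Finset ι) {f g : ι → K} {ε : ℝ} (hε : 0 ≤ ε)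
    (hf : ∀ i, ‖f i‖ ≤ 1) (hg : ∀ i, ‖g i‖ ≤ 1) (h : ∀ i, ‖f i - g i‖ ≤ ε) :
    ‖∏ i ∈ s, f i - ∏ i ∈ s, g i‖ ≤ ε := by
  classical
  induction s using Finset.induction_on with
  | empty => simpa using hε
  | insert a s ha ih =>
    rw [Finset.prod_insert ha, Finset.prod_insert ha,
      show f a * ∏ i ∈ s, f i - g a * ∏ i ∈ s, g i =
        f a * (∏ i ∈ s, f i - ∏ i ∈ s, g i) + (f a - g a) * ∏ i ∈ s, g i by ring]
    refine norm_add_le_of_le ?_ ?_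
    · rw [norm_mul]
      exact (mul_le_of_le_one_left (norm_nonneg _) (hf a)).trans ih
    · rw [norm_mul, norm_prod]
      refine (mul_le_of_le_one_right (norm_nonneg _) ?_).trans (h a)
      exact Finset.prod_le_one (fun _ _ => norm_nonneg _) fun i _ => hg i

theorem norm_det_le_of_columns {ι : Type*} [Fintype ι] [DecidableEq ι] (M : Matrix ι ι K) {r : ℝ}
    (hr : 0 ≤ r) (e : ι → ℕ) (h : ∀ i j, ‖M i j‖ ≤ r ^ e j) : ‖M.det‖ ≤ r ^ ∑ j, e j := by
  rw [Matrix.det_apply']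
  refine IsUltrametricDist.norm_sum_le_of_forall_le_of_nonneg (by positivity) fun δ _ => ?_
  rw [norm_mul, norm_units_intCast, one_mul, norm_prod, ← Finset.prod_pow_eq_pow_sum]
  exact Finset.prod_le_prod (fun _ _ => norm_nonneg _) fun i _ => h _ _

open Classical in
/-- A determinant whose terms have a dominant part of known norm. -/
theorem norm_det_eq {m : ℕ} (M : Matrix (Fin m) (Fin m) K) {π : K} (h0 : π ≠ 0) (h1 : ‖π‖ < 1)
    {E k : Fin m → Fin m → ℕ} {τ : K} (hτ : ‖τ‖ = 1) {c : Fin m → Fin m → K}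
    (hc : ∀ i j, ‖c i j‖ ≤ 1) {b d : ℕ} {ε : Fin m → ℕ} (hE : ∀ i j, E i j = ε j + (d + 1) * k i j)
    (hM : ∀ i j, ∃ e : K, ‖e‖ ≤ ‖π‖ ∧ M i j = π ^ E i j * (τ ^ k i j * c i j + e))
    (hmin : ∀ δ : Equiv.Perm (Fin m), b ≤ ∑ i, k i (δ i))
    (hlead : ‖∑ δ : Equiv.Perm (Fin m), if ∑ i, k i (δ i) = b then
      ((Equiv.Perm.sign δ : ℤ) : K) * ∏ i, c i (δ i) else 0‖ = 1) :
    ‖M.det‖ = ‖π‖ ^ (∑ j, ε j + (d + 1) * b) := by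
  have hr : 0 < ‖π‖ := norm_pos_iff.2 h0
  choose e he hMe using hM
  set T := ∑ j, ε j + (d + 1) * b with hT
  have hsumE : ∀ δ : Equiv.Perm (Fin m), ∑ i, E i (δ i) = ∑ j, ε j + (d + 1) * ∑ i, k i (δ i) :=
    fun δ => by
      simp only [hE]
      rw [Finset.sum_add_distrib, ← Finset.mul_sum, Equiv.sum_comp δ ε]
  have hmain : ‖M.det - π ^ T * (τ ^ b * ∑ δ : Equiv.Perm (Fin m), if ∑ i, k i (δ i) = b then
      ((Equiv.Perm.sign δ : ℤ) : K) * ∏ i, c i (δ i) else 0)‖ ≤ ‖π‖ ^ (T + 1) := by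
    -- Transposing pairs row `i` with column `δ i`, as in the sums `∑ k i (δ i)`. Permutations with
    -- a larger sum gain at least `π^{d+1}`.
    rw [← Matrix.det_transpose, Matrix.det_apply', Finset.mul_sum, Finset.mul_sum,
      ← Finset.sum_sub_distrib]
    refine IsUltrametricDist.norm_sum_le_of_forall_le_of_nonneg (by positivity) fun δ _ => ?_
    have hprod : ∏ i, M.transpose (δ i) i =
        π ^ (∑ i, E i (δ i)) * ∏ i, (τ ^ k i (δ i) * c i (δ i) + e i (δ i)) := by
      rw [← Finset.prod_pow_eq_pow_sum, ← Finset.prod_mul_distrib]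
      exact Finset.prod_congr rfl fun i _ => hMe _ _
    have hg : ∀ i, ‖τ ^ k i (δ i) * c i (δ i)‖ ≤ 1 := fun i => by
      rw [norm_mul, norm_pow, hτ, one_pow, one_mul]; exact hc _ _
    have hf : ∀ i, ‖τ ^ k i (δ i) * c i (δ i) + e i (δ i)‖ ≤ 1 := fun i =>
      norm_add_le_of_le (hg i) ((he _ _).trans h1.le)
    rw [hprod]
    split_ifs with hb
    · have hpow : τ ^ b * ∏ i, c i (δ i) = ∏ i, (τ ^ k i (δ i) * c i (δ i)) := by
        rw [Finset.prod_mul_distrib, Finset.prod_pow_eq_pow_sum, hb]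
      rw [hsumE, hb, ← hT, show ∀ s P Q : K, s * (π ^ T * P) - π ^ T * (τ ^ b *
        (s * Q)) = s * π ^ T * (P - τ ^ b * Q) from fun s P Q => by ring, hpow,
        norm_mul, norm_mul, norm_units_intCast, one_mul, norm_pow, pow_succ]
      gcongr
      exact norm_prod_sub_prod_le _ hr.le hf hg fun i => by
        rw [add_sub_cancel_left]; exact he _ _
    · rw [mul_zero, mul_zero, sub_zero, norm_mul, norm_units_intCast, one_mul, norm_mul, norm_pow,
        norm_prod]
      refine (mul_le_of_le_one_right (by positivity)
        (Finset.prod_le_one (fun _ _ => norm_nonneg _) fun i _ => hf i)).trans ?_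
      refine pow_le_pow_of_le_one hr.le h1.le ?_
      have h2 := lt_of_le_of_ne (hmin δ) (Ne.symm hb)
      have h3 : (d + 1) * (b + 1) ≤ (d + 1) * ∑ i, k i (δ i) := by gcongr; omega
      rw [hsumE, hT]
      linarith [Nat.zero_le d]
  have hl : ‖π ^ T * (τ ^ b * ∑ δ : Equiv.Perm (Fin m), if ∑ i, k i (δ i) = b then
      ((Equiv.Perm.sign δ : ℤ) : K) * ∏ i, c i (δ i) else 0)‖ = ‖π‖ ^ T := by
    rw [norm_mul, norm_mul, hlead, norm_pow, norm_pow, hτ]; simp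
  rw [← hl]
  refine norm_eq_of_norm_sub_lt ?_
  rw [hl]
  exact hmain.trans_lt (pow_lt_pow_right_of_lt_one₀ hr h1 (Nat.lt_succ_self _))

end Ultrametric

end LeadingDeterminant

section CharacteristicSeries

/-! ### The coefficients of the characteristic series -/

theorem le_maxDet {n m : ℕ} {x : Fin m → ℕ} (hx : Function.Injective x) (hxn : ∀ i, x i < n) :
    (vandermondeLike m fun i => (x i : ℤ)).det.natAbs ≤ maxDet n m := by
  let y : Fin m ↪ Fin n :=
    ⟨fun i => ⟨x i, hxn i⟩, fun i j hij => hx (Fin.ext_iff.1 hij)⟩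
  have := Finset.le_sup (f := fun x : Fin m ↪ Fin n =>
    (vandermondeLike m fun i => ((x i : ℕ) : ℤ)).det.natAbs) (Finset.mem_univ y)
  exact this

/-! ### Residues of `-p j` modulo `n` -/

section Residues

variable {p n : ℕ}

theorem alphaInt_zero_injOn (hpn : Nat.Coprime p n) {i j : ℕ} (hi : i < n) (hj : j < n)
    (h : alphaInt p n 0 (i : ℤ) = alphaInt p n 0 (j : ℤ)) : i = j := by
  rw [alphaInt_eq_emod, alphaInt_eq_emod, Int.emod_eq_emod_iff_emod_sub_eq_zero,
    show (0 - p * (i : ℤ) - (0 - p * (j : ℤ))) = p * (j - i) by ring] at h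
  have h1 : (n : ℤ) ∣ j - i :=
    (Nat.isCoprime_iff_coprime.2 hpn.symm).dvd_of_dvd_mul_left (Int.dvd_of_emod_eq_zero h)
  have h2 := Int.eq_zero_of_abs_lt_dvd h1 (abs_lt.2 ⟨by omega, by omega⟩)
  omega

/-- Row `i` only translates the residue of row 0 by `i < n`, so at most one subtraction of `n`
occurs. -/
theorem alphaInt_eq_wrap (hn : 1 ≤ n) {i : ℕ} (hi : i < n) (j : ℤ) :
    alphaInt p n (i : ℤ) j = wrap n (alphaInt p n 0 j).toNat i := by
  have h0 := alphaInt_nonneg p hn 0 j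
  have h1 := alphaInt_lt p hn 0 j
  have e : alphaInt p n (i : ℤ) j = (i + alphaInt p n 0 j) % n := by
    rw [alphaInt_eq_emod, alphaInt_eq_emod, Int.add_emod_emod]
    congr 1; ring
  obtain ⟨r, hr⟩ := Int.eq_ofNat_of_zero_le h0
  rw [e, hr, Int.toNat_natCast, wrap]
  rw [hr] at h1
  split_ifs with h
  · rw [Int.emod_eq_of_lt (by positivity) (by omega)]; push_cast; ring
  · rw [← Int.sub_emod_right, Int.emod_eq_of_lt (by omega) (by omega)]
    omega

theorem mul_div_alphaInt (hn : 1 ≤ n) (j : ℕ) :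
    n * ((p * j + (alphaInt p n 0 j).toNat) / n) = p * j + (alphaInt p n 0 j).toNat := by
  refine Nat.mul_div_cancel' ?_
  zify
  rw [Int.toNat_of_nonneg (alphaInt_nonneg p hn 0 j), alphaInt_eq_emod, Int.emod_def]
  exact ⟨-((0 - p * (j : ℤ)) / n), by ring⟩

end Residues

variable {K : Type*} [NormedField K] {p n m : ℕ} {π t : K} {σ : K ≃+* K}

theorem norm_intCast_eq_one (hNat : ∀ N : ℕ, ¬ p ∣ N → ‖(N : K)‖ = 1) {z : ℤ} (h0 : z ≠ 0)
    (hz : z.natAbs < p) : ‖(z : K)‖ = 1 := by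
  have := hNat z.natAbs (Nat.not_dvd_of_pos_of_lt (Int.natAbs_pos.2 h0) hz)
  rcases Int.natAbs_eq z with h | h
  · rw [h]; simpa using this
  · rw [h]; simpa using this

theorem norm_leadCoeff_eq_one [CharZero K] (hp : p.Prime)
    (hNat : ∀ N : ℕ, ¬ p ∣ N → ‖(N : K)‖ = 1)
    {r L i : ℕ} (hr : r < n) (hi : i < n) (hn : n < p) (hL : L < p) :
    ‖((leadCoeff n r L i : ℚ) : K)‖ = 1 := by
  have hfac : ∀ k < p, ‖((k.factorial : ℕ) : K)‖ = 1 := fun k hk =>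
    hNat _ fun h => hk.not_ge ((hp.dvd_factorial).1 h)
  rw [leadCoeff]
  push_cast
  rw [norm_div, norm_mul, norm_pow, hfac _ ((wrap_lt hi hr).trans hn), hfac _ (by split_ifs <;> omega)]
  simp

variable [IsUltrametricDist K] [CompleteSpace K] [CharZero K]

/-- The norm of the leading principal minors of the Frobenius matrix. -/
theorem norm_leading_minor (h : IsTwistFor p n σ π t) (hprime : p.Prime)
    (hNat : ∀ N : ℕ, ¬ p ∣ N → ‖(N : K)‖ = 1)
    (hAH : ∀ k, ‖((PowerSeries.coeff k (artinHasse p) : ℚ) : K)‖ ≤ 1)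
    (hσ : ∀ x, ‖σ x‖ = ‖x‖) (hσπ : σ π = π) (ht : ‖t‖ = 1)
    (hp : (2 * n + 1) * (n - 1) + 1 ≤ p - 1) (hm : 1 ≤ m) (hmn : m + 1 ≤ n)
    (hV : VandermondeAssumption n m) (hmax : maxDet n m < p)
    {A : Matrix (Fin (2 * n + 1)) (Fin (2 * n + 1)) K} (hA : IsFrobeniusMatrix p n σ π t A)
    {δ : Equiv.Perm (Fin m)} (hδ : δ ∈ minPerms p n m) (hle : m ≤ 2 * n + 1) :
    ‖(A.submatrix (Fin.castLE hle) (Fin.castLE hle)).det‖ =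
      ‖π‖ ^ ((p - 1) * ∑ i : Fin m, (i : ℕ) + (2 * n + 1) * (alphaSum p n m δ).toNat) := by
  classical
  have hnp : n < p := by
    have : 1 * (n - 1) ≤ (2 * n + 1) * (n - 1) := by gcongr; omega
    omega
  have hcop : Nat.Coprime p n :=
    (Nat.Prime.coprime_iff_not_dvd hprime).2 (Nat.not_dvd_of_pos_of_lt (by omega) hnp)
  let r : Fin m → ℕ := fun j => (alphaInt p n 0 ((j : ℕ) : ℤ)).toNat
  let L : Fin m → ℕ := fun j => (p * j + r j) / n
  have hr : ∀ j, r j < n := fun j => by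
    have := alphaInt_lt p (n := n) (by omega) 0 ((j : ℕ) : ℤ)
    simp only [r]
    omega
  have hrinj : Function.Injective r := fun i j hij => by
    refine Fin.ext (alphaInt_zero_injOn hcop (by omega) (by omega) ?_)
    have h1 := alphaInt_nonneg p (n := n) (by omega) 0 ((i : ℕ) : ℤ)
    have h2 := alphaInt_nonneg p (n := n) (by omega) 0 ((j : ℕ) : ℤ)
    simp only [r] at hij
    omega
  have hL : ∀ j, n * L j = p * j + r j := fun j => mul_div_alphaInt (by omega) _
  have hLp : ∀ j, L j < p := fun j => by
    by_contra hcon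
    have h1 : n * p ≤ n * L j := by gcongr; omega
    have h2 : p * (j + 2) ≤ p * n := by gcongr; omega
    have h3 := hr j
    have h4 := hL j
    nlinarith
  have hk : ∀ i j : Fin m, alphaInt p n ((i : ℕ) : ℤ) ((j : ℕ) : ℤ) = wrap n (r j) i :=
    fun i j => alphaInt_eq_wrap (by omega) (by omega) _
  have hsum : ∀ δ : Equiv.Perm (Fin m), alphaSum p n m δ = ∑ i : Fin m, (wrap n (r (δ i)) i : ℤ) :=
    fun δ => Finset.sum_congr rfl fun i _ => hk _ _
  have hlead := sum_leadCoeff (n := n) (r := r) L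
  -- The evaluation points are the residues in the last row. They are distinct because `p` is prime
  -- to `n`, and they lie in `[0, n-1]`, so the hypothesis on `V` applies.
  have hdet0 : (vandermondeLike m fun j => (wrap n (r j) (m - 1) : ℤ)).det ≠ 0 :=
    hV _ (fun i j hij => wrap_injective (M := m - 1) hr hrinj (by simpa using hij))
      fun i => ⟨by positivity, by have := wrap_lt (M := m - 1) (by omega) (hr i); omega⟩
  have hdet1 : (vandermondeLike m fun j => (wrap n (r j) (m - 1) : ℤ)).det.natAbs < p :=
    (le_maxDet (wrap_injective (M := m - 1) hr hrinj)
      fun i => wrap_lt (M := m - 1) (by omega) (hr i)).trans_lt hmax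
  have hlead1 : ‖((∑ δ : Equiv.Perm (Fin m),
      (if ∀ i, n ≤ r (δ i) + (m - 1) → n ≤ r (δ i) + i then
      ((Equiv.Perm.sign δ : ℤ) : ℚ) * ∏ i : Fin m, leadCoeff n (r (δ i)) (L (δ i)) i else 0) : ℚ) :
      K)‖ = 1 := by
    rw [hlead]
    simp only [Rat.cast_mul, Rat.cast_intCast, Rat.cast_prod]
    rw [norm_mul, norm_mul, norm_prod, norm_units_intCast, norm_intCast_eq_one hNat hdet0 hdet1,
      Finset.prod_eq_one fun j _ =>
        norm_leadCoeff_eq_one hprime hNat (hr j) (by omega) hnp (hLp j)]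
    simp
  -- The nonvanishing determinant itself provides a permutation attaining the bound on wraps;
  -- otherwise the sum would be empty.
  have hex : ∃ δ : Equiv.Perm (Fin m), ∀ i, n ≤ r (δ i) + (m - 1) → n ≤ r (δ i) + i := by
    by_contra hcon
    push Not at hcon
    rw [Finset.sum_eq_zero fun δ _ => if_neg (by push Not; exact hcon δ)] at hlead1
    simp at hlead1
  have hmin := minimal_iff (by omega : 0 < n) hex
  have hnn : 0 ≤ alphaSum p n m δ := by rw [hsum]; positivity
  have hb : ((alphaSum p n m δ).toNat : ℤ) = alphaSum p n m δ := Int.toNat_of_nonneg hnn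
  have hcond : ∀ δ' : Equiv.Perm (Fin m),
      ∑ i : Fin m, wrap n (r (δ' i)) i = (alphaSum p n m δ).toNat ↔
      ∀ i, n ≤ r (δ' i) + (m - 1) → n ≤ r (δ' i) + i := fun δ' => by
    rw [← hmin]
    zify
    rw [hb]
    constructor
    · intro h1 δ''
      rw [h1, ← hsum]; exact hδ δ''
    · intro h1
      have h2 := hδ δ'
      have h3 := h1 δ
      rw [← hsum] at h3 ⊢
      rw [← hsum] at h3
      exact le_antisymm h3 h2
  rw [Finset.mul_sum]
  refine norm_det_eq _ h.ne_zero h.norm_lt_one (E := fun i j => (p - 1) * (j : ℕ) + (2 * n + 1) *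
    wrap n (r j) i) (k := fun i j => wrap n (r j) i) (τ := σ.symm t)
    (by rw [← hσ, σ.apply_symm_apply, ht])
    (c := fun i j => ((leadCoeff n (r j) (L j) i : ℚ) : K))
    (fun i j => (norm_leadCoeff_eq_one hprime hNat (hr j) (by omega) hnp (hLp j)).le)
    (fun i j => rfl) (fun i j => ?_) (fun δ' => ?_) ?_
  · have hl : (n : ℤ) * ((if r j + (i : ℕ) < n then L j else L j - 1 : ℕ) : ℤ) =
        p * (j : ℕ) - (i : ℕ) + (wrap n (r j) i : ℕ) := by
      have h1 : (n : ℤ) * L j = p * (j : ℕ) + r j := by exact_mod_cast hL j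
      have h2 := i.isLt
      unfold wrap
      split_ifs with hc
      · push_cast; linarith
      · have h3 : 1 ≤ L j := by
          by_contra h4
          have h5 : L j = 0 := by omega
          have := hL j
          rw [h5, mul_zero] at this
          omega
        push_cast [Nat.cast_sub h3, Nat.cast_sub (by omega : n ≤ r j + (i : ℕ))]
        linarith
    obtain ⟨e, he, hAe⟩ := frobenius_entry h (hNat n (Nat.not_dvd_of_pos_of_lt (by omega) hnp))
      (by omega) hAH hσ hσπ ht hp hA (i := Fin.castLE hle i) (j := Fin.castLE hle j)
      (by simp; omega) (by simp; omega) (k := wrap n (r j) i)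
      (l := if r j + (i : ℕ) < n then L j else L j - 1) (by simpa using (hk i j).symm)
      (by simpa using hl)
    refine ⟨e, he, ?_⟩
    rw [Matrix.submatrix_apply, hAe, leadCoeff]
    push_cast
    simp only [Fin.val_castLE, div_eq_mul_inv, one_mul]
  · have := hδ δ'
    rw [hsum δ', ← hb] at this
    exact_mod_cast this
  · rw [← hlead1]
    congr 1
    push_cast
    refine Finset.sum_congr rfl fun δ' _ => ?_
    rw [if_congr (hcond δ') rfl rfl]
    split_ifs <;> push_cast <;> rfl

/-- The norm of the coefficients of the characteristic series of the Frobenius matrix. -/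
theorem norm_coeff_det (h : IsTwistFor p n σ π t) (hprime : p.Prime)
    (hNat : ∀ N : ℕ, ¬ p ∣ N → ‖(N : K)‖ = 1)
    (hAH : ∀ k, ‖((PowerSeries.coeff k (artinHasse p) : ℚ) : K)‖ ≤ 1)
    (hσ : ∀ x, ‖σ x‖ = ‖x‖) (hσπ : σ π = π) (ht : ‖t‖ = 1)
    (hp : (2 * n + 1) * n * (n - 1) + 1 ≤ p - 1) (hm : 1 ≤ m) (hmn : m + 1 ≤ n)
    (hV : VandermondeAssumption n m) (hmax : maxDet n m < p)
    {A : Matrix (Fin (2 * n + 1)) (Fin (2 * n + 1)) K} (hA : IsFrobeniusMatrix p n σ π t A)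
    {δ : Equiv.Perm (Fin m)} (hδ : δ ∈ minPerms p n m) :
    ‖(1 - (Polynomial.X : Polynomial K) • A.map Polynomial.C).det.coeff m‖ =
      ‖π‖ ^ ((p - 1) * ∑ i : Fin m, (i : ℕ) + (2 * n + 1) * (alphaSum p n m δ).toNat) := by
  classical
  have hr : 0 < ‖π‖ := norm_pos_iff.2 h.ne_zero
  have hle : m ≤ 2 * n + 1 := by omega
  have hnn : (2 * n + 1) * (n - 1) ≤ (2 * n + 1) * n * (n - 1) := by
    rw [mul_assoc]
    exact Nat.mul_le_mul_left _ (Nat.le_mul_of_pos_left _ (by omega))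
  have hnp : n < p := by
    have : 1 * (n - 1) ≤ (2 * n + 1) * (n - 1) := by gcongr; omega
    omega
  have hn1 : ‖(n : K)‖ = 1 := hNat n (Nat.not_dvd_of_pos_of_lt (by omega) hnp)
  set μ := (alphaSum p n m δ).toNat with hμ
  -- Each `α` is at most `n - 1` and there are `m ≤ n` of them. This is where the lower bound on `p`
  -- comes from.
  have hμle : (2 * n + 1) * μ ≤ (2 * n + 1) * n * (n - 1) := by
    rw [mul_assoc]
    refine Nat.mul_le_mul_left _ ?_
    have h1 : alphaSum p n m δ ≤ ∑ _i : Fin m, ((n : ℤ) - 1) := by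
      refine Finset.sum_le_sum fun i _ => ?_
      have := alphaInt_lt p (n := n) (by omega) ((i : ℕ) : ℤ) ((δ i : ℕ) : ℤ)
      omega
    have h2 : ∑ _i : Fin m, ((n : ℤ) - 1) = m * (n - 1) := by simp; ring
    have h3 : (m : ℤ) * (n - 1) ≤ n * (n - 1) := by gcongr <;> omega
    zify [show 1 ≤ n by omega]
    rw [hμ, Int.ofNat_toNat]
    exact max_le (by linarith) (mul_nonneg (by positivity) (by omega))
  set T := (p - 1) * ∑ i : Fin m, (i : ℕ) + (2 * n + 1) * μ with hT
  let e : Fin m → Fin (2 * n + 1) := Fin.castLE hle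
  let S₀ : Finset (Fin (2 * n + 1)) := Finset.univ.map (Fin.castLEEmb hle)
  have hS₀ : ∀ j, j ∈ S₀ ↔ (j : ℕ) < m := fun j => by
    simp only [S₀, Finset.mem_map, Finset.mem_univ, true_and]
    constructor
    · rintro ⟨i, rfl⟩; simp
    · intro hj; exact ⟨⟨j, hj⟩, by ext; simp⟩
  have hcard : S₀.card = m := by simp [S₀]
  have hminor₀ : ‖(A.submatrix (Subtype.val : S₀ → _) (Subtype.val : S₀ → _)).det‖ = ‖π‖ ^ T := by
    let E : Fin m ≃ S₀ := Equiv.ofBijective (fun i => ⟨e i, by rw [hS₀]; simp [e]⟩)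
      ⟨fun i j hij => by simpa [e, Fin.ext_iff] using hij,
        fun ⟨j, hj⟩ => ⟨⟨j, (hS₀ j).1 hj⟩, Subtype.ext (Fin.ext rfl)⟩⟩
    rw [← Matrix.det_submatrix_equiv_self E, Matrix.submatrix_submatrix]
    exact norm_leading_minor h hprime hNat hAH hσ hσπ ht (by omega) hm hmn hV hmax hA hδ hle
  have hsum₀ : ∑ j ∈ S₀, (j : ℕ) = ∑ i : Fin m, (i : ℕ) := by simp [S₀]
  -- Column divisibility alone gives at least one more factor `π^{p-1}`, which exceeds the whole
  -- contribution `(2n+1)μ` in the leading minor.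
  have hminor : ∀ S : Finset (Fin (2 * n + 1)), S.card = m → S ≠ S₀ →
      ‖(A.submatrix (Subtype.val : S → _) (Subtype.val : S → _)).det‖ ≤ ‖π‖ ^ (T + 1) := by
    intro S hS hne
    refine (norm_det_le_of_columns _ hr.le (fun j : S => (p - 1) * min (j.1 : ℕ) n)
      fun i j => ?_).trans (pow_le_pow_of_le_one hr.le h.norm_lt_one.le ?_)
    · exact norm_frobenius_entry_le h hn1 hprime.two_le hAH hσ ht hA _ _
    · have h1 := sum_min_lt (by omega : m ≤ n) S S₀ (hS.trans hcard.symm) hS₀ hne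
      rw [hsum₀] at h1
      rw [← Finset.mul_sum, Finset.sum_coe_sort S fun j : Fin (2 * n + 1) => min (j : ℕ) n]
      calc T + 1 ≤ (p - 1) * (∑ i : Fin m, (i : ℕ) + 1) := by rw [mul_add, hT]; omega
        _ ≤ _ := by gcongr
  have hneg : (1 - (Polynomial.X : Polynomial K) • A.map Polynomial.C) =
      1 + (Polynomial.X : Polynomial K) • (-A).map Polynomial.C := by
    rw [Matrix.map_neg _ (map_neg Polynomial.C), smul_neg, sub_eq_add_neg]
  rw [hneg, Matrix.coeff_det_one_add_X_smul_eq_sum_minors]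
  have hmem : S₀ ∈ Finset.univ.powersetCard m := by simp [Finset.mem_powersetCard, hcard]
  have hnegdet : ∀ S : Finset (Fin (2 * n + 1)),
      ‖((-A).submatrix (Subtype.val : S → _) (Subtype.val : S → _)).det‖ =
      ‖(A.submatrix (Subtype.val : S → _) (Subtype.val : S → _)).det‖ := fun S => by
    rw [Matrix.submatrix_neg, Pi.neg_apply, Pi.neg_apply, Matrix.det_neg, norm_mul, norm_pow, norm_neg,
      norm_one, one_pow, one_mul]
  rw [← Finset.add_sum_erase _ _ hmem, ← hminor₀, ← hnegdet S₀]
  refine norm_eq_of_norm_sub_lt ?_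
  rw [add_sub_cancel_left, hnegdet, hminor₀]
  refine lt_of_le_of_lt ?_
    (pow_lt_pow_right_of_lt_one₀ hr h.norm_lt_one (Nat.lt_succ_self T))
  refine IsUltrametricDist.norm_sum_le_of_forall_le_of_nonneg (by positivity) fun S hS => ?_
  rw [hnegdet]
  exact hminor S (Finset.mem_powersetCard.1 (Finset.mem_of_mem_erase hS)).2
    (Finset.ne_of_mem_erase hS)

end CharacteristicSeries

section SplittingField

/-! ### The field `ℚ_q(ζ_p, γ̃)` -/

section GammaSum

variable {K : Type*} [NormedField K] [IsUltrametricDist K] {p n : ℕ} {π : K}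

/-- For `d = 0` this reduces to `i + n(p-1) ≤ n(p-1) p^i`, which follows from `p^i ≥ i + 1`. Larger
`d` only helps, because `p^k` grows faster than `(p-1)k`. -/
theorem gammaSum_exponent (hp : 2 ≤ p) (hn : 1 ≤ n) (i d : ℕ) :
    n * p ^ i + i + n * (p - 1) * (d + (i + 1)) ≤ n * p ^ (d + (i + 1)) + n * (p - 1) * i := by
  obtain ⟨q, rfl⟩ : ∃ q, p = q + 1 := ⟨p - 1, by omega⟩
  rw [Nat.add_sub_cancel]
  have h2 : i + 1 ≤ (q + 1) ^ i := Nat.lt_pow_self (by omega)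
  have h3 : 1 * i ≤ n * q * i := by
    gcongr
    exact Nat.mul_pos (by omega) (by omega)
  induction d with
  | zero =>
    rw [zero_add, pow_succ]
    have := Nat.mul_le_mul_left (n * q) h2
    nlinarith
  | succ d ih =>
    have h4 : 1 ≤ (q + 1) ^ (d + (i + 1)) := Nat.one_le_pow _ _ (by omega)
    have := Nat.mul_le_mul_left (n * q) h4
    rw [show d + 1 + (i + 1) = d + (i + 1) + 1 by ring, pow_succ]
    nlinarith

/-- Since the full series sums to zero, `γ_i` is minus its tail, which is far smaller than its
individual initial terms. -/
theorem norm_gammaSum_mul_le [CharZero K] (hp : 2 ≤ p) (hn : 1 ≤ n) (h0 : π ≠ 0) (h1 : ‖π‖ ≤ 1)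
    (hpp : ‖(p : K)‖ = ‖π‖ ^ (n * (p - 1)))
    (hsum : HasSum (fun k : ℕ => (π ^ n) ^ p ^ k / (p : K) ^ k) 0) (i : ℕ) :
    ‖gammaSum p (π ^ n) i * (p : K) ^ i‖ ≤ ‖π‖ ^ (n * p ^ i + i) := by
  have hr : 0 < ‖π‖ := norm_pos_iff.2 h0
  have e := hsum.summable.sum_add_tsum_nat_add (i + 1)
  rw [hsum.tsum_eq] at e
  rw [gammaSum, eq_neg_of_add_eq_zero_left e, norm_mul, norm_neg, norm_pow, hpp, ← pow_mul,
    ← le_div_iff₀ (by positivity)]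
  refine IsUltrametricDist.norm_tsum_le_of_forall_le_of_nonneg (by positivity) fun d => ?_
  rw [norm_div, norm_pow, norm_pow, norm_pow, hpp, ← pow_mul, ← pow_mul,
    div_le_div_iff₀ (by positivity) (by positivity), ← pow_add, ← pow_add]
  exact pow_le_pow_of_le_one hr.le h1 (gammaSum_exponent hp hn i d)

end GammaSum

/-! ### Finiteness over `ℚ_p` and norms of `σ`, `γ` and the Teichmüller representatives -/

section Fields

variable (p : ℕ) [Fact p.Prime]

theorem finiteDimensional_adjoin_of_root {P : Polynomial ℚ_[p]} (hP : P ≠ 0) {S : Set ℂ_[p]}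
    (hS : ∀ z ∈ S, Polynomial.aeval z P = 0) :
    FiniteDimensional ℚ_[p] (IntermediateField.adjoin ℚ_[p] S) := by
  have hfin : S.Finite := (Polynomial.rootSet_finite P ℂ_[p]).subset fun z hz =>
    Polynomial.mem_rootSet.2 ⟨hP, hS z hz⟩
  have : Finite S := hfin
  exact IntermediateField.finiteDimensional_adjoin fun z hz =>
    IsAlgebraic.isIntegral ⟨P, hP, hS z hz⟩

theorem finiteDimensional_Qq {a : ℕ} (ha : 1 ≤ a) : FiniteDimensional ℚ_[p] (Qq p a) :=
  finiteDimensional_adjoin_of_root p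
    (FiniteField.X_pow_card_pow_sub_X_ne_zero ℚ_[p] (Nat.one_le_iff_ne_zero.1 ha)
      (Fact.out : p.Prime).one_lt)
    fun z hz => by simpa [sub_eq_zero] using hz

theorem finiteDimensional_Omega1 : FiniteDimensional ℚ_[p] (Omega1 p) :=
  finiteDimensional_adjoin_of_root p
    (Polynomial.X_pow_sub_C_ne_zero (Fact.out : p.Prime).pos 1)
    fun z hz => by simpa [sub_eq_zero] using hz

variable {p} {a n : ℕ} {γ γt : ℂ_[p]}

theorem finiteDimensional_Omega0 (ha : 1 ≤ a) (hn : 1 ≤ n) (hγ : γ ∈ Omega1 p) (h : γt ^ n = γ) :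
    FiniteDimensional ℚ_[p] (Omega0 p a γt) := by
  have h1 : IsIntegral ℚ_[p] γ := by
    have := finiteDimensional_Omega1 p
    have : IsIntegral ℚ_[p] (⟨γ, hγ⟩ : Omega1 p) := IsIntegral.of_finite _ _
    exact (IntermediateField.isIntegral_iff).1 this
  have h2 : IsIntegral ℚ_[p] γt := IsIntegral.of_pow hn (h ▸ h1)
  have := finiteDimensional_Qq p ha
  have := finiteDimensional_Omega1 p
  have : FiniteDimensional ℚ_[p] (IntermediateField.adjoin ℚ_[p] {γt}) :=
    IntermediateField.adjoin.finiteDimensional h2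
  rw [Omega0]
  infer_instance

/-- On a finite extension of `ℚ_p` the norm is the spectral norm, which depends only on the minimal
polynomial and so is invariant under automorphisms. -/
theorem norm_frobenius_eq [FiniteDimensional ℚ_[p] (Omega0 p a γt)]
    (σ : Omega0 p a γt ≃ₐ[ℚ_[p]] Omega0 p a γt) (x : Omega0 p a γt) : ‖σ x‖ = ‖x‖ := by
  rw [NormedAlgebra.norm_eq_spectralNorm ℚ_[p], NormedAlgebra.norm_eq_spectralNorm ℚ_[p] x]
  exact (spectralNorm_eq_of_equiv σ x).symm

theorem norm_pow_of_isSplittingRoot (hγ : IsSplittingRoot p γ) :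
    γ ≠ 0 ∧ ‖γ‖ ^ (p - 1) = (p : ℝ)⁻¹ := by
  have hp : p.Prime := Fact.out
  have h := hγ.2.2
  rw [ordp] at h
  have h0 : γ ≠ 0 := fun h0 => by rw [if_pos h0] at h; exact WithTop.top_ne_coe h
  rw [if_neg h0] at h
  have hlog : -Real.logb p ‖γ‖ = 1 / ((p : ℝ) - 1) := WithTop.coe_injective h
  have hp1 : (1 : ℝ) < p := by exact_mod_cast hp.one_lt
  have hpos : 0 < ‖γ‖ := norm_pos_iff.2 h0
  refine ⟨h0, Real.logb_injOn_pos hp1 (Set.mem_Ioi.2 (pow_pos hpos _))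
    (Set.mem_Ioi.2 (inv_pos.2 (by positivity))) ?_⟩
  rw [Real.logb_pow, Real.logb_inv, Real.logb_self_eq_one hp1, Nat.cast_sub hp.one_le,
    ← neg_neg (Real.logb _ _), hlog]
  have : (p : ℝ) - 1 ≠ 0 := by linarith
  push_cast
  field_simp

theorem norm_teichmuller {t : Omega0 p a γt} (ha : 1 ≤ a) (ht : t ^ p ^ a = t)
    (h0 : t ≠ 0) : ‖t‖ = 1 := by
  have h1 : 1 < p ^ a := Nat.one_lt_pow (by omega) (Fact.out : p.Prime).one_lt
  have h2 : t ^ (p ^ a - 1) = 1 := by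
    refine mul_right_cancel₀ h0 ?_
    rw [← pow_succ, Nat.sub_add_cancel h1.le, ht, one_mul]
  exact (pow_eq_one_iff_of_nonneg (norm_nonneg t) (by omega : p ^ a - 1 ≠ 0)).1
    (by rw [← norm_pow, h2, norm_one])

theorem coe_gammaSum (x : Omega0 p a γt) (i : ℕ) :
    ((gammaSum p x i : Omega0 p a γt) : ℂ_[p]) = gammaSum p (x : ℂ_[p]) i := by
  rw [gammaSum, gammaSum]
  push_cast
  rfl

theorem norm_ratCast_eq (x : ℚ) : ‖(x : Omega0 p a γt)‖ = ‖(x : ℚ_[p])‖ := by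
  rw [← map_ratCast (algebraMap ℚ_[p] (Omega0 p a γt)), norm_algebraMap']

theorem norm_natCast_eq (N : ℕ) : ‖(N : Omega0 p a γt)‖ = ‖(N : ℚ_[p])‖ := by
  rw [← map_natCast (algebraMap ℚ_[p] (Omega0 p a γt)), norm_algebraMap']

end Fields

end SplittingField

end ToricNP

/-! ### The main theorem: verification of the estimates and passage from norms to `ord_p` -/

theorem theorem3p5
    (p : ℕ) [Fact p.Prime] (a n m : ℕ) (ha : 1 ≤ a) (hn : 1 < n) (hm : 2 ≤ m) (hmn : m + 1 ≤ n)
    (hV : ToricNP.VandermondeAssumption n m)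
    (hp : max (ToricNP.maxDet n m : ℤ) (2 * (n : ℤ) ^ 3 - (n : ℤ) ^ 2 - n + 1) < p)
    (γ γt : ℂ_[p]) (hγ : ToricNP.IsSplittingRoot p γ) (hγt : γt ^ n = γ)
    (σ : ToricNP.Omega0 p a γt ≃ₐ[ℚ_[p]] ToricNP.Omega0 p a γt)
    (hσ : ToricNP.IsFrobenius p a γt σ)
    (tbar : ToricNP.Omega0 p a γt) (htbar : tbar ^ p ^ a = tbar) (htbar0 : tbar ≠ 0) :
    ToricNP.EpsIsBasis p n σ.toRingEquiv (ToricNP.gen p a γt) tbar ∧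
    (∃! A, ToricNP.IsFrobeniusMatrix p n σ.toRingEquiv (ToricNP.gen p a γt) tbar A) ∧
    ∀ A, ToricNP.IsFrobeniusMatrix p n σ.toRingEquiv (ToricNP.gen p a γt) tbar A →
      ∀ δ ∈ ToricNP.minPerms p n m,
        ToricNP.ordp p
            ((1 - (Polynomial.X : Polynomial (ToricNP.Omega0 p a γt)) •
              A.map Polynomial.C).det.coeff m) =
          (((m : ℝ) * (m - 1) / (2 * n) +
            (2 * n + 1) / (n * ((p : ℝ) - 1)) * (ToricNP.alphaSum p n m δ : ℝ) : ℝ) :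
              WithTop ℝ) := by
  open ToricNP in
  have hprime : p.Prime := Fact.out
  have hp1 : (1 : ℝ) < p := by exact_mod_cast hprime.one_lt
  obtain ⟨hmax, hp2⟩ := max_lt_iff.1 hp
  have hmax' : maxDet n m < p := by exact_mod_cast hmax
  -- The cubic in the hypothesis is `2n³ - n² - n = (2n+1)n(n-1)`.
  have hpn : (2 * n + 1) * n * (n - 1) + 1 ≤ p - 1 := by
    zify [hn.le, hprime.one_le]
    have : (2 * (n : ℤ) + 1) * n * (n - 1) = 2 * (n : ℤ) ^ 3 - (n : ℤ) ^ 2 - n := by ring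
    omega
  have hnp : n < p := by
    have : 1 * n * 1 ≤ (2 * n + 1) * n * (n - 1) := by gcongr <;> omega
    omega
  have := finiteDimensional_Omega0 (a := a) ha hn.le hγ.1 hγt
  have : CompleteSpace (Omega0 p a γt) := FiniteDimensional.complete ℚ_[p] _
  have hσn : ∀ x, ‖σ.toRingEquiv x‖ = ‖x‖ := norm_frobenius_eq σ
  have ht : ‖tbar‖ = 1 := norm_teichmuller ha htbar htbar0
  have hNat : ∀ N : ℕ, ¬ p ∣ N → ‖(N : Omega0 p a γt)‖ = 1 := fun N hN => by
    rw [norm_natCast_eq, Padic.norm_natCast_eq_one_iff]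
    exact (Nat.Prime.coprime_iff_not_dvd hprime).2 hN
  have hAH : ∀ k, ‖((PowerSeries.coeff k (artinHasse p) : ℚ) : Omega0 p a γt)‖ ≤ 1 := fun k => by
    rw [norm_ratCast_eq]; exact norm_coeff_artinHasse_le p k
  obtain ⟨hγ0, hγn⟩ := norm_pow_of_isSplittingRoot hγ
  have hγt0 : γt ≠ 0 := by
    rintro rfl
    exact hγ0 (by rw [← hγt, zero_pow (by omega)])
  have hrn : ‖γt‖ ^ (n * (p - 1)) = (p : ℝ)⁻¹ := by rw [pow_mul, ← norm_pow, hγt, hγn]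
  have hr1 : ‖γt‖ < 1 := by
    by_contra hcon
    have h1 := one_le_pow₀ (not_lt.1 hcon) (n := n * (p - 1))
    rw [hrn] at h1
    exact absurd h1 (not_le.2 (inv_lt_one_of_one_lt₀ hp1))
  have hg : ‖gen p a γt‖ = ‖γt‖ := rfl
  have hpp : ‖(p : ℂ_[p])‖ = ‖γt‖ ^ (n * (p - 1)) := by
    rw [hrn, ← map_natCast (algebraMap ℚ_[p] ℂ_[p]), norm_algebraMap', Padic.norm_p]
  have hsum : HasSum (fun k : ℕ => (γt ^ n) ^ p ^ k / (p : ℂ_[p]) ^ k) 0 := by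
    rw [hγt]; exact hγ.2.1
  have H : IsTwistFor p n σ.toRingEquiv (gen p a γt) tbar :=
    { one_le_n := hn.le
      ne_zero := fun h => hγt0 (congrArg Subtype.val h)
      norm_lt_one := hr1
      g_zero := by simp [gammaSum]
      norm_g := fun i => by
        -- The estimate is made in `ℂ_p`, where the series is known to sum to zero, and is carried
        -- back along the isometric inclusion.
        have := norm_gammaSum_mul_le hprime.two_le hn.le hγt0 hr1.le hpp hsum i
        change ‖((gammaSum p (gen p a γt ^ n) i * (p : Omega0 p a γt) ^ i : Omega0 p a γt) :
          ℂ_[p])‖ ≤ ‖γt‖ ^ _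
        push_cast
        rw [coe_gammaSum]
        exact this
      norm_tau := fun i => by
        induction i with
        | zero => exact ht
        | succ i ih => rw [Function.iterate_succ_apply']; exact (hσn _).trans ih }
  have hn1 := hNat n (Nat.not_dvd_of_pos_of_lt (by omega) hnp)
  refine ⟨epsIsBasis H hn1, existsUnique_frobeniusMatrix H hn1 hprime.two_le hAH hσn ht,
    fun A hA δ hδ => ?_⟩
  have hb := norm_coeff_det H hprime hNat hAH hσn hσ.2.2 ht hpn (by omega) hmn hV hmax' hA hδ
  rw [hg] at hb
  have hγtpos : 0 < ‖γt‖ := norm_pos_iff.2 hγt0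
  -- This is `ord_p γ̃ = 1/(n(p-1))`, which converts the exponent of `‖γ̃‖` into `ord_p b_m`.
  have hlog : Real.logb p ‖γt‖ = -(1 / (n * ((p : ℝ) - 1))) := by
    have h1 := congrArg (Real.logb p) hrn
    rw [Real.logb_pow, Real.logb_inv, Real.logb_self_eq_one hp1] at h1
    push_cast [Nat.cast_sub hprime.one_le] at h1
    have h2 : (n : ℝ) * (p - 1) ≠ 0 :=
      mul_ne_zero (by positivity) (by linarith)
    rw [← neg_div, eq_div_iff h2, mul_comm]
    exact h1
  have hα : 0 ≤ alphaSum p n m δ := Finset.sum_nonneg fun i _ => alphaInt_nonneg p hn.le _ _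
  have hα' : ((alphaSum p n m δ).toNat : ℝ) = (alphaSum p n m δ : ℝ) := by
    exact_mod_cast congrArg (Int.cast : ℤ → ℝ) (Int.toNat_of_nonneg hα)
  have hgauss : ((∑ i : Fin m, (i : ℕ) : ℕ) : ℝ) = m * (m - 1) / 2 := by
    rw [Fin.sum_univ_eq_sum_range (fun i => i), eq_div_iff two_ne_zero]
    have := Finset.sum_range_id_mul_two m
    have h2 : (((∑ i ∈ Finset.range m, i) * 2 : ℕ) : ℝ) = ((m * (m - 1) : ℕ) : ℝ) := by rw [this]
    push_cast [Nat.cast_sub (by omega : 1 ≤ m)] at h2 ⊢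
    exact h2
  rw [ordp, if_neg (norm_pos_iff.1 (by rw [hb]; positivity)), hb, Real.logb_pow, hlog]
  congr 1
  push_cast [Nat.cast_sub hprime.one_le]
  push_cast at hgauss
  rw [hgauss, hα']
  have h2 : (p : ℝ) - 1 ≠ 0 := by linarith
  have h3 : (n : ℝ) ≠ 0 := by positivity
  field_simp
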